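/- **Model.** Algorithms are probabilistic programs over immutable binary trees (S-expressions), built from: the identity, the constant empty tree, first and second component, a fair coin toss, pairing the results of two programs, sequential composition, branching on whether the first component of the input is empty, and a while loop with the same test. Programs are executed by an abstract machine with a stack of continuation frames; the time is the number of its transitions. An algorithm has running time $t$ on a set of inputs if on each of these inputs, for every outcome of its coins, it halts after at most $t$ steps. Bits and lists are represented by trees in the usual way, numbers in unary, and every program by a tree, its code. A probabilistic algorithm computes $g$ on at least a $\delta$ fraction of the inputs if it outputs $g(\bar x)$ with probability at least $\delta$ over a uniform input $\bar x$ and its coins. For $f:\{0,1\}^n\to\{0,1\}$ and $\bar x=(x_1,\dots,x_k)\in(\{0,1\}^n)^k$ let $f^k(\bar x)=(f(x_1),\dots,f(x_k))$ and $f^{\oplus k}(\bar x)=f(x_1)\oplus\dots\oplus f(x_k)$. **Theorem ($k$-wise Direct Product to $k$-wise XOR).** There are a probabilistic algorithm $A$ and absolute constants $\alpha>0$ and $D,e\in\mathbb N$ with the following property. Let $k\in\mathbb N$ and let $0<\epsilon<1$ be a real number with $\epsilon>2^{-k}$. Let $n,t\in\mathbb N$ with $t\ge n$, let $f:\{0,1\}^n\to\{0,1\}$,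 and let $C'$ be a (possibly probabilistic) algorithm with running time $t$ on $(\{0,1\}^n)^k$ that computes $f^{\oplus k}$ on at least a $\frac12+\epsilon$ fraction of the inputs. Given $k$, $\lceil 1/\epsilon\rceil$ and the code of $C'$, the algorithm $A$ halts and, for every outcome of its coins, outputs the code of a probabilistic algorithm $C$ that computes $f^k$ on at least an $\alpha\epsilon^4$ fraction of the inputs, with a running time $t'$ on $(\{0,1\}^n)^k$ that satisfies $t'\le D\,(k/\epsilon)^e\cdot t$. -/

import Mathlib

namespace DPXor

/-! ### The model of computation

Programs manipulate binary trees (S-expressions), the only data type.  Trees are immutable and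
shared, so forming a pair, projecting and copying a reference take one step each.  Programs are
executed by an abstract machine with an explicit stack of continuation frames; one unit of time is
one transition of this machine. -/

/-- Binary trees, the data on which programs work. -/
inductive Val : Type
  | nil : Val
  | cons (a b : Val) : Val

namespace Val

/-- First component; the empty tree is its own first component. -/
def fst : Val → Val
  | nil => nil
  | cons a _ => a

/-- Second component; the empty tree is its own second component. -/
def snd : Val → Val
  | nil => nil
  | cons _ b => b

/-- Whether a tree is empty. -/
def isNil : Val → Bool
  | nil => true
  | cons _ _ => false

/-- A truth value as a tree. -/
def ofBool : Bool → Val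
  | false => nil
  | true => cons nil nil

/-- A list of trees as a tree. -/
def ofList : List Val → Val
  | [] => nil
  | a :: l => cons a (ofList l)

/-- A natural number as a tree, in unary. -/
def ofNat (m : ℕ) : Val := ofList (List.replicate m nil)

/-- A bit string as a tree: the list of its bits. -/
def ofBits {n : ℕ} (x : Fin n → Bool) : Val := ofList (List.ofFn fun j => ofBool (x j))

/-- A `k`-tuple of `n`-bit strings as a tree: the list of these strings. -/
def ofTuple {k n : ℕ} (x : Fin k → Fin n → Bool) : Val := ofList (List.ofFn fun i => ofBits (x i))

end Val

/-- Probabilistic programs.  A program takes one tree as its input and returns one tree. -/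
inductive Prog : Type
  /-- return the input -/
  | id : Prog
  /-- return the empty tree -/
  | nil : Prog
  /-- return the first component of the input -/
  | fst : Prog
  /-- return the second component of the input -/
  | snd : Prog
  /-- toss a fair coin and return its outcome -/
  | coin : Prog
  /-- run `p` and then `q` on the input, return the pair of the results -/
  | pair (p q : Prog) : Prog
  /-- run `p` on the input, then `q` on the result -/
  | seq (p q : Prog) : Prog
  /-- run `q` on the input if the first component of the input is empty, else run `p` on it -/
  | ite (p q : Prog) : Prog
  /-- while the first component of the current tree is nonempty, replace the tree by the result
  of `p` on it -/
  | loop (p : Prog) : Prog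

/-- Programs as data: the tree that represents a program. -/
def Prog.code : Prog → Val
  | .id => .cons (.ofNat 0) .nil
  | .nil => .cons (.ofNat 1) .nil
  | .fst => .cons (.ofNat 2) .nil
  | .snd => .cons (.ofNat 3) .nil
  | .coin => .cons (.ofNat 4) .nil
  | .pair p q => .cons (.ofNat 5) (.cons p.code q.code)
  | .seq p q => .cons (.ofNat 6) (.cons p.code q.code)
  | .ite p q => .cons (.ofNat 7) (.cons p.code q.code)
  | .loop p => .cons (.ofNat 8) p.code

/-- Continuation frames: what remains to be done with a result. -/
inductive Frame : Type
  /-- the result is a first component; the second one is obtained by running `q` on `v` -/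
  | pairLeft (q : Prog) (v : Val) : Frame
  /-- the result is a second component, to be paired with `a` -/
  | pairRight (a : Val) : Frame
  /-- run `q` on the result -/
  | seqNext (q : Prog) : Frame
  /-- continue the loop with body `p` on the result -/
  | loopNext (p : Prog) : Frame

/-- Configurations of the machine: about to run `p` on `v`, or about to return `v`, in both cases
with a stack of frames. -/
inductive Config : Type
  | call (p : Prog) (v : Val) (K : List Frame) : Config
  | ret (v : Val) (K : List Frame) : Config

/-- One transition of the machine.  A configuration that returns to the empty stack is final. -/
noncomputable def step : Config → PMF Config
  | .call .id v K => PMF.pure (.ret v K)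
  | .call .nil _ K => PMF.pure (.ret .nil K)
  | .call .fst v K => PMF.pure (.ret v.fst K)
  | .call .snd v K => PMF.pure (.ret v.snd K)
  | .call .coin _ K => (PMF.uniformOfFintype Bool).map fun b => .ret (.ofBool b) K
  | .call (.pair p q) v K => PMF.pure (.call p v (.pairLeft q v :: K))
  | .call (.seq p q) v K => PMF.pure (.call p v (.seqNext q :: K))
  | .call (.ite p q) v K => PMF.pure (bif v.fst.isNil then .call q v K else .call p v K)
  | .call (.loop p) v K => PMF.pure (bif v.fst.isNil then .ret v K else .call p v (.loopNext p :: K))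
  | .ret v [] => PMF.pure (.ret v [])
  | .ret a (.pairLeft q v :: K) => PMF.pure (.call q v (.pairRight a :: K))
  | .ret b (.pairRight a :: K) => PMF.pure (.ret (.cons a b) K)
  | .ret v (.seqNext q :: K) => PMF.pure (.call q v K)
  | .ret v (.loopNext p :: K) => PMF.pure (.call (.loop p) v K)

/-- The distribution of the configuration after `t` transitions. -/
noncomputable def runFor : ℕ → Config → PMF Config
  | 0, c => PMF.pure c
  | t + 1, c => (step c).bind (runFor t)

/-- The distribution of the configuration of `p` on input `v` after `t` transitions. -/
noncomputable def Prog.run (p : Prog) (t : ℕ) (v : Val) : PMF Config := runFor t (.call p v [])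

/-- On input `v`, whatever the coins, `p` halts after at most `t` steps. -/
def Prog.HaltsWithin (p : Prog) (t : ℕ) (v : Val) : Prop :=
  ∀ c ∈ (p.run t v).support, ∃ w, c = .ret w []

/-- The probability, over the coins, that on input `v` the program `p` has halted
after `t` steps with output `w`. -/
noncomputable def Prog.outProb (p : Prog) (t : ℕ) (v w : Val) : ℝ :=
  (p.run t v (.ret w [])).toReal

/-- `p` has running time `t` on the `k`-tuples of `n`-bit strings. -/
def Prog.HasTime (p : Prog) (k n t : ℕ) : Prop :=
  ∀ x : Fin k → Fin n → Bool, p.HaltsWithin t (.ofTuple x)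

/-- The fraction of the `k`-tuples of `n`-bit strings on which `p`, run for `t` steps,
outputs `g x`: the probability of this event over a uniform tuple `x` and the coins of `p`. -/
noncomputable def Prog.success (p : Prog) (k n t : ℕ) (g : (Fin k → Fin n → Bool) → Val) : ℝ :=
  (∑ x : Fin k → Fin n → Bool, p.outProb t (.ofTuple x) (g x)) /
    Fintype.card (Fin k → Fin n → Bool)

/-! ### Direct product and XOR -/

/-- The `k`-wise direct product of `f`. -/
def directProduct {n : ℕ} (f : (Fin n → Bool) → Bool) (k : ℕ) (x : Fin k → Fin n → Bool) :
    Fin k → Bool :=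
  fun i => f (x i)

/-- The `k`-wise XOR of `f`. -/
def xorPower {n : ℕ} (f : (Fin n → Bool) → Bool) (k : ℕ) (x : Fin k → Fin n → Bool) : Bool :=
  (List.ofFn fun i => f (x i)).foldr Bool.xor false

end DPXor

/-! Put `m = ⌈1/ε⌉`. By `le_expect_advantage` the output of `C'` has correlation at least `2ε ≥ 2/m`
with the parity of the values of `f` on a random `k`-tuple. The program `C` mixes its input with
further random strings, views the answers of `C'` on sub-tuples indexed by `r ∈ {0,1}^K` as a noisy
character of `r`, and list decodes this character. The difficulty is to lose only `ε^4`.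

List decoding (`E_listDecode_ge`). Let `G` be the mean answer and `M` the wanted vector. A random
linear hash to `l` bits is drawn and the hash value of `M` is guessed. The mean of `G(r) G(r + u +
cs)`, twisted by the character of the guess at `s`, is the sum of `coef G M'^2 * chi M' u` over the
`M'` with the guessed hash value (`E_sample`). If `2^(-l)` is a small multiple of `coef G M ^ 2`,
then by Parseval and pairwise independence `M` usually dominates its bucket, and a majority over
many samples reads off each bit of `M`. The right `l` is unknown; a geometric choice makes the
success probability linear in the correlation, of order `(|coef| - 1/q) / q`. Linearity allows
averaging over the random strings without loss.

Few coordinates, `k < 512 m^2` (`expect_strategyOne`). Add `k` random strings, and let `r` select a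
subset of the `2k` strings; sizes other than `k` are answered by a coin. The mean correlation is
`2ε` times the central binomial probability, which is of order `1/√k`, hence of order at least
`1/m^2`. Decoding with `q` of order `m^2` succeeds with probability of order `1/m^4`.

Many coordinates, `k ≥ 512 m^2` (`expect_strategyTwo`). Take a prime `P` with `k/2 ≤ P ≤ k` and fill
the input up to `2P` strings `x_a`, `y_a` with `a` in `ZMod P`. A query chooses one string of each
pair and appends `k - P` random strings, so every `r` gives a legal tuple and no binomial factor is
lost: the differences `f(x_a) + f(y_a)` are decoded with mean probability `τ` of order at least
`1/m^2`. The same is done for the pairs `x_{a+1}`, `y_a`. Both matchings together form one cycle, so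
the two vectors of differences and one guessed bit give all values (`recon_weave`). Both decodings
must succeed on the same strings. For this the query is read along the cycle in steps of a random
size `e`; in query coordinates the second matching is then a shift by `d = 1/e`. The decoding gains
for the different shifts form a stationary family, and since the variance of their sum is
nonnegative, the mean product of the gains at `0` and at a nonzero shift is about `τ^2`
(`sum_pair_ge`, `gain_pairs`). This is again of order `1/m^4`. The program tosses a coin to choose a
strategy (`expect_mainAlg`).

All of this has to be a program of the given machine. Its behaviour is described by finite
coin-tossing trees (`Sim`), and running times are bounded by powers of one number `B`, polynomial in
`k/ε`, times `t` (`Run`, `run_progP`). The text of the program around the copies of `C'` is fixed up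
to the numeral `m`, so a fixed program can write it (`exists_builder`). -/

namespace DPXor

/-! ### Coin-tossing decision trees -/

/-- A finite random experiment with fair coins. -/
inductive Dt (α : Type) : Type
  | ret (a : α) : Dt α
  | flip (f : Bool → Dt α) : Dt α

namespace Dt
variable {α β γ : Type}

def bind : Dt α → (α → Dt β) → Dt β
  | ret a, g => g a
  | flip f, g => flip fun b => (f b).bind g

def map (f : α → β) (m : Dt α) : Dt β := m.bind fun a => ret (f a)

/-- A fair coin. -/
def coin : Dt Bool := flip ret

/-- All outcomes satisfy `P`. -/
def All (P : α → Prop) : Dt α → Prop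
  | ret a => P a
  | flip f => ∀ b, (f b).All P

/-- Expected value. -/
noncomputable def E : Dt α → (α → ℝ) → ℝ
  | ret a, g => g a
  | flip f, g => ((f false).E g + (f true).E g) / 2

noncomputable def pmf : Dt α → PMF α
  | ret a => PMF.pure a
  | flip f => (PMF.uniformOfFintype Bool).bind fun b => (f b).pmf

@[simp] theorem ret_bind (a : α) (g : α → Dt β) : (ret a).bind g = g a := rfl
@[simp] theorem flip_bind (f : Bool → Dt α) (g : α → Dt β) :
    (flip f).bind g = flip fun b => (f b).bind g := rfl
@[simp] theorem ret_map (a : α) (g : α → β) : (ret a).map g = ret (g a) := rfl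
@[simp] theorem flip_map (f : Bool → Dt α) (g : α → β) :
    (flip f).map g = flip fun b => (f b).map g := rfl

theorem bind_assoc (m : Dt α) (g : α → Dt β) (h : β → Dt γ) :
    (m.bind g).bind h = m.bind fun a => (g a).bind h := by
  induction m with
  | ret a => rfl
  | flip f ih => simp [ih]

theorem bind_ret (m : Dt α) : m.bind ret = m := by
  induction m with
  | ret a => rfl
  | flip f ih => simp [ih]

theorem map_bind (m : Dt α) (g : α → β) (h : β → Dt γ) :
    (m.map g).bind h = m.bind fun a => h (g a) := bind_assoc _ _ _

theorem bind_map (m : Dt α) (g : α → Dt β) (h : β → γ) :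
    (m.bind g).map h = m.bind fun a => (g a).map h := bind_assoc _ _ _

theorem map_map (m : Dt α) (g : α → β) (h : β → γ) :
    (m.map g).map h = m.map fun a => h (g a) := bind_assoc _ _ _

theorem map_id (m : Dt α) : m.map (fun a => a) = m := bind_ret m

@[simp] theorem All_ret (P : α → Prop) (a : α) : (ret a).All P ↔ P a := Iff.rfl
@[simp] theorem All_flip (P : α → Prop) (f : Bool → Dt α) :
    (flip f).All P ↔ ∀ b, (f b).All P := Iff.rfl

theorem All.mono {P Q : α → Prop} {m : Dt α} (h : m.All P) (hPQ : ∀ a, P a → Q a) : m.All Q := by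
  induction m with
  | ret a => exact hPQ a h
  | flip f ih => exact fun b => ih b (h b)

theorem All_of_forall {P : α → Prop} (m : Dt α) (h : ∀ a, P a) : m.All P := by
  induction m with
  | ret a => exact h a
  | flip f ih => exact fun b => ih b

theorem All_bind {P : β → Prop} (m : Dt α) (g : α → Dt β) :
    (m.bind g).All P ↔ m.All fun a => (g a).All P := by
  induction m with
  | ret a => rfl
  | flip f ih => exact forall_congr' fun b => ih b

theorem All_map {P : β → Prop} (m : Dt α) (g : α → β) :
    (m.map g).All P ↔ m.All fun a => P (g a) := All_bind _ _

theorem bind_congr {m : Dt α} {g h : α → Dt β} (H : m.All fun a => g a = h a) :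
    m.bind g = m.bind h := by
  induction m with
  | ret a => exact H
  | flip f ih => simp only [flip_bind]; congr 1; funext b; exact ih b (H b)

@[simp] theorem E_ret (a : α) (g : α → ℝ) : (ret a).E g = g a := rfl
theorem E_flip (f : Bool → Dt α) (g : α → ℝ) :
    (flip f).E g = ((f false).E g + (f true).E g) / 2 := rfl
theorem E_coin (g : Bool → ℝ) : coin.E g = (g false + g true) / 2 := rfl

theorem E_bind (m : Dt α) (h : α → Dt β) (g : β → ℝ) :
    (m.bind h).E g = m.E fun a => (h a).E g := by
  induction m with
  | ret a => rfl
  | flip f ih => simp [E_flip, ih]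

theorem E_map (m : Dt α) (h : α → β) (g : β → ℝ) : (m.map h).E g = m.E fun a => g (h a) :=
  E_bind _ _ _

theorem E_add (m : Dt α) (g h : α → ℝ) : (m.E fun a => g a + h a) = m.E g + m.E h := by
  induction m with
  | ret a => rfl
  | flip f ih => simp only [E_flip, ih]; ring

theorem E_mul_left (m : Dt α) (c : ℝ) (g : α → ℝ) : (m.E fun a => c * g a) = c * m.E g := by
  induction m with
  | ret a => rfl
  | flip f ih => simp only [E_flip, ih]; ring

theorem E_mul_right (m : Dt α) (c : ℝ) (g : α → ℝ) : (m.E fun a => g a * c) = m.E g * c := by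
  simp only [mul_comm _ c, E_mul_left]

theorem E_neg (m : Dt α) (g : α → ℝ) : (m.E fun a => -g a) = -m.E g := by
  simpa using E_mul_left m (-1) g

theorem E_sub (m : Dt α) (g h : α → ℝ) : (m.E fun a => g a - h a) = m.E g - m.E h := by
  simp only [sub_eq_add_neg, E_add, E_neg]

@[simp] theorem E_const (m : Dt α) (c : ℝ) : (m.E fun _ => c) = c := by
  induction m with
  | ret a => rfl
  | flip f ih => simp only [E_flip, ih]; ring

theorem E_mono {m : Dt α} {g h : α → ℝ} (H : m.All fun a => g a ≤ h a) : m.E g ≤ m.E h := by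
  induction m with
  | ret a => exact H
  | flip f ih => simp only [E_flip]; linarith [ih false (H false), ih true (H true)]

theorem E_mono' (m : Dt α) {g h : α → ℝ} (H : ∀ a, g a ≤ h a) : m.E g ≤ m.E h :=
  E_mono (All_of_forall m H)

theorem E_nonneg (m : Dt α) {g : α → ℝ} (H : ∀ a, 0 ≤ g a) : 0 ≤ m.E g := by
  simpa using E_mono' m H

theorem E_le_one (m : Dt α) {g : α → ℝ} (H : ∀ a, g a ≤ 1) : m.E g ≤ 1 := by
  simpa using E_mono' m H

theorem mem_support_pmf {P : α → Prop} {m : Dt α} (h : m.All P) : ∀ a ∈ m.pmf.support, P a := by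
  induction m with
  | ret a => simpa [pmf] using h
  | flip f ih =>
    intro a ha
    simp only [pmf, PMF.mem_support_bind_iff] at ha
    obtain ⟨b, -, hb⟩ := ha
    exact ih b (h b) a hb

open Classical in
theorem pmf_apply (m : Dt α) (a : α) : (m.pmf a).toReal = m.E fun x => if x = a then 1 else 0 := by
  induction m with
  | ret b =>
    by_cases h : b = a
    · simp [pmf, h]
    · simp [pmf, h, PMF.pure_apply, Ne.symm h]
  | flip f ih =>
    have h1 : ((f false).pmf a) ≠ ⊤ := PMF.apply_ne_top _ _
    have h2 : ((f true).pmf a) ≠ ⊤ := PMF.apply_ne_top _ _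
    simp only [pmf, PMF.bind_apply, E_flip, ← ih, tsum_fintype, Fintype.sum_bool,
      PMF.uniformOfFintype_apply, Fintype.card_bool]
    rw [ENNReal.toReal_add (ENNReal.mul_ne_top (by simp) h2) (ENNReal.mul_ne_top (by simp) h1)]
    simp [ENNReal.toReal_mul]
    ring

end Dt

/-! ### Big-step behaviour of the machine -/

/-- From the given configuration the machine returns to the stack `B` within the given number of
steps, with the given random result. -/
inductive Reach (B : List Frame) : Config → Dt Val → ℕ → Prop
  | done (w : Val) (T : ℕ) : Reach B (.ret w B) (.ret w) T
  | step {c c' : Config} {m : Dt Val} {T : ℕ} (h : DPXor.step c = PMF.pure c')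
      (h' : Reach B c' m T) : Reach B c m (T + 1)
  | coin {v : Val} {K : List Frame} {m : Bool → Dt Val} {T : ℕ}
      (h : ∀ b, Reach B (.ret (.ofBool b) K) (m b) T) : Reach B (.call .coin v K) (.flip m) (T + 1)

theorem Reach.mono {B : List Frame} {c m T} (h : Reach B c m T) : ∀ {T'}, T ≤ T' → Reach B c m T' := by
  induction h with
  | done w T => exact fun _ => .done _ _
  | step h h' ih =>
    intro T' hT
    obtain ⟨T', rfl⟩ := Nat.exists_eq_add_of_le' (Nat.lt_of_lt_of_le (Nat.succ_pos _) hT)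
    exact .step h (ih (by omega))
  | coin h ih =>
    intro T' hT
    obtain ⟨T', rfl⟩ := Nat.exists_eq_add_of_le' (Nat.lt_of_lt_of_le (Nat.succ_pos _) hT)
    exact .coin fun b => ih b (by omega)

/-- The first phase returns encodings of objects of a type `σ`. Keeping `m` typed and encoding only
at the seam lets specifications speak of lists and numbers instead of trees. -/
theorem Reach.bind {σ : Type} {e : σ → Val} {B B' : List Frame} {c T T'} {m : Dt σ}
    {g : σ → Dt Val} (h : Reach B c (m.map e) T)
    (h' : m.All fun w => Reach B' (.ret (e w) B) (g w) T') : Reach B' c (m.bind g) (T + T') := by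
  generalize hm : m.map e = m' at h
  induction h generalizing m with
  | done w T =>
    cases m with
    | flip f => simp at hm
    | ret a =>
      simp only [Dt.ret_map, Dt.ret.injEq] at hm
      subst hm
      exact Reach.mono h' (by omega)
  | step h _ ih => rw [Nat.add_right_comm]; exact .step h (ih h' hm)
  | coin h ih =>
    cases m with
    | ret a => simp at hm
    | flip f =>
      simp only [Dt.flip_map, Dt.flip.injEq] at hm
      rw [Nat.add_right_comm]
      exact .coin fun b => ih b (h' b) (congrFun hm b)

theorem runFor_ret (t : ℕ) (w : Val) : runFor t (.ret w []) = PMF.pure (.ret w []) := by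
  induction t with
  | zero => rfl
  | succ t ih => simp [runFor, step, ih]

theorem Reach.runFor {c m T} (h : Reach [] c m T) :
    runFor T c = (m.map fun w => Config.ret w []).pmf := by
  induction h with
  | done w T => simp [runFor_ret, Dt.pmf]
  | step h _ ih => simp [DPXor.runFor, h, ih]
  | coin h ih =>
    simp only [DPXor.runFor, DPXor.step, PMF.bind_map, Dt.flip_map, Dt.pmf]
    congr 1; funext b; exact ih b

def Config.app (K : List Frame) : Config → Config
  | .call p v K' => .call p v (K' ++ K)
  | .ret v K' => .ret v (K' ++ K)

/-- A transition inspects only the topmost frame. The one exception is a final configuration, which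
ceases to be final when frames are put below it; `hc` excludes it. -/
theorem step_app {c c' : Config} (K : List Frame) (h : step c = PMF.pure c')
    (hc : ∀ w, c ≠ .ret w []) : step (c.app K) = PMF.pure (c'.app K) := by
  have inj : ∀ {a b : Config}, (PMF.pure a : PMF Config) = PMF.pure b → a = b := fun {a b} h => by
    have : a ∈ (PMF.pure b : PMF Config).support := by rw [← h]; simp
    simpa using this
  rcases c with ⟨p, v, K'⟩ | ⟨v, K'⟩
  · cases p
    case coin =>
      exfalso
      simp only [step] at h
      have h1 : Config.ret (.ofBool true) K' ∈ (PMF.pure c' : PMF Config).support := by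
        rw [← h]; simp
      have h2 : Config.ret (.ofBool false) K' ∈ (PMF.pure c' : PMF Config).support := by
        rw [← h]; simp
      simp only [PMF.support_pure, Set.mem_singleton_iff] at h1 h2
      have := h1.trans h2.symm
      simp [Val.ofBool] at this
    case ite p q =>
      simp only [step] at h
      obtain rfl := inj h
      simp only [Config.app, step]
      cases v.fst.isNil <;> rfl
    case loop p =>
      simp only [step] at h
      obtain rfl := inj h
      simp only [Config.app, step]
      cases v.fst.isNil <;> rfl
    all_goals
      simp only [step] at h
      obtain rfl := inj h
      simp [Config.app, step]
  · rcases K' with _ | ⟨F, K'⟩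
    · exact absurd rfl (hc v)
    · cases F <;> (simp only [step] at h; obtain rfl := inj h; simp [Config.app, step])

/-- A time bound for the empty stack becomes one for every stack, as is needed to call `C'` as a
subroutine. Idle steps of a final configuration are absorbed by monotonicity. -/
theorem Reach.app {c m T} (K : List Frame) (h : Reach [] c m T) : Reach K (c.app K) m T := by
  induction h with
  | done w T => exact .done _ _
  | @step c c' m T h h' ih =>
    by_cases hc : ∃ w, c = .ret w []
    · obtain ⟨w, rfl⟩ := hc
      have : c' = .ret w [] := by
        have : c' ∈ (DPXor.step (.ret w [])).support := by rw [h]; simp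
        simpa [DPXor.step] using this
      subst this
      exact ih.mono (by omega)
    · exact .step (step_app K h (by simpa using hc)) ih
  | coin h ih => exact .coin fun b => ih b

/-- Coins are the only branching, so a computation that halts within `t` steps for all outcomes
unrolls into a finite tree. This makes the unknown `C'` accessible to the calculus. -/
theorem Reach.of_halts {t : ℕ} : ∀ {c : Config},
    (∀ c' ∈ (DPXor.runFor t c).support, ∃ w, c' = .ret w []) → ∃ m, Reach [] c m t := by
  induction t with
  | zero =>
    intro c h
    obtain ⟨w, rfl⟩ := h c (by simp [DPXor.runFor])
    exact ⟨_, .done _ _⟩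
  | succ t ih =>
    intro c h
    by_cases hc : ∃ c', DPXor.step c = PMF.pure c'
    · obtain ⟨c', hc'⟩ := hc
      obtain ⟨m, hm⟩ := ih (c := c') (by simpa [DPXor.runFor, hc'] using h)
      exact ⟨m, .step hc' hm⟩
    · rcases c with ⟨p, v, K⟩ | ⟨v, K⟩
      · cases p
        case coin =>
          have : ∀ b, ∃ m, Reach [] (.ret (.ofBool b) K) m t := fun b => ih fun c' hc' => h c' (by
            simp only [DPXor.runFor, DPXor.step, PMF.bind_map, PMF.mem_support_bind_iff]
            exact ⟨b, by simp, hc'⟩)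
          choose m hm using this
          exact ⟨_, .coin hm⟩
        all_goals exact absurd ⟨_, rfl⟩ hc
      · rcases K with _ | ⟨F, K⟩
        · exact absurd ⟨_, rfl⟩ hc
        · cases F <;> exact absurd ⟨_, rfl⟩ hc

/-- On input `v` the program `p` takes at most `T` steps and has the random result `m`. -/
def Sim (p : Prog) (v : Val) (m : Dt Val) (T : ℕ) : Prop := ∀ K, Reach K (.call p v K) m T

theorem Prog.HaltsWithin.sim {p : Prog} {t : ℕ} {v : Val} (h : p.HaltsWithin t v) :
    ∃ m, Sim p v m t := by
  obtain ⟨m, hm⟩ := Reach.of_halts h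
  exact ⟨m, fun K => by simpa [Config.app] using hm.app K⟩

namespace Sim
variable {p q : Prog} {v w : Val} {m m' : Dt Val} {T T' : ℕ}

theorem run_eq (h : Sim p v m T) : p.run T v = (m.map fun w => Config.ret w []).pmf :=
  (h []).runFor

theorem haltsWithin (h : Sim p v m T) : p.HaltsWithin T v := by
  intro c hc
  rw [h.run_eq] at hc
  exact Dt.mem_support_pmf (P := fun c => ∃ w, c = Config.ret w [])
    ((Dt.All_map _ _).2 (Dt.All_of_forall _ fun w => ⟨w, rfl⟩)) c hc

open Classical in
theorem outProb_eq (h : Sim p v m T) (w : Val) :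
    p.outProb T v w = m.E fun x => if x = w then 1 else 0 := by
  rw [Prog.outProb, h.run_eq, Dt.pmf_apply, Dt.E_map]
  simp

theorem mono (h : Sim p v m T) (hT : T ≤ T') : Sim p v m T' := fun K => (h K).mono hT

theorem id : Sim .id v (.ret v) 1 := fun _ => .step rfl (.done _ _)
theorem nil : Sim .nil v (.ret .nil) 1 := fun _ => .step rfl (.done _ _)
theorem fst : Sim .fst v (.ret v.fst) 1 := fun _ => .step rfl (.done _ _)
theorem snd : Sim .snd v (.ret v.snd) 1 := fun _ => .step rfl (.done _ _)
theorem coin : Sim .coin v (.flip fun b => .ret (.ofBool b)) 1 := fun _ => .coin fun _ => .done _ _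

theorem seq {σ : Type} {e : σ → Val} {m : Dt σ} {g : σ → Dt Val} (hp : Sim p v (m.map e) T)
    (hq : m.All fun w => Sim q (e w) (g w) T') : Sim (.seq p q) v (m.bind g) (T + T' + 2) := fun K => by
  have := (hp (.seqNext q :: K)).bind (B' := K) (g := g) (T' := T' + 1)
    (hq.mono fun w hw => .step rfl (hw K))
  exact .step rfl (this.mono (by omega))

theorem pair {σ τ : Type} {e : σ → Val} {e' : τ → Val} {m : Dt σ} {m' : Dt τ}
    (hp : Sim p v (m.map e) T) (hq : Sim q v (m'.map e') T') :
    Sim (.pair p q) v (m.bind fun a => m'.map fun b => .cons (e a) (e' b)) (T + T' + 3) := fun K => by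
  have := (hp (.pairLeft q v :: K)).bind (B' := K)
    (g := fun a => m'.bind fun b => .ret (.cons (e a) (e' b))) (T' := T' + 1 + 1)
    (Dt.All_of_forall _ fun a => .step rfl ((hq (.pairRight (e a) :: K)).bind
      (Dt.All_of_forall _ fun b => .step rfl (.done _ 0))))
  exact .step rfl (this.mono (by omega))

theorem ite (hp : v.fst.isNil = false → Sim p v m T) (hq : v.fst.isNil = true → Sim q v m T) :
    Sim (.ite p q) v m (T + 1) := fun K => by
  cases h : v.fst.isNil
  · exact .step (c' := .call p v K) (by simp [step, h]) (hp h K)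
  · exact .step (c' := .call q v K) (by simp [step, h]) (hq h K)

theorem loop_stop (h : v.fst.isNil = true) : Sim (.loop p) v (.ret v) 1 := fun K =>
  .step (c' := .ret v K) (by simp [step, h]) (.done _ _)

theorem loop_step {σ : Type} {e : σ → Val} {m : Dt σ} {g : σ → Dt Val}
    (h : v.fst.isNil = false) (hp : Sim p v (m.map e) T)
    (hq : m.All fun w => Sim (.loop p) (e w) (g w) T') :
    Sim (.loop p) v (m.bind g) (T + T' + 2) := fun K => by
  have := (hp (.loopNext p :: K)).bind (B' := K) (g := g) (T' := T' + 1)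
    (hq.mono fun w hw => .step rfl (hw K))
  exact .step (c' := .call p v (.loopNext p :: K)) (by simp [step, h]) (this.mono (by omega))

theorem seq_map {σ : Type} {e : σ → Val} {f : σ → Val} {m : Dt σ} (hp : Sim p v (m.map e) T)
    (hq : m.All fun a => Sim q (e a) (.ret (f a)) T') : Sim (.seq p q) v (m.map f) (T + T' + 2) :=
  seq hp hq

/-- Deterministic first part. -/
theorem ret_seq (hp : Sim p v (.ret w) T) (hq : Sim q w m T') :
    Sim (.seq p q) v m (T + T' + 2) := seq (e := fun x => x) (m := .ret w) (g := fun _ => m) hp hq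

theorem ret_pair {σ : Type} {e : σ → Val} {m : Dt σ} (hp : Sim p v (.ret w) T)
    (hq : Sim q v (m.map e) T') :
    Sim (.pair p q) v (m.map fun b => .cons w (e b)) (T + T' + 3) :=
  pair (e := fun x => x) (m := .ret w) hp hq

theorem pair_ret {σ : Type} {e : σ → Val} {m : Dt σ} (hp : Sim p v (m.map e) T)
    (hq : Sim q v (.ret w) T') :
    Sim (.pair p q) v (m.map fun a => .cons (e a) w) (T + T' + 3) :=
  pair (e' := fun x => x) (m' := .ret w) hp hq

end Sim

/-- The random result of a program without loops. -/
def Prog.ev : Prog → Val → Dt Val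
  | .id, v => .ret v
  | .nil, _ => .ret .nil
  | .fst, v => .ret v.fst
  | .snd, v => .ret v.snd
  | .coin, _ => .flip fun b => .ret (.ofBool b)
  | .pair p q, v => (p.ev v).bind fun a => (q.ev v).bind fun b => .ret (.cons a b)
  | .seq p q, v => (p.ev v).bind q.ev
  | .ite p q, v => bif v.fst.isNil then q.ev v else p.ev v
  | .loop _, v => .ret v

/-- A bound for the running time of a program without loops. -/
def Prog.cost : Prog → ℕ
  | .pair p q => p.cost + q.cost + 3
  | .seq p q => p.cost + q.cost + 2
  | .ite p q => p.cost + q.cost + 1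
  | _ => 1

def Prog.noLoop : Prog → Bool
  | .pair p q => p.noLoop && q.noLoop
  | .seq p q => p.noLoop && q.noLoop
  | .ite p q => p.noLoop && q.noLoop
  | .loop _ => false
  | _ => true

theorem Sim.ev : ∀ {p : Prog}, p.noLoop = true → ∀ v, Sim p v (p.ev v) p.cost
  | .id, _, _ => Sim.id
  | .nil, _, _ => Sim.nil
  | .fst, _, _ => Sim.fst
  | .snd, _, _ => Sim.snd
  | .coin, _, _ => Sim.coin
  | .pair p q, h, v => by
    simp only [Prog.noLoop, Bool.and_eq_true] at h
    have h1 := Sim.ev h.1 v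
    have h2 := Sim.ev h.2 v
    rw [← Dt.map_id (p.ev v)] at h1
    rw [← Dt.map_id (q.ev v)] at h2
    exact h1.pair h2
  | .seq p q, h, v => by
    simp only [Prog.noLoop, Bool.and_eq_true] at h
    have h1 := Sim.ev h.1 v
    rw [← Dt.map_id (p.ev v)] at h1
    exact h1.seq (Dt.All_of_forall _ (Sim.ev h.2))
  | .ite p q, h, v => by
    simp only [Prog.noLoop, Bool.and_eq_true] at h
    refine Sim.ite (T := p.cost + q.cost) (fun hv => ?_) (fun hv => ?_)
    · simpa [Prog.ev, hv] using (Sim.ev h.1 v).mono (by omega)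
    · simpa [Prog.ev, hv] using (Sim.ev h.2 v).mono (by omega)
  | .loop _, h, _ => by simp [Prog.noLoop] at h

end DPXor

namespace DPXor

/-! ### Polynomial time bounds -/

/-- A bound `B` for the lengths of the lists that are processed, and a unit of time `t`. -/
structure Budget where
  B : ℕ
  t : ℕ
  hB : 64 ≤ B
  ht : 1 ≤ t

/-- `p` has the random result `m` on `v`, in time `B ^ j * t`. -/
def Run (β : Budget) (j : ℕ) (p : Prog) (v : Val) (m : Dt Val) : Prop :=
  Sim p v m (β.B ^ j * β.t)

theorem Budget.one_le (β : Budget) (j : ℕ) : 1 ≤ β.B ^ j :=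
  Nat.one_le_pow _ _ (by have := β.hB; omega)

/-- Composition adds the exponents although the times only add up. The waste is harmless, since the
number of compositions is an absolute constant, and exponents become closed numerals. The assumption
`64 ≤ B` pays for both summands and for the overhead of the machine. -/
theorem Budget.add_le (β : Budget) (i j : ℕ) :
    β.B ^ i * β.t + β.B ^ j * β.t + 40 ≤ β.B ^ (i + j + 1) * β.t := by
  have hi := β.one_le i
  have hj := β.one_le j
  have h1 : β.B ^ i ≤ β.B ^ i * β.B ^ j := Nat.le_mul_of_pos_right _ hj
  have h2 : β.B ^ j ≤ β.B ^ i * β.B ^ j := Nat.le_mul_of_pos_left _ hi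
  have h3 : β.B ^ i * β.B ^ j * 64 ≤ β.B ^ (i + j + 1) := by
    rw [pow_succ, pow_add]; exact Nat.mul_le_mul_left _ β.hB
  have h4 : 1 ≤ β.B ^ i * β.B ^ j := Nat.mul_pos hi hj
  have ht := β.ht
  calc β.B ^ i * β.t + β.B ^ j * β.t + 40
      ≤ β.B ^ i * β.t + β.B ^ j * β.t + 40 * β.t := by omega
    _ = (β.B ^ i + β.B ^ j + 40) * β.t := by ring
    _ ≤ _ := Nat.mul_le_mul_right _ (by omega)

theorem Budget.mono (β : Budget) {i j : ℕ} (h : i ≤ j) :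
    β.B ^ i * β.t ≤ β.B ^ j * β.t :=
  Nat.mul_le_mul_right _ (Nat.pow_le_pow_right (by have := β.hB; omega) h)

/-- Allows the cost of a loop-free program to serve as its exponent. -/
theorem Budget.le_pow (β : Budget) (j : ℕ) : j + 1 ≤ β.B ^ j * β.t := by
  have h1 : j < 2 ^ j := Nat.lt_two_pow_self
  have h2 : 2 ^ j ≤ β.B ^ j := Nat.pow_le_pow_left (by have := β.hB; omega) j
  calc j + 1 ≤ β.B ^ j * 1 := by omega
    _ ≤ _ := Nat.mul_le_mul_left _ β.ht

/-- `m` iterated along a list, threading a state. -/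
def Dt.foldl {α σ : Type} (g : σ → α → Dt σ) : σ → List α → Dt σ
  | s, [] => .ret s
  | s, a :: l => (g s a).bind fun s' => Dt.foldl g s' l

theorem Dt.foldl_ret {α σ : Type} (h : σ → α → σ) (s : σ) (L : List α) :
    Dt.foldl (fun s a => .ret (h s a)) s L = .ret (L.foldl h s) := by
  induction L generalizing s with
  | nil => rfl
  | cons a l ih => simp [Dt.foldl, ih]

/-- The results of `g` on the elements of a list, in reverse order. -/
def Dt.mapRev {α β : Type} (g : α → Dt β) (acc : List β) (L : List α) : Dt (List β) :=
  Dt.foldl (fun l a => (g a).map fun b => b :: l) acc L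

theorem Dt.mapRev_length {α β : Type} (g : α → Dt β) (acc : List β) (L : List α) :
    (Dt.mapRev g acc L).All fun l => l.length = acc.length + L.length := by
  induction L generalizing acc with
  | nil => simp [mapRev, Dt.foldl]
  | cons a l ih =>
    simp only [mapRev, Dt.foldl, All_bind, map_bind]
    refine All_of_forall _ fun b => (ih (b :: acc)).mono fun l' h => ?_
    simp only [List.length_cons] at h ⊢
    omega

namespace Val

/-- The component with the given index of a tuple. -/
def nth : ℕ → Val → Val
  | 0, v => v.fst
  | i + 1, v => nth i v.snd

@[simp] theorem nth_zero (a b : Val) : nth 0 (cons a b) = a := rfl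
@[simp] theorem nth_succ (i : ℕ) (a b : Val) : nth (i + 1) (cons a b) = nth i b := rfl
@[simp] theorem fst_cons (a b : Val) : (cons a b).fst = a := rfl
@[simp] theorem snd_cons (a b : Val) : (cons a b).snd = b := rfl
@[simp] theorem fst_nil : nil.fst = nil := rfl
@[simp] theorem snd_nil : nil.snd = nil := rfl
@[simp] theorem isNil_nil : nil.isNil = true := rfl
@[simp] theorem isNil_cons (a b : Val) : (cons a b).isNil = false := rfl
@[simp] theorem isNil_ofBool (b : Bool) : (ofBool b).isNil = !b := by cases b <;> rfl
@[simp] theorem ofList_nil : ofList [] = nil := rfl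
@[simp] theorem ofList_cons (a : Val) (l : List Val) : ofList (a :: l) = cons a (ofList l) := rfl
/-- A list of encoded objects. -/
def list {α : Type} (e : α → Val) (l : List α) : Val := ofList (l.map e)

@[simp] theorem list_nil {α : Type} (e : α → Val) : list e [] = nil := rfl
@[simp] theorem list_cons {α : Type} (e : α → Val) (a : α) (l : List α) :
    list e (a :: l) = cons (e a) (list e l) := rfl
@[simp] theorem snd_list {α : Type} (e : α → Val) (l : List α) :
    (list e l).snd = list e l.tail := by cases l <;> rfl
@[simp] theorem isNil_list {α : Type} (e : α → Val) (l : List α) :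
    (list e l).isNil = l.isEmpty := by cases l <;> rfl
end Val

/-- The component with the given index of a tuple. -/
def get : ℕ → Prog
  | 0 => .fst
  | i + 1 => .seq .snd (get i)

/-- The rest of a tuple from the given index on. -/
def from' : ℕ → Prog
  | 0 => .id
  | i + 1 => .seq .snd (from' i)

/-- Branch on whether the result of `c` is nonempty. -/
def ifP (c p q : Prog) : Prog := .seq (.pair c .id) (.ite (.seq .snd p) (.seq .snd q))

/-- Add the result of `e` in front of the environment. -/
def letP (e b : Prog) : Prog := .seq (.pair e .id) b

/-- The truth value `true`. -/
def trueP : Prog := .pair .nil .nil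

/-- Exclusive or of two truth values. -/
def xorP (p q : Prog) : Prog := ifP p (ifP q .nil trueP) q

@[simp] theorem ev_get (i : ℕ) (v : Val) : (get i).ev v = .ret (v.nth i) := by
  induction i generalizing v with
  | zero => rfl
  | succ i ih => simp [get, Prog.ev, ih, Val.nth]

theorem noLoop_get (i : ℕ) : (get i).noLoop = true := by
  induction i with
  | zero => rfl
  | succ i ih => simp [get, Prog.noLoop, ih]

attribute [simp] Prog.ev

@[simp] theorem ev_trueP (v : Val) : trueP.ev v = .ret (.ofBool true) := rfl

@[simp] theorem ev_ifP {c p q : Prog} {v w : Val} (h : c.ev v = .ret w) :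
    (ifP c p q).ev v = if w.isNil then q.ev v else p.ev v := by
  simp only [ifP, Prog.ev, h, Dt.ret_bind, Val.fst_cons, Val.snd_cons]
  cases w.isNil <;> rfl

@[simp] theorem ev_letP {e b : Prog} {v w : Val} (h : e.ev v = .ret w) :
    (letP e b).ev v = b.ev (.cons w v) := by
  simp [letP, h]

@[simp] theorem ev_xorP {p q : Prog} {v : Val} {a b : Bool} (hp : p.ev v = .ret (.ofBool a))
    (hq : q.ev v = .ret (.ofBool b)) : (xorP p q).ev v = .ret (.ofBool (xor a b)) := by
  rw [xorP, ev_ifP hp, ev_ifP hq]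
  cases a <;> cases b <;> simp [hq, Val.ofBool]

/-- Run `body` along a list, from left to right; the input is the list, the initial state
and an environment. -/
def foldE (body : Prog) : Prog :=
  .seq (.seq (.loop (.pair (.seq .fst .snd)
    (.seq (.pair (.seq .fst .fst) .snd) (.pair body (.seq .snd .snd))))) .snd) .fst

/-- The list, in reverse order, of the results of `p` on the elements of a list. -/
def mapP (p : Prog) : Prog :=
  .seq (.pair .fst (.pair .nil .snd))
    (foldE (.pair (.seq (.pair .fst (.seq .snd .snd)) p) (.seq .snd .fst)))

/-- The loop keeps the triple of remaining list, state and environment, so that its built-in test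
asks whether the list is exhausted. The invariant `I` relates the remaining list to the state; it
carries length bounds into the body. -/
theorem Sim.foldE {α σ : Type} {body : Prog} {T : ℕ} {env : Val} (ea : α → Val) (es : σ → Val)
    (g : σ → α → Dt σ) (I : List α → σ → Prop)
    (hb : ∀ a l s, I (a :: l) s →
      Sim body (.cons (ea a) (.cons (es s) env)) ((g s a).map es) T ∧ (g s a).All (I l))
    (L : List α) (s : σ) (hI : I L s) :
    Sim (foldE body) (.cons (.list ea L) (.cons (es s) env)) ((Dt.foldl g s L).map es)
      (L.length * (T + 40) + 10) := by
  have key : ∀ (L : List α) (s : σ), I L s → Sim (.loop (.pair (.seq .fst .snd)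
      (.seq (.pair (.seq .fst .fst) .snd) (.pair body (.seq .snd .snd)))))
      (.cons (.list ea L) (.cons (es s) env))
      ((Dt.foldl g s L).map fun s => .cons .nil (.cons (es s) env)) (L.length * (T + 40) + 1) := by
    intro L
    induction L with
    | nil => intro s _; exact (Sim.loop_stop rfl).mono (by simp)
    | cons a l ih =>
      intro s hs
      obtain ⟨h1, h2⟩ := hb a l s hs
      have h3 := Sim.ret_pair (Sim.ev (p := .seq .fst .snd) rfl
        (.cons (.list ea (a :: l)) (.cons (es s) env)))
          (Sim.ret_seq (Sim.ev (p := .pair (.seq .fst .fst) .snd) rfl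
            (.cons (.list ea (a :: l)) (.cons (es s) env)))
          (h1.pair_ret (Sim.ev (p := .seq .snd .snd) rfl (.cons (ea a) (.cons (es s) env)))))
      have h4 := Sim.loop_step (g := fun s => (Dt.foldl g s l).map fun s => .cons .nil (.cons (es s) env))
        rfl h3 (h2.mono fun s' hs' => ih s' hs')
      simp only [Dt.foldl, Dt.bind_map]
      refine h4.mono ?_
      simp [Prog.cost, Nat.add_mul]
      omega
  refine (Sim.seq_map (e := fun s => .cons (es s) env) (Sim.seq_map (key L s hI)
    (Dt.All_of_forall _ fun s => Sim.snd)) (Dt.All_of_forall _ fun s => Sim.fst)).mono ?_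
  omega

namespace Run
variable {β : Budget} {p q : Prog} {v w : Val} {m m' : Dt Val} {i j : ℕ}

theorem mono (h : Run β i p v m) (hj : i ≤ j) : Run β j p v m := Sim.mono h (β.mono hj)

theorem congr (h : Run β j p v m) (hm : m = m') : Run β j p v m' := hm ▸ h

theorem ev (h : p.noLoop = true) (v : Val) : Run β p.cost p v (p.ev v) :=
  (Sim.ev h v).mono (by have := β.le_pow p.cost; omega)

theorem det (h : p.noLoop = true) (hw : p.ev v = .ret w) : Run β p.cost p v (.ret w) :=
  hw ▸ ev h v

section
variable {σ τ : Type} {e : σ → Val} {e' : τ → Val} {m : Dt σ} {m' : Dt τ}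

theorem seq {g : σ → Dt Val} (hp : Run β i p v (m.map e))
    (hq : m.All fun w => Run β j q (e w) (g w)) : Run β (i + j + 1) (.seq p q) v (m.bind g) :=
  (Sim.seq hp hq).mono (by have := β.add_le i j; omega)

theorem seq_map {f : σ → Val} (hp : Run β i p v (m.map e))
    (hq : m.All fun a => Run β j q (e a) (.ret (f a))) :
    Run β (i + j + 1) (.seq p q) v (m.map f) := seq hp hq

theorem ret_pair (hp : Run β i p v (.ret w)) (hq : Run β j q v (m.map e)) :
    Run β (i + j + 1) (.pair p q) v (m.map fun b => .cons w (e b)) :=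
  (Sim.ret_pair hp hq).mono (by have := β.add_le i j; omega)

theorem pair_ret (hp : Run β i p v (m.map e)) (hq : Run β j q v (.ret w)) :
    Run β (i + j + 1) (.pair p q) v (m.map fun a => .cons (e a) w) :=
  (Sim.pair_ret hp hq).mono (by have := β.add_le i j; omega)

/-- Bind the result of `p` to a variable. -/
theorem letP {g : σ → Dt Val} (hp : Run β i p v (m.map e))
    (hq : m.All fun a => Run β j q (.cons (e a) v) (g a)) :
    Run β (i + j + 3) (letP p q) v (m.bind g) :=
  (seq (pair_ret hp (ev (p := .id) rfl v)) hq).mono (by simp only [Prog.cost]; omega)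

theorem ret_seq {m : Dt Val} (hp : Run β i p v (.ret w)) (hq : Run β j q w m) :
    Run β (i + j + 1) (.seq p q) v m :=
  (Sim.ret_seq hp hq).mono (by have := β.add_le i j; omega)

theorem ret_letP {m : Dt Val} (hp : Run β i p v (.ret w)) (hq : Run β j q (.cons w v) m) :
    Run β (i + j + 3) (DPXor.letP p q) v m :=
  letP (m := .ret w) (e := fun x => x) (g := fun _ => m) hp hq

theorem ret_pair_ret {w' : Val} (hp : Run β i p v (.ret w)) (hq : Run β j q v (.ret w')) :
    Run β (i + j + 1) (.pair p q) v (.ret (.cons w w')) :=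
  ret_pair (m := .ret w') (e := fun x => x) hp hq

/-- A call of `q` with arguments that are computed without loops. -/
theorem call {m : Dt Val} (hp : p.noLoop = true) (hw : p.ev v = .ret w) (hq : Run β j q w m) :
    Run β (p.cost + j + 1) (.seq p q) v m := ret_seq (det hp hw) hq

theorem ifP {c : Prog} {k : ℕ} {m : Dt Val} (hc : Run β k c v (.ret w))
    (hp : w.isNil = false → Run β i p v m) (hq : w.isNil = true → Run β j q v m) :
    Run β (k + i + j + 10) (DPXor.ifP c p q) v m := by
  have h1 : Run β (k + 1 + 1) (.pair c .id) v (.ret (.cons w v)) :=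
    ret_pair_ret hc (ev (p := .id) rfl v)
  have h2 : Run β (i + j + 5) (.ite (.seq .snd p) (.seq .snd q)) (.cons w v) m := by
    refine Sim.mono (Sim.ite (T := β.B ^ (i + j + 3) * β.t) (fun h => ?_) (fun h => ?_)) ?_
    · exact (ret_seq (ev (p := .snd) rfl _) (hp h)).mono (by simp only [Prog.cost]; omega)
    · exact (ret_seq (ev (p := .snd) rfl _) (hq h)).mono (by simp only [Prog.cost]; omega)
    · have := β.add_le (i + j + 3) 1; have := β.mono (show i + j + 3 + 1 + 1 ≤ i + j + 5 by omega); omega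
  exact (ret_seq h1 h2).mono (by omega)

end

theorem foldE {α σ : Type} {body : Prog} {env : Val} (ea : α → Val) (es : σ → Val)
    (g : σ → α → Dt σ) (I : List α → σ → Prop)
    (hb : ∀ a l s, I (a :: l) s →
      Run β j body (.cons (ea a) (.cons (es s) env)) ((g s a).map es) ∧ (g s a).All (I l))
    {L : List α} {s : σ} (hI : I L s) (hL : L.length ≤ β.B) :
    Run β (j + 2) (foldE body) (.cons (.list ea L) (.cons (es s) env)) ((Dt.foldl g s L).map es) := by
  refine Sim.mono (Sim.foldE ea es g I hb L s hI) ?_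
  have h1 := β.one_le j
  have ht := β.ht
  have hB := β.hB
  have h2 : 1 ≤ β.B ^ j * β.t := Nat.mul_pos h1 ht
  calc L.length * (β.B ^ j * β.t + 40) + 10
      ≤ β.B * (β.B ^ j * β.t + 40) + 10 := by gcongr
    _ ≤ β.B * (β.B ^ j * β.t * 64) := by nlinarith
    _ ≤ β.B * (β.B ^ j * β.t * β.B) := by gcongr
    _ = _ := by ring

/-- Deterministic iteration. -/
theorem foldE_ret {α σ : Type} {body : Prog} {env : Val} (ea : α → Val) (es : σ → Val)
    (g : σ → α → σ) (I : List α → σ → Prop)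
    (hb : ∀ a l s, I (a :: l) s →
      Run β j body (.cons (ea a) (.cons (es s) env)) (.ret (es (g s a))) ∧ I l (g s a))
    {L : List α} {s : σ} (hI : I L s) (hL : L.length ≤ β.B) :
    Run β (j + 2) (DPXor.foldE body) (.cons (.list ea L) (.cons (es s) env))
      (.ret (es (L.foldl g s))) := by
  have := foldE ea es (fun s a => .ret (g s a)) I hb hI hL
  rwa [Dt.foldl_ret] at this

/-- Deterministic iteration of a program without loops. -/
theorem foldE_det {α σ : Type} {body : Prog} {env : Val} (ea : α → Val) (es : σ → Val)
    (g : σ → α → σ) (hn : body.noLoop = true)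
    (hb : ∀ a s, body.ev (.cons (ea a) (.cons (es s) env)) = .ret (es (g s a)))
    {L : List α} {s : σ} (hL : L.length ≤ β.B) :
    Run β (body.cost + 2) (DPXor.foldE body) (.cons (.list ea L) (.cons (es s) env))
      (.ret (es (L.foldl g s))) :=
  foldE_ret ea es g (fun _ _ => True) (fun a _ s _ => ⟨det hn (hb a s), trivial⟩) trivial hL

theorem mapP {α γ : Type} {p : Prog} {env : Val} (ea : α → Val) (ec : γ → Val)
    (g : α → Dt γ) {L : List α} (hp : ∀ a ∈ L, Run β j p (.cons (ea a) env) ((g a).map ec))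
    (hL : L.length ≤ β.B) :
    Run β (j + 60) (mapP p) (.cons (.list ea L) env) ((Dt.mapRev g [] L).map (.list ec)) := by
  have h1 := foldE (β := β) (j := j + 30) (body := .pair (.seq (.pair .fst (.seq .snd .snd)) p) (.seq .snd .fst))
    (env := env) ea (.list ec) (fun l a => (g a).map fun b => b :: l) (fun l' _ => ∀ a ∈ l', a ∈ L)
    (fun a l s hs => ⟨?_, ?_⟩) (L := L) (s := []) (by simp) hL
  · refine (ret_seq (ev (p := .pair .fst (.pair .nil .snd)) rfl _) h1).mono ?_
    simp only [Prog.cost]; omega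
  · have h2 := pair_ret (ret_seq (ev (p := .pair .fst (.seq .snd .snd)) rfl
      (.cons (ea a) (.cons (.list ec s) env))) (hp a (hs a (by simp))))
      (ev (p := .seq .snd .fst) rfl (.cons (ea a) (.cons (.list ec s) env)))
    simp only [Dt.map_map]
    exact h2.mono (by simp only [Prog.cost]; omega)
  · exact Dt.All_of_forall _ fun l' a' ha' => hs a' (List.mem_cons_of_mem _ ha')

/-- Independent random results, without loops, for a list that is as long as the unit of time. -/
theorem mapP_short {α γ : Type} {p : Prog} {env : Val} (ea : α → Val) (ec : γ → Val)
    (g : α → Dt γ) {L : List α} (hn : p.noLoop = true)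
    (hp : ∀ a, p.ev (.cons (ea a) env) = (g a).map ec)
    (hL : L.length ≤ β.t) :
    Run β (p.cost + 60) (DPXor.mapP p) (.cons (.list ea L) env)
      ((Dt.mapRev g [] L).map (.list ec)) := by
  -- The body has constant cost, independent of `t`. A loop of length at most `t` therefore costs a
  -- constant times `t`, whereas `Run.foldE` would charge a factor `t` to every round.
  have h1 := Sim.foldE (T := p.cost + 30) (body := .pair (.seq (.pair .fst (.seq .snd .snd)) p) (.seq .snd .fst))
    (env := env) ea (.list ec) (fun l a => (g a).map fun b => b :: l) (fun _ _ => True)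
    (fun a l s _ => ⟨?_, Dt.All_of_forall _ fun _ => trivial⟩) L [] trivial
  · have h3 := Sim.ret_seq (Sim.ev (p := .pair .fst (.pair .nil .snd)) rfl (.cons (.list ea L) env)) h1
    refine Sim.mono h3 ?_
    simp only [Prog.cost]
    have h4 := β.le_pow p.cost
    have h5 : p.cost + 1 ≤ β.B ^ p.cost := by
      have h1 : p.cost < 2 ^ p.cost := Nat.lt_two_pow_self
      have h2 : 2 ^ p.cost ≤ β.B ^ p.cost := Nat.pow_le_pow_left (by have := β.hB; omega) _
      omega
    have ht := β.ht
    have hB := β.hB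
    calc _ ≤ β.t * (p.cost + 30 + 40) + 30 := by
            have := Nat.mul_le_mul_right (p.cost + 30 + 40) hL; omega
      _ ≤ β.t * ((p.cost + 1) * 64 * 64) := by nlinarith
      _ ≤ β.t * (β.B ^ p.cost * β.B * β.B) := by gcongr
      _ = β.B ^ (p.cost + 2) * β.t := by ring
      _ ≤ _ := β.mono (by omega)
  · have h := Sim.ev hn (.cons (ea a) env)
    rw [hp] at h
    have h2 := Sim.pair_ret (Sim.ret_seq (Sim.ev (p := .pair .fst (.seq .snd .snd)) rfl
      (.cons (ea a) (.cons (.list ec s) env))) h)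
      (Sim.ev (p := .seq .snd .fst) rfl (.cons (ea a) (.cons (.list ec s) env)))
    simp only [Dt.map_map]
    exact h2.mono (by simp only [Prog.cost]; omega)

end Run

end DPXor

namespace DPXor

/-! ### Programs for lists and numbers -/

namespace Val

abbrev num (n : ℕ) : Val := list (fun _ : Unit => nil) (List.replicate n ())
abbrev bits (l : List Bool) : Val := list ofBool l
theorem ofNat_eq (n : ℕ) : ofNat n = num n := by simp [ofNat, num, list]

theorem fst_bits (l : List Bool) : (bits l).fst = ofBool (l.headD false) := by cases l <;> rfl
theorem fst_cols (l : List (List Bool)) : (list bits l).fst = bits (l.headD []) := by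
  cases l <;> rfl
@[simp] theorem num_zero : num 0 = nil := rfl
theorem num_succ (n : ℕ) : num (n + 1) = cons nil (num n) := rfl
theorem isNil_num (n : ℕ) : (num n).isNil = decide (n = 0) := by cases n <;> rfl

/-- The rest of a tuple from the given index on. -/
def rest : ℕ → Val → Val
  | 0, v => v
  | i + 1, v => rest i v.snd

@[simp] theorem rest_zero (v : Val) : rest 0 v = v := rfl
@[simp] theorem rest_succ (i : ℕ) (a b : Val) : rest (i + 1) (cons a b) = rest i b := rfl

end Val

@[simp] theorem ev_from (i : ℕ) (v : Val) : (from' i).ev v = .ret (v.rest i) := by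
  induction i generalizing v with
  | zero => rfl
  | succ i ih => simp [from', Prog.ev, ih, Val.rest]

open Val

variable {β : Budget}

/-- `(L, acc, _) ↦ L.reverse ++ acc` -/
def revApp : Prog := foldE (.pair .fst (get 1))

theorem run_revApp {α : Type} (e : α → Val) (L acc : List α) (env : Val) (hL : L.length ≤ β.B) :
    Run β 20 revApp (.cons (list e L) (.cons (list e acc) env)) (.ret (list e (L.reverse ++ acc))) := by
  have := Run.foldE_det (β := β) (body := .pair .fst (get 1)) (env := env) e (list e)
    (fun s a => a :: s) rfl (by simp) (s := acc) hL
  have h : ∀ (L acc : List α), L.foldl (fun s a => a :: s) acc = L.reverse ++ acc := by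
    intro L
    induction L with
    | nil => simp
    | cons a l ih => intro acc; simp [ih]
  rw [h] at this
  exact this.mono (by decide)

/-- `(L, D, _) ↦ D.drop L.length` -/
def dropP : Prog := foldE (.seq (get 1) .snd)

theorem run_dropP {α γ : Type} (e : α → Val) (e' : γ → Val) (L : List α) (D : List γ) (env : Val)
    (hL : L.length ≤ β.B) :
    Run β 20 dropP (.cons (list e L) (.cons (list e' D) env)) (.ret (list e' (D.drop L.length))) := by
  have := Run.foldE_det (β := β) (body := .seq (get 1) .snd) (env := env) e (list e')
    (fun s _ => s.tail) rfl (by simp) (s := D) hL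
  have h : ∀ (L : List α) (D : List γ), L.foldl (fun s _ => s.tail) D = D.drop L.length := by
    intro L
    induction L with
    | nil => simp
    | cons a l ih => intro D; simp [ih, List.drop_tail]
  rw [h] at this
  exact this.mono (by decide)

/-- `(L, c, _) ↦ L.length + c` -/
def addP : Prog := foldE (.pair .nil (get 1))

theorem run_addP {α : Type} (e : α → Val) (L : List α) (c : ℕ) (env : Val) (hL : L.length ≤ β.B) :
    Run β 20 addP (.cons (list e L) (.cons (num c) env)) (.ret (num (L.length + c))) := by
  have := Run.foldE_det (β := β) (body := .pair .nil (get 1)) (env := env) e num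
    (fun s _ => s + 1) rfl (by simp [num_succ]) (s := c) hL
  have h : ∀ (L : List α) (c : ℕ), L.foldl (fun s _ => s + 1) c = L.length + c := by
    intro L
    induction L with
    | nil => simp
    | cons a l ih => intro c; simp [ih]; omega
  rw [h] at this
  exact this.mono (by decide)

/-- `(A, B) ↦ A.length * B.length` -/
def mulP : Prog :=
  .seq (.pair .fst (.pair .nil .snd)) (foldE (.seq (.pair (from' 2) (.pair (get 1) .nil)) addP))

theorem run_mulP {α γ : Type} (e : α → Val) (e' : γ → Val) (L : List α) (D : List γ)
    (hL : L.length ≤ β.B) (hD : D.length ≤ β.B) :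
    Run β 70 mulP (.cons (list e L) (list e' D)) (.ret (num (L.length * D.length))) := by
  have := Run.foldE_ret (β := β) (body := .seq (.pair (from' 2) (.pair (get 1) .nil)) addP)
    (env := list e' D) e num (fun s _ => D.length + s) (fun _ _ => True)
    (fun a l s _ => ⟨Run.call rfl (by simp) (run_addP e' D s .nil hD), trivial⟩) (s := 0) trivial hL
  have h : ∀ (L : List α) (c : ℕ), L.foldl (fun s _ => D.length + s) c = L.length * D.length + c := by
    intro L
    induction L with
    | nil => simp
    | cons a l ih => intro c; simp [ih]; ring
  rw [h] at this
  exact (Run.call rfl (by simp) this).mono (by decide)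

/-- Split a list into the elements at even and at odd places, counted from the end. -/
def deintP : Prog :=
  .seq (.pair .id (.pair (.pair .nil .nil) .nil))
    (foldE (.pair (.seq (get 1) .snd) (.pair .fst (.seq (get 1) .fst))))

def deint {α : Type} (L : List α) : List α × List α :=
  L.foldl (fun s a => (s.2, a :: s.1)) ([], [])

theorem run_deintP {α : Type} (e : α → Val) (L : List α) (hL : L.length ≤ β.B) :
    Run β 50 deintP (list e L) (.ret (.cons (list e (deint L).1) (list e (deint L).2))) := by
  have := Run.foldE_det (β := β) (body := .pair (.seq (get 1) .snd) (.pair .fst (.seq (get 1) .fst)))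
    (env := .nil) e (fun s : List α × List α => .cons (list e s.1) (list e s.2))
    (fun s a => (s.2, a :: s.1)) rfl (by simp) (s := ([], [])) hL
  exact (Run.call rfl (by simp) this).mono (by decide)

theorem deint_length {α : Type} (L : List α) :
    (deint L).1.length = L.length / 2 ∧ (deint L).2.length = (L.length + 1) / 2 := by
  unfold deint
  induction L using List.reverseRecOn with
  | nil => simp
  | append_singleton l a ih => simp [ih]; omega

def halfP : Prog := .seq deintP .fst

theorem run_halfP (c : ℕ) (hc : c ≤ β.B) : Run β 60 halfP (num c) (.ret (num (c / 2))) := by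
  have h := run_deintP (β := β) (fun _ : Unit => nil) (List.replicate c ()) (by simpa using hc)
  have h2 := (Run.ret_seq h (Run.det (p := .fst) rfl rfl)).mono (j := 60) (by decide)
  refine h2.congr ?_
  simp only [fst_cons]
  congr 2
  rw [List.eq_replicate_iff]
  exact ⟨by simp [deint_length], fun _ _ => rfl⟩

/-- The number of binary digits. -/
def lg : ℕ → ℕ
  | 0 => 0
  | n + 1 => lg ((n + 1) / 2) + 1
decreasing_by omega

theorem lg_pos {n : ℕ} (h : n ≠ 0) : lg n = lg (n / 2) + 1 := by
  obtain ⟨n, rfl⟩ := Nat.exists_eq_succ_of_ne_zero h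
  rw [lg]

theorem lt_two_pow_lg (n : ℕ) : n < 2 ^ lg n := by
  induction n using Nat.strongRecOn with
  | ind n ih =>
    rcases eq_or_ne n 0 with rfl | h
    · simp
    · rw [lg_pos h, pow_succ]
      have := ih (n / 2) (by omega)
      omega

theorem two_pow_lg_le {n : ℕ} (h : n ≠ 0) : 2 ^ lg n ≤ 2 * n := by
  induction n using Nat.strongRecOn with
  | ind n ih =>
    rw [lg_pos h, pow_succ]
    rcases eq_or_ne (n / 2) 0 with h0 | h0
    · rw [h0, lg]; omega
    · have := ih (n / 2) (by omega) h0
      omega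

theorem lg_le (n : ℕ) : lg n ≤ n := by
  induction n using Nat.strongRecOn with
  | ind n ih =>
    rcases eq_or_ne n 0 with rfl | h
    · simp [lg]
    · rw [lg_pos h]
      have := ih (n / 2) (by omega)
      omega

/-- `L ↦ lg L.length` -/
def logP : Prog :=
  .seq (.seq (.pair .id (.pair (.seq (.pair .id (.pair .nil .nil)) addP) .nil))
    (.pair .fst (.pair (.pair (get 1) .nil) .nil)))
  (.seq (foldE (ifP (.seq (get 1) .fst)
    (.pair (.seq (.seq (get 1) .fst) halfP) (.pair .nil (.seq (get 1) .snd))) (get 1))) .snd)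

theorem run_logP {α : Type} (e : α → Val) (L : List α) (hL : L.length ≤ β.B) :
    Run β 400 logP (list e L) (.ret (num (lg L.length))) := by
  -- Halve the first number until it vanishes and count the halvings. The list itself is the clock:
  -- as `lg n ≤ n`, it has enough elements.
  let g : ℕ × ℕ → α → ℕ × ℕ := fun s _ => if s.1 = 0 then s else (s.1 / 2, s.2 + 1)
  have hb : ∀ (a : α) (l : List α) (s : ℕ × ℕ), s.1 ≤ β.B →
      Run β 200 (ifP (.seq (get 1) .fst)
        (.pair (.seq (.seq (get 1) .fst) halfP) (.pair .nil (.seq (get 1) .snd))) (get 1))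
        (.cons (e a) (.cons (.cons (num s.1) (num s.2)) .nil))
        (.ret (.cons (num (g s a).1) (num (g s a).2))) ∧ (g s a).1 ≤ β.B := by
    intro a l s hs
    refine ⟨(Run.ifP (i := 100) (j := 10) (w := num s.1) (Run.det rfl (by simp))
      (fun h => ?_) (fun h => ?_)).mono (by decide), ?_⟩
    · have h2 := Run.ret_pair_ret (Run.call (p := .seq (get 1) .fst) (v := .cons (e a) (.cons (.cons (num s.1) (num s.2)) .nil)) rfl (by simp) (run_halfP s.1 hs))
        (Run.det (p := .pair .nil (.seq (get 1) .snd)) rfl (by simp; rfl))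
      have h' : s.1 ≠ 0 := by simpa [isNil_num] using h
      refine (h2.mono (by decide)).congr ?_
      simp [g, h', num_succ]
    · have h' : s.1 = 0 := by simpa [isNil_num] using h
      exact (Run.det rfl (by simp [g, h'])).mono (by decide)
    · simp only [g]; split_ifs
      · exact hs
      · simp only; omega
  have h1 := Run.foldE_ret (β := β) (env := .nil) e
    (fun s : ℕ × ℕ => .cons (num s.1) (num s.2)) g (fun _ s => s.1 ≤ β.B) hb
    (L := L) (s := (L.length, 0)) hL hL
  have h : ∀ (L : List α) (s : ℕ × ℕ), s.1 ≤ L.length → L.foldl g s = (0, s.2 + lg s.1) := by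
    intro L
    induction L with
    | nil => intro s hs; obtain ⟨a, b⟩ := s; simp at hs; subst hs; simp [lg]
    | cons a l ih =>
      intro s hs
      rw [List.foldl_cons, ih]
      · simp only [g]
        split_ifs with h
        · rw [h]
        · rw [lg_pos h]; simp only [Prod.mk.injEq, true_and]; omega
      · simp only [g]
        simp only [List.length_cons] at hs
        split_ifs with h <;> simp only [h] <;> omega
  rw [h L _ le_rfl] at h1
  have h3 := Run.ret_pair_ret (Run.call (p := .pair .id (.pair .nil .nil)) (v := list e L) rfl (by simp) (run_addP e L 0 .nil hL))
    (Run.det (p := .nil) rfl (by simp; rfl))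
  have h4 := Run.ret_seq (Run.ret_pair_ret (Run.det (p := .id) rfl (by simp; rfl)) h3)
    (Run.det (p := .pair .fst (.pair (.pair (get 1) .nil) .nil)) rfl (by simp; rfl))
  have h5 := Run.ret_seq h4 (Run.ret_seq h1 (Run.det (p := .snd) rfl rfl))
  exact (h5.mono (by decide)).congr (by simp)

/-- The length of a random list, about twice the length of `L`: with probability `1/2` it takes
the full value, with probability `1/4` the next smaller one, and so on. -/
def geo {α : Type} (L : List α) : Dt (Bool × ℕ) :=
  Dt.foldl (fun s _ => if s.1 then .ret (true, s.2 + 2) else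
    .flip fun c => .ret (c, if c then s.2 + 2 else s.2)) (false, 2) L

def geoP : Prog :=
  .seq (.pair .id (.pair (.pair .nil (.pair .nil (.pair .nil .nil))) .nil))
  (.seq (foldE (.seq (.pair (ifP (.seq (get 1) .fst) trueP .coin) (.seq (get 1) .snd))
    (ifP .fst (.pair trueP (.pair .nil (.pair .nil .snd))) (.pair .nil .snd)))) .snd)

theorem run_geoP {α : Type} (e : α → Val) (L : List α) (hL : L.length ≤ β.B) :
    Run β 200 geoP (list e L) ((geo L).map fun s => num s.2) := by
  have h1 := Run.foldE (β := β) (env := .nil)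
    (body := .seq (.pair (ifP (.seq (get 1) .fst) trueP .coin) (.seq (get 1) .snd))
    (ifP .fst (.pair trueP (.pair .nil (.pair .nil .snd))) (.pair .nil .snd))) e
    (fun s : Bool × ℕ => .cons (ofBool s.1) (num s.2))
    (fun s _ => if s.1 then .ret (true, s.2 + 2) else
      .flip fun c => .ret (c, if c then s.2 + 2 else s.2)) (fun _ _ => True)
    (fun a l s _ => ⟨(Run.ev rfl _).congr ?_, Dt.All_of_forall _ fun _ => trivial⟩) (L := L) (s := (false, 2)) trivial hL
  · have h2 := Run.call (p := (.pair .id (.pair (.pair .nil (.pair .nil (.pair .nil .nil))) .nil))) (v := list e L) rfl (by simp; exact ⟨rfl, rfl⟩)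
      (Run.seq_map h1 (Dt.All_of_forall _ fun s => Run.det (p := .snd) rfl rfl))
    exact h2.mono (by decide)
  · rcases s with ⟨_ | _, n⟩
    · simp [ifP]
      funext b; cases b <;> simp [num_succ, ofBool]
    · simp [ifP, num_succ, ofBool]

/-- A random bit string that is as long as `L`. -/
def rand {α : Type} (L : List α) : Dt (List Bool) := Dt.mapRev (fun _ => Dt.coin) [] L

def randP : Prog := mapP .coin

theorem run_randP {α : Type} (e : α → Val) (L : List α) (env : Val) (hL : L.length ≤ β.B) :
    Run β 65 randP (.cons (list e L) env) ((rand L).map bits) :=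
  (Run.mapP e ofBool (fun _ => Dt.coin) (fun _ _ => Run.ev (p := .coin) rfl _) hL).mono (by decide)

theorem run_randP_short {α : Type} (e : α → Val) (L : List α) (env : Val) (hL : L.length ≤ β.t) :
    Run β 65 randP (.cons (list e L) env) ((rand L).map bits) :=
  (Run.mapP_short (p := .coin) e ofBool (fun _ => Dt.coin) rfl (fun _ => rfl) hL).mono (by decide)

/-- The inner product of bit strings. -/
def ip (s v : List Bool) : Bool :=
  (s.foldl (fun st a => (st.1.tail, xor st.2 (a && st.1.headD false))) (v, false)).2

def ipP : Prog :=
  .seq (.pair .fst (.pair (.pair .snd .nil) .nil))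
  (.seq (foldE (.pair (.seq (.seq (get 1) .fst) .snd)
    (xorP (.seq (get 1) .snd) (ifP .fst (.seq (.seq (get 1) .fst) .fst) .nil)))) .snd)

theorem run_ipP (s v : List Bool) (hL : s.length ≤ β.B) :
    Run β 200 ipP (.cons (bits s) (bits v)) (.ret (ofBool (ip s v))) := by
  have h1 := Run.foldE_det (β := β) (body := (.pair (.seq (.seq (get 1) .fst) .snd)
    (xorP (.seq (get 1) .snd) (ifP .fst (.seq (.seq (get 1) .fst) .fst) .nil))))
    (env := .nil) ofBool (fun s : List Bool × Bool => .cons (bits s.1) (ofBool s.2))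
    (fun st a => (st.1.tail, xor st.2 (a && st.1.headD false))) rfl
    (fun a st => by
      have h2 : ∀ v', ((ifP .fst (.seq (.seq (get 1) .fst) .fst) .nil)).ev (.cons (ofBool a) (.cons (.cons (bits st.1) (ofBool st.2)) v')) =
          .ret (ofBool (a && st.1.headD false)) := fun v' => by
        cases a
        · simp [ifP, ofBool]
        · simp only [ifP, Prog.ev, ev_get, nth_succ, nth_zero, fst_cons, snd_cons, fst_bits, Dt.ret_bind, isNil_ofBool]
          rfl
      rw [Prog.ev, ev_xorP (a := st.2) (by simp) (h2 _)]
      simp) (s := (v, false)) hL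
  exact (Run.call rfl (by simp; rfl) (Run.ret_seq h1 (Run.det (p := .snd) rfl rfl))).mono (by decide)

/-- The number of `false` minus the number of `true`. -/
def tally (L : List Bool) : ℤ := L.foldl (fun z a => z + if a then -1 else 1) 0

def majP : Prog :=
  .seq (.pair .id (.pair (.pair .nil .nil) .nil))
  (.seq (foldE (ifP .fst
    (ifP (.seq (get 1) .fst) (.pair (.seq (.seq (get 1) .fst) .snd) (.seq (get 1) .snd))
      (.pair (.seq (get 1) .fst) (.pair .nil (.seq (get 1) .snd))))
    (ifP (.seq (get 1) .snd) (.pair (.seq (get 1) .fst) (.seq (.seq (get 1) .snd) .snd))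
      (.pair (.pair .nil (.seq (get 1) .fst)) (.seq (get 1) .snd)))))
    (ifP .snd trueP .nil))

theorem run_majP (L : List Bool) (hL : L.length ≤ β.B) :
    Run β 300 majP (bits L) (.ret (ofBool (decide (tally L < 0)))) := by
  -- An integer is stored as the unary pair of its positive and negative parts, at most one of which
  -- is nonempty.
  have h1 := Run.foldE_det (β := β) (body := (ifP .fst
    (ifP (.seq (get 1) .fst) (.pair (.seq (.seq (get 1) .fst) .snd) (.seq (get 1) .snd))
      (.pair (.seq (get 1) .fst) (.pair .nil (.seq (get 1) .snd))))
    (ifP (.seq (get 1) .snd) (.pair (.seq (get 1) .fst) (.seq (.seq (get 1) .snd) .snd))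
      (.pair (.pair .nil (.seq (get 1) .fst)) (.seq (get 1) .snd)))))
    (env := .nil) ofBool (fun z : ℤ => .cons (num z.toNat) (num (-z).toNat))
    (fun z a => z + if a then -1 else 1) rfl
    (fun a z => by
      rcases lt_trichotomy z 0 with hz | rfl | hz
      · obtain ⟨n, rfl⟩ : ∃ n : ℕ, z = -((n : ℤ) + 1) := ⟨(-z - 1).toNat, by omega⟩
        have e1 : (-((n : ℤ) + 1)).toNat = 0 := by omega
        have e2 : (- -((n : ℤ) + 1)).toNat = n + 1 := by omega
        cases a
        · have e3 : (-((n : ℤ) + 1) + 1).toNat = 0 := by omega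
          have e4 : (-(-((n : ℤ) + 1) + 1)).toNat = n := by omega
          simp [ifP, e1, e3, e4, num_succ, -neg_add_rev]
        · have e3 : (-((n : ℤ) + 1) + -1).toNat = 0 := by omega
          have e4 : (-(-((n : ℤ) + 1) + -1)).toNat = n + 2 := by omega
          simp [ifP, e1, e3, e4, num_succ, -neg_add_rev]
      · cases a <;> simp [ifP, ofBool, num_succ]
      · obtain ⟨n, rfl⟩ : ∃ n : ℕ, z = (n : ℤ) + 1 := ⟨(z - 1).toNat, by omega⟩
        have e1 : ((n : ℤ) + 1).toNat = n + 1 := by omega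
        have e2 : (-((n : ℤ) + 1)).toNat = 0 := by omega
        cases a
        · have e3 : ((n : ℤ) + 1 + 1).toNat = n + 2 := by omega
          have e4 : (-((n : ℤ) + 1 + 1)).toNat = 0 := by omega
          simp [ifP, e1, e2, e3, e4, num_succ, -neg_add_rev]
        · have e3 : ((n : ℤ) + 1 + -1).toNat = n := by omega
          have e4 : (-((n : ℤ) + 1 + -1)).toNat = 0 := by omega
          simp only [if_true, e3, e4]
          simp [ifP, e1, e2, num_succ, -neg_add_rev]) (s := 0) hL
  refine (Run.call rfl (by simp) (Run.ret_seq h1 (Run.det (p := ifP .snd trueP .nil) (w := ofBool (decide (tally L < 0))) rfl ?_))).mono (by decide)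
  have : List.foldl (fun z a => z + if a = true then -1 else 1) 0 L = tally L := rfl
  rw [this]
  by_cases h : tally L < 0
  · obtain ⟨n, hn⟩ : ∃ n : ℕ, (-tally L).toNat = n + 1 := ⟨(-tally L - 1).toNat, by omega⟩
    simp [ifP, h, hn, num_succ, trueP, ofBool]
  · have hn : (-tally L).toNat = 0 := by omega
    simp [ifP, h, hn, ofBool]

end DPXor

namespace DPXor
open Val
variable {β : Budget}

/-! ### The list-decoding program -/

/-- Put `x` in front of `acc` if `b`, and otherwise the first element of `ys`, if there is one. -/
def pick {α : Type} (b : Bool) (x : α) (ys acc : List α) : List α :=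
  if b then x :: acc else match ys with
    | [] => acc
    | y :: _ => y :: acc

/-- The elements of `xs` at the places where `r` is `true` and those of `ys` at the other places,
in reverse order. -/
def choose {α : Type} : List α → List α → List Bool → List α → List α
  | [], _, _, acc => acc
  | x :: xs, ys, r, acc => choose xs ys.tail r.tail (pick (r.headD false) x ys acc)

theorem choose_length {α : Type} (xs ys : List α) (r : List Bool) (acc : List α) :
    (choose xs ys r acc).length ≤ xs.length + acc.length := by
  induction xs generalizing ys r acc with
  | nil => simp [choose]
  | cons x xs ih =>
    refine (ih _ _ _).trans ?_
    have : (pick (r.headD false) x ys acc).length ≤ acc.length + 1 := by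
      unfold pick; split_ifs
      · simp
      · cases ys <;> simp
    simp only [List.length_cons]
    omega

/-- The vector `r + u` plus the products of `s` with the columns. -/
def shift (s : List Bool) : ℕ → List Bool → List Bool → List (List Bool) → List Bool
  | 0, _, _, _ => []
  | k + 1, r, u, cols => xor (xor (r.headD false) (u.headD false)) (ip s (cols.headD [])) ::
      shift s k r.tail u.tail cols.tail

/-- One pass over `xs` computes both queries of a sample: `sel` for the vector `r`, and `sel'` for
`r` shifted by `u` and by the combination `s` of the hash columns. The other fields are the unread
parts of the inputs. -/
structure SelState (α : Type) where
  ys : List α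
  r : List Bool
  u : List Bool
  cols : List (List Bool)
  sel : List α
  sel' : List α

namespace SelState
variable {α : Type}

def enc (e : α → Val) (st : SelState α) : Val :=
  .cons (list e st.ys) (.cons (bits st.r) (.cons (bits st.u) (.cons (list bits st.cols)
    (.cons (list e st.sel) (list e st.sel')))))

def step (s : List Bool) (st : SelState α) (x : α) : SelState α where
  ys := st.ys.tail
  r := st.r.tail
  u := st.u.tail
  cols := st.cols.tail
  sel := pick (st.r.headD false) x st.ys st.sel
  sel' := pick (xor (xor (st.r.headD false) (st.u.headD false)) (ip s (st.cols.headD [])))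
    x st.ys st.sel'

theorem foldl_step (s : List Bool) (xs : List α) (st : SelState α) :
    (xs.foldl (step s) st).sel = choose xs st.ys st.r st.sel ∧
    (xs.foldl (step s) st).sel' =
      choose xs st.ys (shift s xs.length st.r st.u st.cols) st.sel' := by
  induction xs generalizing st with
  | nil => exact ⟨rfl, rfl⟩
  | cons x xs ih =>
    obtain ⟨h1, h2⟩ := ih (step s st x)
    exact ⟨h1, h2⟩

end SelState

def selField (i : ℕ) : Prog := .seq (get 2) (get i)

def pickP (b sel : Prog) : Prog :=
  ifP b (.pair (get 1) sel) (ifP (selField 0) (.pair (.seq (selField 0) .fst) sel) sel)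

def selectStep : Prog :=
  letP (.seq (.pair (from' 2) (.seq (get 1) (.seq (get 3) .fst))) ipP)
  (.pair (.seq (selField 0) .snd) (.pair (.seq (selField 1) .snd) (.pair (.seq (selField 2) .snd)
    (.pair (.seq (selField 3) .snd) (.pair (pickP (.seq (selField 1) .fst) (selField 4))
      (pickP (xorP (xorP (.seq (selField 1) .fst) (.seq (selField 2) .fst)) (get 0))
        (.seq (get 2) (from' 5))))))))

theorem run_selectStep {α : Type} (e : α → Val) (s : List Bool) (hs : s.length ≤ β.B)
    (x : α) (st : SelState α) : Run β 1000 selectStep (.cons (e x) (.cons (st.enc e) (bits s)))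
      (.ret ((st.step s x).enc e)) := by
  have h1 := Run.call (p := .pair (from' 2) (.seq (get 1) (.seq (get 3) .fst)))
    (v := .cons (e x) (.cons (st.enc e) (bits s))) rfl
    (by simp [SelState.enc, fst_cols]) (run_ipP s (st.cols.headD []) hs)
  refine (Run.ret_letP (j := 600) h1 ((Run.det (by decide) ?_).mono (by decide))).mono (by decide)
  have e1 : ∀ (b sel : Prog) (c : Bool) (l : List α) (h : Val),
      b.ev (.cons h (.cons (e x) (.cons (st.enc e) (bits s)))) = .ret (ofBool c) →
      sel.ev (.cons h (.cons (e x) (.cons (st.enc e) (bits s)))) = .ret (list e l) →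
      (pickP b sel).ev (.cons h (.cons (e x) (.cons (st.enc e) (bits s)))) =
        .ret (list e (pick c x st.ys l)) := by
    intro b sel c l h hb hsel
    rw [pickP, ev_ifP hb, ev_ifP (w := list e st.ys) (by simp [selField, SelState.enc])]
    cases c
    · rw [show (ofBool false).isNil = true from rfl, if_pos rfl, isNil_list]
      rcases hy : st.ys with _ | ⟨y, ys⟩
      · simpa [pick] using hsel
      · have h2 : (selField 0).ev (.cons h (.cons (e x) (.cons (st.enc e) (bits s)))) =
            .ret (list e (y :: ys)) := by simp [selField, SelState.enc, hy]
        simp [pick, Prog.ev, hsel, h2]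
    · simp [pick, hsel]
  simp only [Prog.ev]
  rw [e1 _ _ _ _ _ (by simp [selField, SelState.enc, fst_bits]; rfl)
    (by simp [selField, SelState.enc]; rfl), e1 _ _ _ st.sel' _ (ev_xorP (ev_xorP
      (by simp [selField, SelState.enc, fst_bits]; rfl)
      (by simp [selField, SelState.enc, fst_bits]; rfl)) (by simp; rfl))
      (by simp [SelState.enc])]
  simp [selField, SelState.enc, SelState.step]

def selectP : Prog := .seq (foldE selectStep) (from' 4)

theorem run_selectP {α : Type} (e : α → Val) (s : List Bool) (hs : s.length ≤ β.B)
    (xs ys : List α) (r u : List Bool) (cols : List (List Bool)) (hxs : xs.length ≤ β.B) :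
    Run β 1100 selectP (.cons (list e xs) (.cons (.cons (list e ys) (.cons (bits r) (.cons (bits u)
      (.cons (list bits cols) (.cons .nil .nil))))) (bits s)))
      (.ret (.cons (list e (choose xs ys r [])) (list e (choose xs ys (shift s xs.length r u cols) [])))) := by
  have h1 := Run.foldE_ret (β := β) e (SelState.enc e) (SelState.step s) (fun _ _ => True)
    (fun a l st _ => ⟨run_selectStep e s hs a st, trivial⟩) (s := ⟨ys, r, u, cols, [], []⟩) trivial hxs
  obtain ⟨h2, h3⟩ := SelState.foldl_step s xs ⟨ys, r, u, cols, [], []⟩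
  have h4 := Run.ret_seq h1 (Run.det (p := from' 4) rfl (by simp [SelState.enc]; rfl))
  rw [h2, h3] at h4
  exact h4.mono (by decide)

/-- One sample: for a random `r`, the answers for `r` and for the shifted vector, plus the product
of the random combination of hash functions with the guessed hash value. -/
def sample {α : Type} (o : List α → Dt Bool) (xs ys : List α) (l : ℕ) (v : List Bool)
    (cols : List (List Bool)) (u : List Bool) : Dt Bool :=
  (rand xs).bind fun r => (rand (List.replicate l ())).bind fun s =>
    (o (choose xs ys r [])).bind fun b =>
      (o (choose xs ys (shift s xs.length r u cols) [])).bind fun b' =>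
        .ret (xor (xor b b') (ip s v))

def sampleP (orc : Prog) : Prog :=
  letP (.seq (.pair (get 3) .nil) randP)
  (letP (.seq (.pair (get 6) .nil) randP)
  (letP (.seq (.pair (get 5) (.pair (.pair (get 6) (.pair (get 1) (.pair (get 3) (.pair (get 9)
    (.pair .nil .nil))))) (get 0))) selectP)
  (letP (.seq (.pair (.seq (get 0) .fst) (from' 11)) orc)
  (letP (.seq (.pair (.seq (get 1) .snd) (from' 12)) orc)
  (letP (.seq (.pair (get 3) (get 11)) ipP)
    (xorP (xorP (get 2) (get 1)) (get 0)))))))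

theorem rand_length {α : Type} (L : List α) : (rand L).All fun r => r.length = L.length := by
  simpa [rand] using Dt.mapRev_length (fun _ : α => Dt.coin) [] L

variable {α : Type} {e : α → Val} {o : List α → Dt Bool} {orc : Prog} {oenv : Val} {j : ℕ}
  {xs ys : List α}

/-- The exponent contains `2 * j` because the oracle is called twice. -/
theorem run_sampleP (ho : ∀ sel : List α, sel.length ≤ xs.length →
      Run β j orc (.cons (list e sel) oenv) ((o sel).map ofBool))
    (hxs : xs.length ≤ β.B) (l : ℕ) (hl : l ≤ β.B) (v : List Bool) (cols : List (List Bool))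
    (u : List Bool) (N d : Val) :
    Run β (2 * j + 5000) (sampleP orc) (.cons d (.cons (bits u) (.cons N (.cons (list e xs)
      (.cons (list e ys) (.cons (num l) (.cons (bits v) (.cons (list bits cols) oenv))))))))
      ((sample o xs ys l v cols u).map ofBool) := by
  simp only [sample, Dt.bind_map, Dt.ret_map]
  have c1 : (Prog.pair (.seq (get 0) .fst) (from' 11)).cost ≤ 90 := by decide
  have c2 : (Prog.pair (.seq (get 1) .snd) (from' 12)).cost ≤ 90 := by decide
  refine (Run.letP (i := 100) (j := 2 * j + 4800) ((Run.call rfl (by simp)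
    (run_randP e xs .nil hxs)).mono (by decide)) ((rand_length xs).mono fun r hr => ?_)).mono (by omega)
  refine (Run.letP (i := 200) (j := 2 * j + 4500) ((Run.call rfl (by simp; rfl)
    (run_randP _ (List.replicate l ()) .nil (by simpa using hl))).mono (by decide))
    ((rand_length _).mono fun s hs => ?_)).mono (by omega)
  have hs' : s.length ≤ β.B := by rw [hs]; simpa using hl
  refine (Run.ret_letP (i := 1400) (j := 2 * j + 3000) ((Run.call rfl (by simp)
    (run_selectP e s hs' xs ys r u cols hxs)).mono (by decide)) ?_).mono (by omega)
  refine (Run.letP (i := j + 100) (j := j + 2800) ((Run.call rfl (by simp)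
    (ho _ (choose_length xs ys r []))).mono (by omega)) (Dt.All_of_forall _ fun b => ?_)).mono (by omega)
  refine (Run.letP (i := j + 100) (j := 2600) ((Run.call rfl (by simp)
    (ho _ (choose_length xs ys (shift s xs.length r u cols) []))).mono (by omega))
    (Dt.All_of_forall _ fun b' => ?_)).mono (by omega)
  exact (Run.ret_letP (i := 500) (j := 1000) ((Run.call rfl (by simp)
    (run_ipP s v hs')).mono (by decide))
    ((Run.det rfl (ev_xorP (ev_xorP (by simp) (by simp)) (by simp))).mono
      (by decide))).mono (by omega)

/-- The majority of `N` samples. -/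
def estimate (o : List α → Dt Bool) (xs ys : List α) (N l : ℕ) (v : List Bool)
    (cols : List (List Bool)) (u : List Bool) : Dt Bool :=
  (Dt.mapRev (fun _ : Unit => sample o xs ys l v cols u) [] (List.replicate N ())).map
    fun L => decide (tally L < 0)

def estimateP (orc : Prog) : Prog :=
  .seq (.pair (get 1) .id) (.seq (mapP (sampleP orc)) majP)

theorem run_estimateP (ho : ∀ sel : List α, sel.length ≤ xs.length →
      Run β j orc (.cons (list e sel) oenv) ((o sel).map ofBool))
    (hxs : xs.length ≤ β.B) (l : ℕ) (hl : l ≤ β.B) (v : List Bool) (cols : List (List Bool))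
    (u : List Bool) (N : ℕ) (hN : N ≤ β.B) :
    Run β (2 * j + 6000) (estimateP orc) (.cons (bits u) (.cons (num N) (.cons (list e xs)
      (.cons (list e ys) (.cons (num l) (.cons (bits v) (.cons (list bits cols) oenv)))))))
      ((estimate o xs ys N l v cols u).map ofBool) := by
  have h1 := Run.mapP (β := β) (fun _ : Unit => nil) ofBool
    (fun _ => sample o xs ys l v cols u) (L := List.replicate N ())
    (fun a _ => run_sampleP ho hxs l hl v cols u (num N) nil) (by simpa using hN)
  have h2 := Run.call (p := .pair (get 1) .id) (v := .cons (bits u) (.cons (num N) (.cons (list e xs)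
      (.cons (list e ys) (.cons (num l) (.cons (bits v) (.cons (list bits cols) oenv)))))))
    rfl (by simp) (Run.seq_map h1
    ((Dt.mapRev_length _ _ _).mono fun L hL => run_majP L (by rw [hL]; simpa using hN)))
  refine (h2.mono ?_).congr (by simp [estimate, Dt.map_map])
  have : (Prog.pair (get 1) .id).cost ≤ 90 := by decide
  omega

/-- The unit vectors, in reverse order. -/
def units (k : ℕ) : List (List Bool) :=
  ((List.range k).map fun i => List.replicate i false ++ [true]).reverse

def unitsP : Prog :=
  .seq (.pair .id (.pair (.pair (.pair trueP .nil) .nil) .nil))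
  (.seq (foldE (.pair (.pair .nil (.seq (get 1) .fst)) (.seq (get 1) .id))) .snd)

theorem run_unitsP (hxs : xs.length ≤ β.B) :
    Run β 100 unitsP (list e xs) (.ret (list bits (units xs.length))) := by
  have h1 := Run.foldE_det (β := β) (env := .nil)
    (body := .pair (.pair .nil (.seq (get 1) .fst)) (.seq (get 1) .id))
    e (fun s : List Bool × List (List Bool) => .cons (bits s.1) (list bits s.2))
    (fun s _ => (false :: s.1, s.1 :: s.2)) rfl (by simp [ofBool]) (L := xs) (s := ([true], [])) hxs
  have h2 : ∀ (xs : List α) (i : ℕ),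
      xs.foldl (fun (s : List Bool × List (List Bool)) _ => (false :: s.1, s.1 :: s.2))
        (List.replicate i false ++ [true], units i) =
      (List.replicate (i + xs.length) false ++ [true], units (i + xs.length)) := by
    intro xs
    induction xs with
    | nil => simp
    | cons x xs ih =>
      intro i
      have := ih (i + 1)
      rw [List.foldl_cons, List.length_cons, show i + (xs.length + 1) = i + 1 + xs.length by omega,
        ← this]
      simp [units, List.range_succ, List.replicate_succ]
  have h3 := h2 xs 0
  simp only [List.replicate_zero, List.nil_append, Nat.zero_add] at h3
  rw [show units 0 = [] from rfl] at h3
  rw [h3] at h1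
  exact (Run.call rfl (by simp) (Run.ret_seq h1 (Run.det (p := .snd) rfl rfl))).mono (by decide)

/-- Guess a hash value and decode all bits. -/
def decode (o : List α → Dt Bool) (xs ys : List α) (N l : ℕ) : Dt (List Bool) :=
  (rand (List.replicate l ())).bind fun v =>
    (Dt.mapRev (fun _ : α => rand (List.replicate l ())) [] xs).bind fun cols =>
      Dt.mapRev (estimate o xs ys N l v cols) [] (units xs.length)

/-- List decoding with a random number of hash functions. -/
def listDecode (o : List α → Dt Bool) (xs ys : List α) (q : ℕ) : Dt (List Bool) :=
  (geo (List.replicate (lg q) ())).bind fun g => decode o xs ys ((4 * q) ^ 4 * xs.length) g.2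

/-- A program for a constant number. -/
def numP : ℕ → Prog
  | 0 => .nil
  | n + 1 => .pair .nil (numP n)

@[simp] theorem ev_numP (n : ℕ) (v : Val) : (numP n).ev v = .ret (num n) := by
  induction n with
  | zero => rfl
  | succ n ih => simp [numP, ih, num_succ]

def samplesP : Prog :=
  letP (.seq (.pair (get 5) (numP 4)) mulP) (letP (.seq (.pair (get 0) (get 0)) mulP)
    (letP (.seq (.pair (get 0) (get 0)) mulP) (.seq (.pair (get 0) (get 6)) mulP)))

theorem run_samplesP (q : ℕ) (hN : (4 * q) ^ 4 * xs.length ≤ β.B) (hq : (4 * q) ^ 4 ≤ β.B)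
    (hxs : xs.length ≤ β.B) (a b c d f : Val) :
    Run β 600 samplesP (.cons a (.cons b (.cons c (.cons (list e xs) (.cons d (.cons (num q) f))))))
      (.ret (num ((4 * q) ^ 4 * xs.length))) := by
  have hB := β.hB
  have hq1 : 4 * q ≤ (4 * q) ^ 4 := Nat.le_self_pow (by norm_num) _
  have hq2 : q * 4 * (q * 4) ≤ (4 * q) ^ 4 := by
    have : (4 * q) ^ 2 ≤ (4 * q) ^ 4 := by
      rcases Nat.eq_zero_or_pos q with rfl | h
      · simp
      · exact Nat.pow_le_pow_right (by omega) (by norm_num)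
    calc _ = (4 * q) ^ 2 := by ring
      _ ≤ _ := this
  have m1 := run_mulP (β := β) (fun _ : Unit => nil) (fun _ : Unit => nil) (List.replicate q ())
    (List.replicate 4 ()) (by simp; omega) (by simp; omega)
  have m2 := run_mulP (β := β) (fun _ : Unit => nil) (fun _ : Unit => nil) (List.replicate (q * 4) ())
    (List.replicate (q * 4) ()) (by simp; omega) (by simp; omega)
  have m3 := run_mulP (β := β) (fun _ : Unit => nil) (fun _ : Unit => nil)
    (List.replicate (q * 4 * (q * 4)) ()) (List.replicate (q * 4 * (q * 4)) ())
    (by simp; omega) (by simp; omega)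
  have m4 := run_mulP (β := β) (fun _ : Unit => nil) e
    (List.replicate (q * 4 * (q * 4) * (q * 4 * (q * 4))) ()) xs
    (by simp; refine le_trans (le_of_eq (by ring)) hq) hxs
  simp only [List.length_replicate] at m1 m2 m3 m4
  rw [show q * 4 * (q * 4) * (q * 4 * (q * 4)) * xs.length = (4 * q) ^ 4 * xs.length by ring] at m4
  exact Run.mono (Run.ret_letP (Run.call (by decide) (by simp; rfl) m1)
    (Run.ret_letP (Run.call (by decide) (by simp) m2)
    (Run.ret_letP (Run.call (by decide) (by simp) m3)
    (Run.call (by decide) (by simp) m4)))) (by decide)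

/-- Variables are positions in the environment, the latest binding first. The last tuple rearranges
them into the layout that `estimateP` and `sampleP` expect. -/
def decodeP (orc : Prog) : Prog :=
  letP (.seq (.seq (get 2) logP) geoP)
  (letP (.seq (.pair (get 0) .nil) randP)
  (letP (.seq (.pair (get 2) (get 1)) (mapP (.seq (.pair .snd .nil) randP)))
  (letP samplesP
  (letP (.seq (get 4) unitsP)
  (.seq (.pair (get 0) (.pair (get 1) (.pair (get 5) (.pair (get 6) (.pair (get 4) (.pair (get 3)
    (.pair (get 2) (from' 8)))))))) (mapP (estimateP orc)))))))

theorem geo_le (L : List α) : (geo L).All fun s => s.2 ≤ 2 * L.length + 2 := by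
  have : ∀ (L : List α) (s : Bool × ℕ), (Dt.foldl (fun (s : Bool × ℕ) _ => if s.1 then .ret (true, s.2 + 2) else
    .flip fun c => .ret (c, if c then s.2 + 2 else s.2)) s L).All fun s' => s'.2 ≤ 2 * L.length + s.2 := by
    intro L
    induction L with
    | nil => simp [Dt.foldl]
    | cons a l ih =>
      rintro ⟨b, n⟩
      rw [Dt.foldl, Dt.All_bind]
      cases b
      · simp only [Bool.false_eq_true, if_false, Dt.All_flip, Dt.All_ret]
        intro b
        refine (ih _).mono fun s hs => hs.trans ?_
        cases b <;> simp; omega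
      · simp only [if_true, Dt.All_ret]
        refine (ih _).mono fun s hs => hs.trans ?_
        simp; omega
  exact this L (false, 2)

theorem run_decodeP (ho : ∀ sel : List α, sel.length ≤ xs.length →
      Run β j orc (.cons (list e sel) oenv) ((o sel).map ofBool))
    (hxs : xs.length ≤ β.B) (q : ℕ) (hN : (4 * q) ^ 4 * xs.length ≤ β.B) (hq : (4 * q) ^ 4 ≤ β.B) :
    Run β (2 * j + 9000) (decodeP orc) (.cons (list e xs) (.cons (list e ys) (.cons (num q) oenv)))
      ((listDecode o xs ys q).map bits) := by
  have hB := β.hB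
  have hq1 : 4 * q ≤ (4 * q) ^ 4 := Nat.le_self_pow (by norm_num) _
  have hlg := lg_le q
  have g1 := run_logP (β := β) (fun _ : Unit => nil) (List.replicate q ()) (by simp; omega)
  simp only [List.length_replicate] at g1
  have g2 := run_geoP (β := β) (fun _ : Unit => nil) (List.replicate (lg q) ()) (by simp; omega)
  simp only [listDecode, decode, Dt.bind_map]
  refine (Run.letP (i := 700) (j := 2 * j + 8000) ((Run.ret_seq (Run.call rfl (by simp) g1) g2).mono (by decide))
    ((geo_le _).mono fun g hg => ?_)).mono (by omega)
  have hg' : g.2 ≤ β.B := by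
    simp only [List.length_replicate] at hg
    have : 4 * q ≤ β.B := hq1.trans hq
    omega
  have c1 := Run.mapP (β := β) (j := 200) (p := .seq (.pair .snd .nil) randP) (env := num g.2) e bits
    (fun _ => rand (List.replicate g.2 ())) (L := xs) (fun a _ =>
      (Run.call rfl (by simp; rfl) (run_randP _ (List.replicate g.2 ()) .nil (by simpa using hg'))).mono (by decide)) hxs
  have c2 : (Prog.pair (get 0) (.pair (get 1) (.pair (get 5) (.pair (get 6) (.pair (get 4)
      (.pair (get 3) (.pair (get 2) (from' 8)))))))).cost ≤ 180 := by decide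
  refine (Run.letP (i := 100) (j := 2 * j + 7800) ((Run.call rfl (by simp; rfl)
    (run_randP _ (List.replicate g.2 ()) .nil (by simpa using hg'))).mono (by decide))
    (Dt.All_of_forall _ fun v => ?_)).mono (by omega)
  refine (Run.letP (i := 400) (j := 2 * j + 7200) ((Run.call rfl (by simp) c1).mono (by decide))
    (Dt.All_of_forall _ fun cols => ?_)).mono (by omega)
  refine (Run.ret_letP (i := 700) (j := 2 * j + 6480)
    ((run_samplesP q hN hq hxs _ _ _ _ _).mono (by decide)) ?_).mono (by omega)
  refine (Run.ret_letP (i := 200) (j := 2 * j + 6250)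
    ((Run.call rfl (by simp) (run_unitsP (e := e) hxs)).mono (by decide)) ?_).mono (by omega)
  exact (Run.call rfl (by simp) (Run.mapP bits ofBool
    (estimate o xs ys ((4 * q) ^ 4 * xs.length) g.2 v cols)
    (fun u _ => run_estimateP ho hxs g.2 hg' v cols u _ hN) (L := units xs.length)
    (by simpa [units] using hxs))).mono (by omega)

end DPXor

namespace DPXor
open Val
variable {β : Budget}

/-! ### The oracle: queries to the given program -/

/-- Move a pointer into a circular list by one place. -/
def advance {α : Type} (full ptr : List α) : List α :=
  if ptr.tail.isEmpty then full else ptr.tail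

def advanceP : Prog := foldE (ifP (.seq (get 1) .snd) (.seq (get 1) .snd) (from' 2))

theorem run_advanceP {α : Type} (e : α → Val) (n : ℕ) (full ptr : List α) (hn : n ≤ β.B) :
    Run β 100 advanceP (.cons (num n) (.cons (list e ptr) (list e full)))
      (.ret (list e ((advance full)^[n] ptr))) := by
  have h1 := Run.foldE_det (β := β) (env := list e full)
    (body := ifP (.seq (get 1) .snd) (.seq (get 1) .snd) (from' 2)) (fun _ : Unit => nil) (list e)
    (fun s _ => advance full s) rfl (fun a s => by
      rw [ev_ifP (w := list e s.tail) (by simp), isNil_list, advance]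
      split_ifs <;> simp) (L := List.replicate n ()) (s := ptr) (by simpa using hn)
  have h2 : ∀ (n : ℕ) (ptr : List α), (List.replicate n ()).foldl (fun s _ => advance full s) ptr =
      (advance full)^[n] ptr := by
    intro n
    induction n with
    | zero => intro; rfl
    | succ n ih => intro ptr; simp [List.replicate_succ, ih]
  rw [h2] at h1
  exact h1.mono (by decide)

/-- Walk through the circular list `sel` in steps of size `n`, as often as it has elements, and put
the elements that are met in front of `Z`. -/
def dilate {α : Type} (n : ℕ) (sel Z : List α) : List α :=
  (sel.foldl (fun (s : List α × List α) _ =>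
    ((advance sel)^[n] s.1, s.1.head?.toList ++ s.2)) (sel, Z)).2

def dilateP : Prog :=
  .seq (.pair (get 0) (.pair (.pair (get 0) (from' 2)) (.pair (get 1) (get 0))))
  (.seq (foldE (.pair (.seq (.pair (get 2) (.pair (.seq (get 1) .fst) (from' 3))) advanceP)
    (.pair (.seq (.seq (get 1) .fst) .fst) (.seq (get 1) .snd)))) .snd)

/-- The pointer is dereferenced by `fst`, which would yield a spurious empty tree on an empty list.
-/
theorem advance_iterate_ne_nil {α : Type} {full : List α} (h : full ≠ []) (n : ℕ) :
    ∀ {ptr : List α}, ptr ≠ [] → (advance full)^[n] ptr ≠ [] := by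
  induction n with
  | zero => exact fun h => h
  | succ n ih =>
    intro ptr hp
    refine ih ?_
    unfold advance
    split_ifs with h1
    · exact h
    · simpa using h1

theorem run_dilateP {α : Type} (e : α → Val) (n : ℕ) (sel Z : List α) (hn : n ≤ β.B)
    (hsel : sel.length ≤ β.B) :
    Run β 400 dilateP (.cons (list e sel) (.cons (num n) (list e Z)))
      (.ret (list e (dilate n sel Z))) := by
  have h1 := Run.foldE_ret (β := β) (j := 300) (env := .cons (num n) (list e sel))
    (body := .pair (.seq (.pair (get 2) (.pair (.seq (get 1) .fst) (from' 3))) advanceP)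
      (.pair (.seq (.seq (get 1) .fst) .fst) (.seq (get 1) .snd)))
    e (fun s : List α × List α => .cons (list e s.1) (list e s.2))
    (fun (s : List α × List α) _ => ((advance sel)^[n] s.1, s.1.head?.toList ++ s.2))
    (fun l s => l.length ≤ sel.length ∧ (sel ≠ [] → s.1 ≠ [])) (fun a l s hs => ?_)
    (L := sel) (s := (sel, Z)) (by simp) hsel
  · exact (Run.call rfl (by simp) (Run.ret_seq h1 (Run.det (p := .snd) rfl rfl))).mono (by decide)
  · have hsel' : sel ≠ [] := by rintro rfl; simp at hs
    refine ⟨?_, by have := hs.1; simp at this; omega, fun _ => advance_iterate_ne_nil hsel' _ (hs.2 hsel')⟩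
    have h2 := Run.ret_pair_ret (Run.call (p := (.pair (get 2) (.pair (.seq (get 1) .fst) (from' 3))))
      (v := .cons (e a) (.cons (.cons (list e s.1) (list e s.2)) (.cons (num n) (list e sel)))) rfl
      (by simp) (run_advanceP e n sel s.1 hn))
      (Run.det (p := (.pair (.seq (.seq (get 1) .fst) .fst) (.seq (get 1) .snd)))
        (w := list e (s.1.head?.toList ++ s.2)) rfl
        (by rcases hp : s.1 with _ | ⟨y, ys⟩
            · exact absurd hp (hs.2 hsel')
            · simp))
    exact h2.mono (by decide)

/-- The answer to the query with the strings `sel`: if the resulting tuple has length `k`, whether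
the output of the given program is nonempty, and a coin otherwise. -/
def oracle {α : Type} (c : List α → Dt Val) (k n : ℕ) (Z sel : List α) : Dt Bool :=
  if (dilate n sel Z).length = k then (c (dilate n sel Z)).map fun w => !w.isNil else .coin

/-- Equality of the length of the query with `k` is tested by dropping each list from the other; `k`
itself is available only as the length of the input. -/
def oracleP (C' : Prog) : Prog :=
  letP (.seq (.pair (get 0) (.pair (get 2) (from' 3))) dilateP)
  (ifP (.seq (.pair (get 2) (.pair (get 0) .nil)) dropP) .coin
    (ifP (.seq (.pair (get 0) (.pair (get 2) .nil)) dropP) .coin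
      (.seq (.seq (get 0) C') (ifP .id trueP .nil))))

theorem dilate_length {α : Type} (n : ℕ) (sel Z : List α) :
    (dilate n sel Z).length ≤ sel.length + Z.length := by
  have : ∀ (L : List α) (s : List α × List α), ((L.foldl (fun (s : List α × List α) _ =>
      ((advance sel)^[n] s.1, s.1.head?.toList ++ s.2)) s).2).length ≤ L.length + s.2.length := by
    intro L
    induction L with
    | nil => simp
    | cons a l ih =>
      intro s
      refine (ih _).trans ?_
      have : s.1.head?.toList.length ≤ 1 := by cases s.1 <;> simp
      simp only [List.length_append, List.length_cons]
      omega
  exact this sel (sel, Z)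

theorem run_oracleP {α : Type} {e : α → Val} {c : List α → Dt Val} {C' : Prog} {k : ℕ}
    (hC : ∀ L : List α, L.length = k → Run β 0 C' (list e L) (c L))
    (X Z sel : List α) (n : ℕ) (hX : X.length = k) (hk : k ≤ β.B) (hn : n ≤ β.B)
    (hsel : sel.length + Z.length ≤ β.B) :
    Run β 1500 (oracleP C') (.cons (list e sel) (.cons (list e X) (.cons (num n) (list e Z))))
      ((oracle c k n Z sel).map ofBool) := by
  have hlen := dilate_length n sel Z
  refine (Run.ret_letP (i := 500) (j := 900) ((Run.call rfl (by simp) (run_dilateP e n sel Z hn (by omega))).mono (by decide))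
    ?_).mono (by omega)
  refine (Run.ifP (i := 10) (j := 700) (k := 100) ((Run.call rfl (by simp) (run_dropP e e X (dilate n sel Z) .nil
    (by omega))).mono (by decide)) (fun h => ?_) (fun h => ?_)).mono (by omega)
  · rw [isNil_list, List.isEmpty_eq_false_iff, ne_eq, List.drop_eq_nil_iff] at h
    rw [oracle, if_neg (by omega)]
    exact Run.mono (Run.ev (p := .coin) rfl _) (by decide)
  · rw [isNil_list, List.isEmpty_iff, List.drop_eq_nil_iff] at h
    refine (Run.ifP (i := 10) (j := 500) (k := 100) ((Run.call rfl (by simp) (run_dropP e e (dilate n sel Z) X .nil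
      (by omega))).mono (by decide)) (fun h' => ?_) (fun h' => ?_)).mono (by omega)
    · rw [isNil_list, List.isEmpty_eq_false_iff, ne_eq, List.drop_eq_nil_iff] at h'
      rw [oracle, if_neg (by omega)]
      exact Run.mono (Run.ev (p := .coin) rfl _) (by decide)
    · rw [isNil_list, List.isEmpty_iff, List.drop_eq_nil_iff] at h'
      rw [oracle, if_pos (by omega), Dt.map_map]
      have h1 := hC (dilate n sel Z) (by omega)
      rw [← Dt.map_id (c _)] at h1
      refine (Run.seq_map (i := 50) (j := 100) ((Run.call rfl (by simp) h1).mono (by decide))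
        (Dt.All_of_forall _ fun w => ?_)).mono (by omega)
      refine Run.mono (Run.det rfl ?_) (show _ ≤ 100 by decide)
      rw [ev_ifP (w := w) rfl]
      cases w <;> simp [ofBool]

/-! ### Search for a prime number -/

/-- A cyclic counter for residues modulo `d`: starting from zero, after `c` steps it holds the
residue of `-c`, so it is zero exactly at the multiples of `d`. -/
def countdown (d p : ℕ) : ℕ := if p = 0 then d - 1 else p - 1

theorem countdown_iterate (d : ℕ) (hd : 0 < d) (c : ℕ) :
    (countdown d)^[c] 0 < d ∧ d ∣ (countdown d)^[c] 0 + c := by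
  induction c with
  | zero => simpa using hd
  | succ c ih =>
    rw [Function.iterate_succ_apply']
    obtain ⟨h1, h2⟩ := ih
    generalize (countdown d)^[c] 0 = p at h1 h2 ⊢
    unfold countdown
    split_ifs with h
    · rw [h] at h2
      refine ⟨by omega, ?_⟩
      rw [show d - 1 + (c + 1) = d + (0 + c) by omega]
      exact Dvd.dvd.add dvd_rfl h2
    · refine ⟨by omega, ?_⟩
      rwa [show p - 1 + (c + 1) = p + c by omega]

theorem countdown_eq_zero_iff (d : ℕ) (hd : 0 < d) (c : ℕ) : (countdown d)^[c] 0 = 0 ↔ d ∣ c := by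
  obtain ⟨h1, h2⟩ := countdown_iterate d hd c
  constructor
  · intro h; rwa [h, zero_add] at h2
  · intro h
    exact Nat.eq_zero_of_dvd_of_lt ((Nat.dvd_add_left h).1 h2) h1

/-- `(c, d) ↦` zero if and only if `d` divides `c` -/
def divP : Prog :=
  .seq (.pair .fst (.pair .nil .snd)) (foldE (ifP (get 1) (.seq (get 1) .snd) (.seq (from' 2) .snd)))

theorem run_divP (c d : ℕ) (hc : c ≤ β.B) :
    Run β 100 divP (.cons (num c) (num d)) (.ret (num ((countdown d)^[c] 0))) := by
  have h1 := Run.foldE_det (β := β) (env := num d)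
    (body := ifP (get 1) (.seq (get 1) .snd) (.seq (from' 2) .snd)) (fun _ : Unit => nil) num
    (fun s _ => countdown d s) rfl (fun a s => by
      rw [ev_ifP (w := num s) (by simp), isNil_num, countdown]
      split_ifs with h1 h2 h2
      · simp
      · simp_all
      · simp_all
      · simp) (L := List.replicate c ()) (s := 0) (by simpa using hc)
  have h2 : ∀ (n p : ℕ), (List.replicate n ()).foldl (fun s _ => countdown d s) p =
      (countdown d)^[n] p := by
    intro n
    induction n with
    | zero => intro; rfl
    | succ n ih => intro ptr; simp [List.replicate_succ, ih]
  rw [h2] at h1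
  exact (Run.call rfl (by simp) h1).mono (by decide)

/-- Whether a number is prime. -/
def primeP : Prog :=
  .seq (.pair (from' 2) (.pair (.pair (numP 2) .nil) .id))
  (letP (foldE (.seq (.pair (.seq (.pair (from' 2) (.seq (get 1) .fst)) divP) (get 1))
      (.pair (.pair .nil (.seq (get 1) .id)) (ifP .fst (from' 2) trueP))))
    (ifP (.seq (from' 3) .snd) (ifP (.seq (get 0) .snd) .nil trueP) .nil))

theorem run_primeP (c : ℕ) (hc : c ≤ β.B) :
    Run β 1000 primeP (num c) (.ret (ofBool (decide c.Prime))) := by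
  classical
  -- Trial division by `2, …, c - 1`: the state is the next divisor and whether some divisor has
  -- been found.
  let g : ℕ × Bool → Unit → ℕ × Bool := fun s _ => (s.1 + 1, s.2 || decide (s.1 ∣ c))
  have h1 := Run.foldE_ret (β := β) (j := 500) (env := num c)
    (body := .seq (.pair (.seq (.pair (from' 2) (.seq (get 1) .fst)) divP) (get 1))
      (.pair (.pair .nil (.seq (get 1) .id)) (ifP .fst (from' 2) trueP)))
    (fun _ : Unit => nil) (fun s : ℕ × Bool => .cons (num s.1) (ofBool s.2)) g
    (fun _ s => 0 < s.1) (fun a l s hs => ⟨?_, Nat.succ_pos _⟩)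
    (L := List.replicate (c - 2) ()) (s := (2, false)) (by simp) (by simp; omega)
  · have h2 : ∀ (n : ℕ) (s : ℕ × Bool), (List.replicate n ()).foldl g s =
        (s.1 + n, s.2 || decide (∃ d, s.1 ≤ d ∧ d < s.1 + n ∧ d ∣ c)) := by
      intro n
      induction n with
      | zero =>
        intro s
        have : ¬∃ d, s.1 ≤ d ∧ d < s.1 + 0 ∧ d ∣ c := by rintro ⟨d, h1, h2, -⟩; omega
        rw [decide_eq_false this, Bool.or_false]
        rfl
      | succ n ih =>
        intro s
        rw [List.replicate_succ, List.foldl_cons, ih]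
        simp only [g, Prod.mk.injEq]
        refine ⟨by omega, ?_⟩
        rw [Bool.eq_iff_iff]
        simp only [Bool.or_eq_true, decide_eq_true_eq, or_assoc]
        refine or_congr_right ⟨?_, ?_⟩
        · rintro (h | ⟨d, h1, h2, h3⟩)
          · exact ⟨_, le_rfl, by omega, h⟩
          · exact ⟨d, by omega, by omega, h3⟩
        · rintro ⟨d, h1, h2, h3⟩
          rcases h1.eq_or_lt with rfl | h1
          · exact Or.inl h3
          · exact Or.inr ⟨d, by omega, by omega, h3⟩
    rw [h2] at h1
    refine (Run.call rfl (by simp [rest, num_succ, Nat.sub_sub, ofBool]) (Run.ret_letP h1 (Run.det rfl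
      (?_ : _ = Dt.ret (ofBool (decide c.Prime)))))).mono (by decide)
    have hp := @Nat.prime_def_lt' c
    rw [ev_ifP (w := num (c - 1)) (by simp), ev_ifP
      (w := ofBool (decide (∃ d, 2 ≤ d ∧ d < 2 + (c - 2) ∧ d ∣ c))) (by simp), isNil_num, isNil_ofBool]
    by_cases h3 : c.Prime
    · have h4 := hp.1 h3
      rw [if_neg (by simp; omega), if_pos]
      · simp [h3]
      · simp only [Bool.not_eq_true', decide_eq_false_iff_not]
        rintro ⟨d, h5, h6, h7⟩
        exact h4.2 d h5 (by omega) h7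
    · by_cases h5 : 2 ≤ c
      · rw [if_neg (by simp; omega), if_neg]
        · simp [h3, ofBool]
        · have : ¬∀ m, 2 ≤ m → m < c → ¬m ∣ c := fun h => h3 (hp.2 ⟨h5, h⟩)
          push Not at this
          obtain ⟨d, h6, h7, h8⟩ := this
          simp only [Bool.not_eq_true', decide_eq_false_iff_not, not_not]
          exact ⟨d, h6, by omega, h8⟩
      · rw [if_pos (by simp; omega)]
        simp [h3, ofBool]
  · have h3 := Run.ret_pair_ret (Run.call (p := .pair (from' 2) (.seq (get 1) .fst))
      (v := .cons nil (.cons (.cons (num s.1) (ofBool s.2)) (num c))) rfl (by simp)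
      (run_divP (β := β) c s.1 hc)) (Run.det (p := get 1) rfl (by simp; rfl))
    refine (Run.ret_seq h3 (Run.det rfl ?_)).mono (by decide)
    have h4 := countdown_eq_zero_iff s.1 hs c
    simp only [Prog.ev]
    rw [ev_ifP (w := num ((countdown s.1)^[c] 0)) rfl, isNil_num]
    by_cases h5 : s.1 ∣ c
    · rw [if_pos (by simpa using h4.2 h5)]
      simp [g, h5, num_succ]
    · rw [if_neg (by simpa using fun h => h5 (h4.1 h))]
      simp [g, h5, num_succ]

/-- The largest prime number that is at most the length of a list. -/
def findPrimeP : Prog :=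
  .seq (.pair .id (.pair (.pair .nil .nil) .nil))
  (.seq (foldE (letP (.seq (.pair .nil (.seq (get 1) .fst)) primeP)
    (.pair (.pair .nil (.seq (get 2) .fst))
      (ifP (get 0) (.pair .nil (.seq (get 2) .fst)) (.seq (get 2) .snd))))) .snd)

theorem run_findPrimeP {α : Type} (e : α → Val) (X : List α) (hX : X.length ≤ β.B) :
    Run β 1500 findPrimeP (list e X) (.ret (num (Nat.findGreatest Nat.Prime X.length))) := by
  have h1 := Run.foldE_ret (β := β) (j := 1300) (env := .nil)
    (body := letP (.seq (.pair .nil (.seq (get 1) .fst)) primeP)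
    (.pair (.pair .nil (.seq (get 2) .fst))
      (ifP (get 0) (.pair .nil (.seq (get 2) .fst)) (.seq (get 2) .snd))))
    e (fun s : ℕ × ℕ => .cons (num s.1) (num s.2))
    (fun s _ => (s.1 + 1, if (s.1 + 1).Prime then s.1 + 1 else s.2))
    (fun l s => s.1 + l.length ≤ β.B) (fun a l s hs => ⟨?_, by simp only [List.length_cons] at hs; simp only; omega⟩)
    (L := X) (s := (0, 0)) (by simpa using hX) hX
  · have h2 : ∀ (X : List α) (i : ℕ), X.foldl (fun (s : ℕ × ℕ) _ =>
        (s.1 + 1, if (s.1 + 1).Prime then s.1 + 1 else s.2)) (i, Nat.findGreatest Nat.Prime i) =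
        (i + X.length, Nat.findGreatest Nat.Prime (i + X.length)) := by
      intro X
      induction X with
      | nil => intro; rfl
      | cons x X ih =>
        intro i
        have := ih (i + 1)
        rw [List.foldl_cons, List.length_cons, show i + (X.length + 1) = i + 1 + X.length by omega,
          ← this, Nat.findGreatest_succ]
    have h3 := h2 X 0
    simp only [Nat.findGreatest_zero, zero_add] at h3
    rw [h3] at h1
    exact (Run.call rfl (by simp) (Run.ret_seq h1 (Run.det (p := .snd) rfl rfl))).mono (by decide)
  · simp only [List.length_cons] at hs
    refine (Run.ret_letP (i := 1100) (j := 100) ((Run.call rfl (by simp [num_succ]) (run_primeP (s.1 + 1) (by omega))).mono (by decide))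
      ((Run.det rfl ?_).mono (by decide))).mono (by omega)
    simp only [Prog.ev]
    rw [ev_ifP (w := ofBool (decide (s.1 + 1).Prime)) (by simp), isNil_ofBool]
    by_cases h : (s.1 + 1).Prime
    · simp [h, num_succ]
    · simp [h, num_succ]

/-! ### Random numbers and lists -/

/-- A random number below `2 ^ L.length`. -/
def randNum {α : Type} (L : List α) : Dt ℕ :=
  Dt.foldl (fun a _ => .flip fun b => .ret (a * 2 + b.toNat)) 0 L

def randNumP : Prog :=
  .seq (.pair .id (.pair .nil .nil))
    (foldE (.seq (.pair .coin (.seq (.pair (get 1) (numP 2)) mulP)) (ifP .fst (.pair .nil .snd) .snd)))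

theorem run_randNumP {α : Type} (e : α → Val) (L : List α) (hL : 2 ^ L.length ≤ β.B) :
    Run β 300 randNumP (list e L) ((randNum L).map num) := by
  have hL' : L.length ≤ β.B := Nat.lt_two_pow_self.le.trans hL
  -- The invariant bounds every number that can still arise from the prefix read so far, so unary
  -- arithmetic stays within the budget.
  have h1 := Run.foldE (β := β) (j := 250) (env := .nil)
    (body := .seq (.pair .coin (.seq (.pair (get 1) (numP 2)) mulP)) (ifP .fst (.pair .nil .snd) .snd))
    e num (fun a _ => .flip fun b => .ret (a * 2 + b.toNat)) (fun l a => (a + 1) * 2 ^ l.length ≤ β.B)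
    (fun x l a ha => ⟨?_, ?_⟩) (L := L) (s := 0) (by simpa using hL) hL'
  · exact (Run.call rfl (by simp) h1).mono (by decide)
  · have hB := β.hB
    have ha' : a ≤ β.B := le_trans (by nlinarith [Nat.one_le_two_pow (n := (x :: l).length)]) ha
    have h2 := run_mulP (β := β) (fun _ : Unit => nil) (fun _ : Unit => nil) (List.replicate a ())
      (List.replicate 2 ()) (by simpa using ha') (by simp; omega)
    simp only [List.length_replicate] at h2
    have h3 := Run.pair_ret (m := Dt.coin) (e := ofBool) (Run.ev (p := .coin) rfl
      (.cons (e x) (.cons (num a) .nil)))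
      (Run.call (p := .pair (get 1) (numP 2)) rfl (by simp; rfl) h2)
    refine ((Run.seq (j := 50) (q := ifP .fst (.pair .nil .snd) .snd)
      (g := fun b => .ret (num (a * 2 + b.toNat))) h3 (Dt.All_of_forall _ fun b => ?_)).mono (by decide)).congr ?_
    · refine (Run.det rfl ?_).mono (by decide)
      rw [ev_ifP (w := ofBool b) rfl]
      cases b <;> simp [num_succ]
    · simp [Dt.coin]
  · simp only [Dt.All_flip, Dt.All_ret]
    intro b
    simp only [List.length_cons, pow_succ] at ha
    refine le_trans ?_ ha
    rw [mul_comm (2 ^ l.length) 2, ← mul_assoc]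
    refine Nat.mul_le_mul_right _ ?_
    cases b <;> simp; omega

/-- Move the first element to the end. -/
def rot {α : Type} (xs : List α) : List α := xs.tail ++ xs.head?.toList

def rotP : Prog :=
  .seq (.pair (.seq (.pair .snd (.pair .nil .nil)) revApp) (.pair (.pair .fst .nil) .nil)) revApp

theorem run_rotP {α : Type} (e : α → Val) (xs : List α) (h : xs ≠ []) (hxs : xs.length ≤ β.B) :
    Run β 100 rotP (list e xs) (.ret (list e (rot xs))) := by
  obtain ⟨x, xs, rfl⟩ := List.exists_cons_of_ne_nil h
  simp only [List.length_cons] at hxs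
  have h1 := run_revApp (β := β) e xs [] .nil (by omega)
  have h2 := run_revApp (β := β) e (xs.reverse ++ []) [x] .nil (by simp; omega)
  refine (Run.mono (Run.ret_seq (Run.ret_pair_ret (Run.call rfl (by simp) h1)
    (Run.det (p := (.pair (.pair .fst .nil) .nil)) rfl (by simp))) h2) (by decide)).congr ?_
  simp [rot]

/-- The values along a cycle, from the last to the first, computed from the first value and the
differences of successive values. -/
def recon (g : Bool) (A B : List Bool) : List Bool :=
  (A.foldl (fun (s : Bool × List Bool × List Bool) a =>
    (xor (xor s.1 a) (s.2.1.headD false), s.2.1.tail, xor s.1 a :: s.1 :: s.2.2)) (g, B, [])).2.2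

def reconP : Prog :=
  .seq (.pair (get 0) (.pair (.pair (get 1) (.pair (from' 2) .nil)) .nil))
  (.seq (foldE (.pair (xorP (xorP (.seq (get 1) (get 0)) .fst) (.seq (.seq (get 1) (get 1)) .fst))
    (.pair (.seq (.seq (get 1) (get 1)) .snd) (.pair (xorP (.seq (get 1) (get 0)) .fst)
      (.pair (.seq (get 1) (get 0)) (.seq (get 1) (from' 2))))))) (from' 2))

theorem run_reconP (g : Bool) (A B : List Bool) (hA : A.length ≤ β.B) :
    Run β 400 reconP (.cons (bits A) (.cons (ofBool g) (bits B))) (.ret (bits (recon g A B))) := by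
  have h1 := Run.foldE_det (β := β) (env := .nil)
    (body := (.pair (xorP (xorP (.seq (get 1) (get 0)) .fst) (.seq (.seq (get 1) (get 1)) .fst))
    (.pair (.seq (.seq (get 1) (get 1)) .snd) (.pair (xorP (.seq (get 1) (get 0)) .fst)
      (.pair (.seq (get 1) (get 0)) (.seq (get 1) (from' 2)))))))
    ofBool (fun s : Bool × List Bool × List Bool => .cons (ofBool s.1) (.cons (bits s.2.1) (bits s.2.2)))
    (fun (s : Bool × List Bool × List Bool) a =>
      (xor (xor s.1 a) (s.2.1.headD false), s.2.1.tail, xor s.1 a :: s.1 :: s.2.2)) rfl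
    (fun a s => by
      have e1 := ev_xorP (p := .seq (get 1) (get 0)) (q := .fst) (a := s.1) (b := a)
        (v := .cons (ofBool a) (.cons (.cons (ofBool s.1) (.cons (bits s.2.1) (bits s.2.2))) .nil))
        (by simp) (by simp)
      have e2 := ev_xorP (q := .seq (.seq (get 1) (get 1)) .fst) (b := s.2.1.headD false) e1
        (by simp [fst_bits])
      simp only [Prog.ev] at e1 e2 ⊢
      rw [e1, e2]
      simp)
    (L := A) (s := (g, B, [])) hA
  exact (Run.call rfl (by simp) (Run.ret_seq h1 (Run.det (p := from' 2) rfl (by simp only [ev_from]; rfl)))).mono (by decide)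

end DPXor

namespace DPXor
open Val
variable {β : Budget}

/-! ### The two strategies and the main program -/

theorem rand_eq {α : Type} (L : List α) : rand L = rand (List.replicate L.length ()) := by
  have : ∀ (L : List α) (acc : List Bool), Dt.mapRev (fun _ => Dt.coin) acc L =
      Dt.mapRev (fun _ => Dt.coin) acc (List.replicate L.length ()) := by
    intro L
    induction L with
    | nil => intro; rfl
    | cons a l ih =>
      intro acc
      simp only [Dt.mapRev, Dt.foldl, List.length_cons, List.replicate_succ] at ih ⊢
      congr 1
      funext s
      exact ih s
  exact this L []

/-- A random bit string. -/
def randStr (n : ℕ) : Dt (Fin n → Bool) :=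
  (rand (List.replicate n ())).map fun l j => l.getD j false

/-- A list of random bit strings that is as long as `L`. -/
def randStrs (n : ℕ) {α : Type} (L : List α) : Dt (List (Fin n → Bool)) :=
  Dt.mapRev (fun _ => randStr n) [] L

theorem randStrs_length (n : ℕ) {α : Type} (L : List α) :
    (randStrs n L).All fun l => l.length = L.length := by
  simpa [randStrs] using Dt.mapRev_length (fun _ : α => randStr n) [] L

theorem ofBits_eq {n : ℕ} (x : Fin n → Bool) : ofBits x = bits (List.ofFn x) := by
  simp [ofBits, bits, list, List.map_ofFn, Function.comp_def]

theorem ofTuple_eq {k n : ℕ} (x : Fin k → Fin n → Bool) :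
    ofTuple x = list ofBits (List.ofFn x) := by
  simp [ofTuple, list, List.map_ofFn, Function.comp_def]

/-- The length `n` is not given as a number; it is read off a string of the input, whose bits serve
as a clock. -/
def randStrP : Prog := .seq (.pair .snd .nil) randP

theorem run_randStrP {n : ℕ} (hn : n ≤ β.t) (a : Val) (x : Fin n → Bool) :
    Run β 100 randStrP (.cons a (ofBits x)) ((randStr n).map ofBits) := by
  have h1 := run_randP_short (β := β) ofBool (List.ofFn x) .nil (by simpa using hn)
  refine ((Run.call rfl (by simp [ofBits_eq]) h1).mono (by decide)).congr ?_
  rw [rand_eq, List.length_ofFn, randStr, Dt.map_map]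
  refine Dt.bind_congr ((rand_length _).mono fun l hl => ?_)
  rw [List.length_replicate] at hl
  simp only [ofBits_eq]
  congr 2
  apply List.ext_getElem
  · simp [hl]
  · intro i h1 h2
    simp [h1]

theorem run_randStrs {n : ℕ} (hn : n ≤ β.t) {α : Type} (ea : α → Val) (L : List α)
    (hL : L.length ≤ β.B) (x : Fin n → Bool) :
    Run β 200 (mapP randStrP) (.cons (list ea L) (ofBits x)) ((randStrs n L).map (list ofBits)) :=
  (Run.mapP ea ofBits (fun _ => randStr n) (fun _ _ => run_randStrP hn _ _) hL).mono (by decide)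

theorem listDecode_length {α : Type} (o : List α → Dt Bool) (xs ys : List α) (q : ℕ) :
    (listDecode o xs ys q).All fun M => M.length = xs.length := by
  simp only [listDecode, decode, Dt.All_bind]
  refine Dt.All_of_forall _ fun g => Dt.All_of_forall _ fun v => Dt.All_of_forall _ fun cols => ?_
  simpa [units] using Dt.mapRev_length (estimate o xs ys ((4 * q) ^ 4 * xs.length) g.2 v cols) []
    (units xs.length)

theorem randNum_lt {α : Type} (L : List α) : (randNum L).All fun e => e < 2 ^ L.length := by
  have : ∀ (L : List α) (a : ℕ), (Dt.foldl (fun a _ => .flip fun b => .ret (a * 2 + b.toNat)) a L).All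
      fun e => e < (a + 1) * 2 ^ L.length := by
    intro L
    induction L with
    | nil => simp [Dt.foldl]
    | cons x l ih =>
      intro a b
      refine (ih _).mono fun e he => he.trans_le ?_
      rw [List.length_cons, pow_succ, mul_comm (2 ^ l.length) 2, ← mul_assoc]
      refine Nat.mul_le_mul_right _ ?_
      cases b <;> simp; omega
  simpa [randNum] using this L 0

variable {n : ℕ} (c : List (Fin n → Bool) → Dt Val) (X : List (Fin n → Bool)) (m : ℕ)

/-- Decode the values at the given strings and as many random ones. -/
def strategyOne : Dt (List Bool) :=
  (randStrs n X).bind fun Y =>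
    (listDecode (oracle c X.length 1 []) (Y.reverse ++ X) [] (64 * (m * m))).map fun M =>
      M.drop X.length

/-- Decode the differences along two matchings that form a cycle. -/
def strategyTwo : Dt (List Bool) :=
  let P := Nat.findGreatest Nat.Prime X.length
  let D := (List.replicate (P + P) ()).drop X.length
  (randStrs n D).bind fun F => (randStrs n (X.drop P)).bind fun Z =>
    (randNum (List.replicate (lg P) ())).bind fun e =>
      let W := deint (F.reverse ++ X)
      (listDecode (oracle c X.length e Z) W.2 W.1 m).bind fun A =>
        (listDecode (oracle c X.length e Z) (rot W.2) W.1 m).bind fun B =>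
          Dt.coin.map fun g => (recon g A B).drop D.length

def mainAlg : Dt (List Bool) :=
  Dt.coin.bind fun b => if b then strategyOne c X m else strategyTwo c X m

def strategyOneP (orc : Prog) : Prog :=
  letP (.seq (.pair (get 0) (.seq (get 0) .fst)) (mapP randStrP))
  (letP (.seq (.pair (get 0) (.pair (get 1) .nil)) revApp)
  (letP (.seq (.pair (from' 3) (from' 3)) mulP)
  (letP (.seq (.pair (numP 64) (get 0)) mulP)
  (letP (.seq (.pair (get 2) (.pair .nil (.pair (get 0) (.pair (get 4) (.pair (numP 1) .nil)))))
    (decodeP orc))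
    (.seq (.pair (get 5) (.pair (get 0) .nil)) dropP)))))

def strategyTwoP (orc : Prog) : Prog :=
  letP (.seq (get 0) findPrimeP)
  (letP (.seq (.pair (get 0) (.pair (get 0) .nil)) addP)
  (letP (.seq (.pair (get 2) (.pair (get 0) .nil)) dropP)
  (letP (.seq (.pair (get 2) (.pair (get 3) .nil)) dropP)
  (letP (.seq (.pair (get 1) (.seq (get 4) .fst)) (mapP randStrP))
  (letP (.seq (.pair (get 1) (.seq (get 5) .fst)) (mapP randStrP))
  (letP (.seq (.seq (get 5) logP) randNumP)
  (letP (.seq (.seq (.pair (get 2) (.pair (get 7) .nil)) revApp) deintP)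
  (letP (.seq (.seq (get 0) .snd) rotP)
  (letP (.seq (.pair (.seq (get 1) .snd) (.pair (.seq (get 1) .fst) (.pair (from' 10)
    (.pair (get 9) (.pair (get 2) (get 3)))))) (decodeP orc))
  (letP (.seq (.pair (get 1) (.pair (.seq (get 2) .fst) (.pair (from' 11)
    (.pair (get 10) (.pair (get 3) (get 4)))))) (decodeP orc))
  (letP .coin
  (letP (.seq (.pair (get 2) (.pair (get 0) (get 1))) reconP)
    (.seq (.pair (get 10) (.pair (get 0) .nil)) dropP)))))))))))))

def mainP (orc : Prog) : Prog :=
  .seq (.pair .coin .id) (.ite (.seq .snd (strategyOneP orc)) (.seq .snd (strategyTwoP orc)))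

def progP (m : ℕ) (C' : Prog) : Prog := .seq (.pair .id (numP m)) (mainP (oracleP C'))

variable {c X m} {C' : Prog} {k : ℕ}

theorem run_strategyOneP (hn : n ≤ β.t) (hX : X.length = k) (hk : k ≠ 0) (hm : m ≠ 0)
    (hB : (4 * (64 * (m * m))) ^ 4 * (2 * k) ≤ β.B)
    (hC : ∀ L : List (Fin n → Bool), L.length = k → Run β 0 C' (list ofBits L) (c L)) :
    Run β 20000 (strategyOneP (oracleP C')) (.cons (list ofBits X) (num m))
      ((strategyOne c X m).map bits) := by
  have hB0 := β.hB
  have hq1 : 64 * (m * m) ≤ (4 * (64 * (m * m))) ^ 4 :=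
    le_trans (by omega) (Nat.le_self_pow (by norm_num) _)
  have hq2 : (4 * (64 * (m * m))) ^ 4 ≤ β.B := le_trans (Nat.le_mul_of_pos_right _ (by omega)) hB
  have hm2 : m ≤ m * m := Nat.le_mul_of_pos_left _ (by omega)
  have hk2 : 2 * k ≤ β.B := le_trans (Nat.le_mul_of_pos_left _ (by positivity)) hB
  obtain ⟨x, hx⟩ : ∃ x, (list ofBits X).fst = ofBits x := by
    obtain ⟨x, l, h⟩ := List.exists_cons_of_ne_nil (show X ≠ [] by rintro rfl; exact hk hX.symm)
    exact ⟨x, by rw [h]; rfl⟩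
  simp only [strategyOne, Dt.bind_map, Dt.map_map]
  refine (Run.letP (i := 300) (j := 19000) ((Run.call rfl (by simp [hx]) (run_randStrs hn ofBits X
    (by omega) x)).mono (by decide)) ((randStrs_length n X).mono fun Y hY => ?_)).mono (by omega)
  refine (Run.ret_letP (i := 100) (j := 18000) ((Run.call rfl (by simp)
    (run_revApp ofBits Y X .nil (by omega))).mono (by decide)) ?_).mono (by omega)
  have m1 := run_mulP (β := β) (fun _ : Unit => nil) (fun _ : Unit => nil) (List.replicate m ())
    (List.replicate m ()) (by simp; omega) (by simp; omega)
  have m2 := run_mulP (β := β) (fun _ : Unit => nil) (fun _ : Unit => nil) (List.replicate 64 ())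
    (List.replicate (m * m) ()) (by simp; omega) (by simp; omega)
  simp only [List.length_replicate] at m1 m2
  refine (Run.ret_letP (i := 100) (j := 17000) ((Run.call rfl (by simp) m1).mono (by decide)) ?_).mono (by omega)
  refine (Run.ret_letP (i := 400) (j := 15000) ((Run.call rfl (by simp; rfl) m2).mono (by decide)) ?_).mono (by omega)
  have hlen : (Y.reverse ++ X).length = 2 * k := by simp [hY, hX]; omega
  have d1 := run_decodeP (β := β) (e := ofBits) (xs := Y.reverse ++ X) (ys := [])
    (fun sel hsel => run_oracleP hC X [] sel 1 hX (by omega) (by omega) (by rw [hlen] at hsel; simp; omega))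
    (by omega) (64 * (m * m)) (by rw [hlen]; exact hB) hq2
  rw [← hX] at d1
  refine (Run.letP (i := 13000) (j := 1000) ((Run.call rfl (by simp) d1).mono (by decide))
    (Dt.All_of_forall _ fun M => ?_)).mono (by omega)
  exact (Run.call rfl (by simp) (run_dropP ofBits ofBool X M .nil (by omega))).mono (by decide)

theorem run_strategyTwoP (hn : n ≤ β.t) (hX : X.length = k) (hk : k ≠ 0) (hm : m ≠ 0)
    (hB : (4 * m) ^ 4 * (2 * k) ≤ β.B)
    (hC : ∀ L : List (Fin n → Bool), L.length = k → Run β 0 C' (list ofBits L) (c L)) :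
    Run β 60000 (strategyTwoP (oracleP C')) (.cons (list ofBits X) (num m))
      ((strategyTwo c X m).map bits) := by
  have hB0 := β.hB
  have hq2 : (4 * m) ^ 4 ≤ β.B := le_trans (Nat.le_mul_of_pos_right _ (by omega)) hB
  have hk2 : 2 * k ≤ β.B := le_trans (Nat.le_mul_of_pos_left _ (by positivity)) hB
  obtain ⟨x, hx⟩ : ∃ x, (list ofBits X).fst = ofBits x := by
    obtain ⟨x, l, h⟩ := List.exists_cons_of_ne_nil (show X ≠ [] by rintro rfl; exact hk hX.symm)
    exact ⟨x, by rw [h]; rfl⟩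
  simp only [strategyTwo, Dt.bind_map, Dt.map_map]
  have hPk : Nat.findGreatest Nat.Prime X.length ≤ k := hX ▸ Nat.findGreatest_le _
  have f1 := run_findPrimeP (β := β) ofBits X (by omega)
  generalize Nat.findGreatest Nat.Prime X.length = P at *
  have h2P : 2 ^ lg P ≤ β.B := by
    rcases eq_or_ne P 0 with rfl | h
    · simp [lg]; omega
    · exact (two_pow_lg_le h).trans (by omega)
  refine (Run.ret_letP (i := 1600) (j := 58000) ((Run.call rfl (by simp) f1).mono (by decide)) ?_).mono (by omega)
  have a1 := run_addP (β := β) (fun _ : Unit => nil) (List.replicate P ()) P .nil (by simp; omega)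
  rw [List.length_replicate] at a1
  refine (Run.ret_letP (i := 100) (j := 57000) ((Run.call rfl (by simp) a1).mono (by decide)) ?_).mono (by omega)
  refine (Run.ret_letP (i := 100) (j := 56000) ((Run.call rfl (by simp)
    (run_dropP ofBits (fun _ : Unit => nil) X (List.replicate (P + P) ()) .nil (by omega))).mono (by decide)) ?_).mono (by omega)
  have a2 := run_dropP (β := β) (fun _ : Unit => nil) ofBits (List.replicate P ()) X .nil (by simp; omega)
  rw [List.length_replicate] at a2
  refine (Run.ret_letP (i := 100) (j := 55000) ((Run.call rfl (by simp) a2).mono (by decide)) ?_).mono (by omega)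
  have hD : ((List.replicate (P + P) ()).drop X.length).length = P + P - k := by simp [hX]
  refine (Run.letP (i := 300) (j := 54000) ((Run.call rfl (by simp [hx]; rfl) (run_randStrs hn _
    ((List.replicate (P + P) ()).drop X.length) (by omega) x)).mono (by decide))
    ((randStrs_length n _).mono fun F hF => ?_)).mono (by omega)
  refine (Run.letP (i := 300) (j := 53000) ((Run.call rfl (by simp [hx]) (run_randStrs hn ofBits
    (X.drop P) (by simp; omega) x)).mono (by decide))
    ((randStrs_length n _).mono fun Z hZ => ?_)).mono (by omega)
  have l1 := run_logP (β := β) (fun _ : Unit => nil) (List.replicate P ()) (by simp; omega)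
  rw [List.length_replicate] at l1
  have l2 := run_randNumP (β := β) (fun _ : Unit => nil) (List.replicate (lg P) ()) (by simpa using h2P)
  refine (Run.letP (i := 1000) (j := 51000) ((Run.ret_seq (Run.call rfl (by simp) l1) l2).mono (by decide))
    ((randNum_lt _).mono fun e he => ?_)).mono (by omega)
  rw [List.length_replicate] at he
  rw [hD] at hF
  rw [List.length_drop, hX] at hZ
  have hW : (F.reverse ++ X).length = P + P - k + k := by simp [hF, hX]
  obtain ⟨w1, w2⟩ := deint_length (F.reverse ++ X)
  rw [hW] at w1 w2
  have r1 := run_revApp (β := β) ofBits F X .nil (by omega)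
  have r2 := run_deintP (β := β) ofBits (F.reverse ++ X) (by omega)
  refine (Run.ret_letP (i := 300) (j := 50000) ((Run.ret_seq (Run.call rfl (by simp) r1) r2).mono (by decide)) ?_).mono (by omega)
  generalize deint (F.reverse ++ X) = W at *
  -- For `k = 1` there is no prime and `P = 0`. The list is nonempty even then, since `deint` puts
  -- the extra element of a list of odd length into its second component.
  have hW2 : W.2 ≠ [] := by rw [ne_eq, ← List.length_eq_zero_iff]; omega
  have hrot : (rot W.2).length = W.2.length := by
    obtain ⟨y, l, h⟩ := List.exists_cons_of_ne_nil hW2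
    rw [h]; simp [rot]
  refine (Run.ret_letP (i := 300) (j := 49000) ((Run.call rfl (by simp)
    (run_rotP ofBits W.2 hW2 (by omega))).mono (by decide)) ?_).mono (by omega)
  have hN : ∀ l ≤ 2 * k, (4 * m) ^ 4 * l ≤ β.B := fun l hl => (Nat.mul_le_mul_left _ hl).trans hB
  have d1 := run_decodeP (β := β) (e := ofBits) (xs := W.2) (ys := W.1)
    (fun sel hsel => run_oracleP hC X Z sel e hX (by omega) (by omega) (by omega))
    (by omega) m (hN _ (by omega)) hq2
  have d2 := run_decodeP (β := β) (e := ofBits) (xs := rot W.2) (ys := W.1)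
    (fun sel hsel => run_oracleP hC X Z sel e hX (by omega) (by omega) (by omega))
    (by omega) m (hN _ (by omega)) hq2
  rw [← hX] at d1 d2
  refine (Run.letP (i := 13000) (j := 35000) ((Run.call rfl (by simp) d1).mono (by decide))
    ((listDecode_length _ _ _ _).mono fun A hA => ?_)).mono (by omega)
  refine (Run.letP (i := 13000) (j := 20000) ((Run.call rfl (by simp) d2).mono (by decide))
    (Dt.All_of_forall _ fun B => ?_)).mono (by omega)
  refine (Run.letP (e := ofBool) (m := Dt.coin) (i := 100) (j := 19000) (Run.mono (Run.ev (p := .coin) rfl _) (by decide))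
    (Dt.All_of_forall _ fun g => ?_)).mono (by omega)
  refine (Run.ret_letP (i := 700) (j := 10000) ((Run.call rfl (by simp)
    (run_reconP g A B (by omega))).mono (by decide)) ?_).mono (by omega)
  exact (Run.call rfl (by simp) (run_dropP (fun _ : Unit => nil) ofBool
    ((List.replicate (P + P) ()).drop X.length) (recon g A B) .nil (by omega))).mono (by decide)

theorem run_numP (hm : m ≤ β.B) (v : Val) : Run β 5 (numP m) v (.ret (num m)) := by
  have h1 : (numP m).noLoop = true := by
    clear hm
    induction m with
    | zero => rfl
    | succ m ih => simp [numP, Prog.noLoop, ih]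
  have h2 : (numP m).cost ≤ 4 * m + 1 := by
    clear hm h1
    induction m with
    | zero => simp [numP, Prog.cost]
    | succ m ih => simp [numP, Prog.cost]; omega
  have h3 := Sim.ev h1 v
  rw [ev_numP] at h3
  refine Sim.mono h3 (h2.trans ?_)
  have := β.hB
  calc 4 * m + 1 ≤ β.B * β.B := by nlinarith
    _ = β.B ^ 2 * 1 := by ring
    _ ≤ β.B ^ 2 * β.t := Nat.mul_le_mul_left _ β.ht
    _ ≤ _ := β.mono (by norm_num)

theorem run_progP (hn : n ≤ β.t) (hX : X.length = k) (hk : k ≠ 0) (hm : m ≠ 0)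
    (hB : (4 * (64 * (m * m))) ^ 4 * (2 * k) ≤ β.B)
    (hC : ∀ L : List (Fin n → Bool), L.length = k → Run β 0 C' (list ofBits L) (c L)) :
    Run β 90000 (progP m C') (list ofBits X) ((mainAlg c X m).map bits) := by
  have hm2 : m ≤ 64 * (m * m) := le_trans (Nat.le_mul_of_pos_left _ (Nat.pos_of_ne_zero hm)) (by omega)
  have hB' : (4 * m) ^ 4 * (2 * k) ≤ β.B := by
    refine le_trans ?_ hB
    gcongr
  have hmB : m ≤ β.B := by
    refine le_trans ?_ hB'
    calc m ≤ (4 * m) ^ 4 := le_trans (by omega) (Nat.le_self_pow (by norm_num) _)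
      _ ≤ _ := Nat.le_mul_of_pos_right _ (by omega)
  have h1 := Run.ret_pair_ret (Run.ev (p := .id) rfl (list ofBits X)) (run_numP hmB (list ofBits X))
  refine (Run.ret_seq (j := 85000) h1 ?_).mono (by decide)
  have h2 := Run.pair_ret (β := β) (m := Dt.coin) (e := ofBool) (Run.ev (p := .coin) rfl
    (.cons (list ofBits X) (num m))) (Run.ev (p := .id) rfl _)
  simp only [mainAlg, Dt.bind_map]
  refine (Run.seq (j := 70000) h2 (Dt.All_of_forall _ fun b => ?_)).mono (by decide)
  have key : Run β 61000 (if b then .seq .snd (strategyOneP (oracleP C')) else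
      .seq .snd (strategyTwoP (oracleP C'))) (.cons (ofBool b) (.cons (list ofBits X) (num m)))
      ((if b then strategyOne c X m else strategyTwo c X m).map bits) := by
    cases b
    · exact (Run.ret_seq (Run.ev (p := .snd) rfl _) (run_strategyTwoP hn hX hk hm hB' hC)).mono (by decide)
    · exact (Run.ret_seq (Run.ev (p := .snd) rfl _) (run_strategyOneP hn hX hk hm hB hC)).mono (by decide)
  refine Sim.mono (Sim.ite (T := β.B ^ 61000 * β.t) (fun h => ?_) (fun h => ?_)) ?_
  · cases b
    · simp at h
    · exact key
  · cases b
    · exact key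
    · simp at h
  · have := β.add_le 61000 0
    have := β.mono (show 61000 + 0 + 1 ≤ 70000 by omega)
    omega

end DPXor

namespace DPXor
open Val

/-! ### Programs that write programs -/

/-- A program that returns a constant. -/
def constP : Val → Prog
  | .nil => .nil
  | .cons a b => .pair (constP a) (constP b)

theorem sim_constP (w v : Val) : ∃ T, Sim (constP w) v (.ret w) T := by
  induction w with
  | nil => exact ⟨_, Sim.nil⟩
  | cons a b ha hb =>
    obtain ⟨T, h⟩ := ha
    obtain ⟨T', h'⟩ := hb
    exact ⟨_, h.ret_pair (m := .ret b) (e := fun x => x) h'⟩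

/-- There is a program that computes the code of `F p` from the code of `p`. -/
def Buildable (F : Prog → Prog) : Prop :=
  ∃ b : Prog, ∀ p : Prog, ∃ T, Sim b p.code (.ret (F p).code) T

namespace Buildable

theorem id : Buildable fun p => p := ⟨.id, fun _ => ⟨_, Sim.id⟩⟩

theorem const (q : Prog) : Buildable fun _ => q := ⟨constP q.code, fun _ => sim_constP _ _⟩

variable {F G : Prog → Prog}

theorem aux (hF : Buildable F) (hG : Buildable G) (tag : ℕ) :
    ∃ b : Prog, ∀ p : Prog, ∃ T, Sim b p.code
      (.ret (.cons (.ofNat tag) (.cons (F p).code (G p).code))) T := by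
  obtain ⟨b, hb⟩ := hF
  obtain ⟨b', hb'⟩ := hG
  refine ⟨.pair (constP (.ofNat tag)) (.pair b b'), fun p => ?_⟩
  obtain ⟨T, h⟩ := hb p
  obtain ⟨T', h'⟩ := hb' p
  obtain ⟨T'', h''⟩ := sim_constP (.ofNat tag) p.code
  exact ⟨_, h''.ret_pair (m := .ret _) (e := fun x => x) (h.ret_pair (m := .ret _) (e := fun x => x) h')⟩

theorem pair (hF : Buildable F) (hG : Buildable G) : Buildable fun p => .pair (F p) (G p) :=
  aux hF hG 5

theorem seq (hF : Buildable F) (hG : Buildable G) : Buildable fun p => .seq (F p) (G p) :=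
  aux hF hG 6

theorem ite (hF : Buildable F) (hG : Buildable G) : Buildable fun p => .ite (F p) (G p) :=
  aux hF hG 7

theorem loop (hF : Buildable F) : Buildable fun p => .loop (F p) := by
  obtain ⟨b, hb⟩ := hF
  refine ⟨.pair (constP (.ofNat 8)) b, fun p => ?_⟩
  obtain ⟨T, h⟩ := hb p
  obtain ⟨T', h'⟩ := sim_constP (.ofNat 8) p.code
  exact ⟨_, h'.ret_pair (m := .ret _) (e := fun x => x) h⟩

theorem letP (hF : Buildable F) (hG : Buildable G) : Buildable fun p => letP (F p) (G p) :=
  (hF.pair (const _)).seq hG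

theorem ifP {H : Prog → Prog} (hF : Buildable F) (hG : Buildable G) (hH : Buildable H) :
    Buildable fun p => ifP (F p) (G p) (H p) :=
  (hF.pair (const _)).seq (((const _).seq hG).ite ((const _).seq hH))

theorem foldE (hF : Buildable F) : Buildable fun p => foldE (F p) :=
  ((((const _).pair ((const _).seq (hF.pair (const _)))).loop).seq (const _)).seq (const _)

theorem mapP (hF : Buildable F) : Buildable fun p => mapP (F p) :=
  (const _).seq (foldE (((const _).seq hF).pair (const _)))

theorem sampleP (hF : Buildable F) : Buildable fun p => sampleP (F p) :=
  letP (const _) (letP (const _) (letP (const _) (letP ((const _).seq hF)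
    (letP ((const _).seq hF) (const _)))))

theorem decodeP (hF : Buildable F) : Buildable fun p => decodeP (F p) :=
  letP (const _) (letP (const _) (letP (const _) (letP (const _) (letP (const _)
    ((const _).seq (mapP ((const _).seq ((mapP (sampleP hF)).seq (const _)))))))))

theorem oracleP (hF : Buildable F) : Buildable fun p => oracleP (F p) :=
  letP (const _) (ifP (const _) (const _) (ifP (const _) (const _)
    (((const _).seq hF).seq (const _))))

theorem strategyOneP (hF : Buildable F) : Buildable fun p => strategyOneP (F p) :=
  letP (const _) (letP (const _) (letP (const _) (letP (const _)
    (letP ((const _).seq (decodeP hF)) (const _)))))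

theorem strategyTwoP (hF : Buildable F) : Buildable fun p => strategyTwoP (F p) :=
  letP (const _) (letP (const _) (letP (const _) (letP (const _) (letP (const _) (letP (const _)
    (letP (const _) (letP (const _) (letP (const _) (letP ((const _).seq (decodeP hF))
      (letP ((const _).seq (decodeP hF)) (const _)))))))))))

theorem mainP (hF : Buildable F) : Buildable fun p => mainP (F p) :=
  (const _).seq (((const _).seq (strategyOneP hF)).ite ((const _).seq (strategyTwoP hF)))

end Buildable

/-- From a number `m`, the code of `numP m`. -/
def numCodeP : Prog :=
  .seq (.pair .id (.pair (constP Prog.nil.code) .nil))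
    (foldE (.pair (constP (.ofNat 5)) (.pair (constP Prog.nil.code) (get 1))))

theorem sim_numCodeP (m : ℕ) : ∃ T, Sim numCodeP (num m) (.ret (numP m).code) T := by
  obtain ⟨T1, h1⟩ := sim_constP Prog.nil.code (num m)
  have h2 := Sim.ret_pair (Sim.id (v := num m)) (m := .ret _) (e := fun x => x)
    (Sim.ret_pair h1 (m := .ret _) (e := fun x => x) (Sim.nil (v := num m)))
  have hb : ∃ T, ∀ i, Sim (.pair (constP (.ofNat 5)) (.pair (constP Prog.nil.code) (get 1)))
      (.cons .nil (.cons (numP i).code .nil)) (.ret (numP (i + 1)).code) T := by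
    have key : ∀ w, ∃ T, ∀ v, Sim (constP w) v (.ret w) T := by
      intro w
      induction w with
      | nil => exact ⟨_, fun _ => Sim.nil⟩
      | cons a b ha hb =>
        obtain ⟨T, h⟩ := ha
        obtain ⟨T', h'⟩ := hb
        exact ⟨_, fun v => (h v).ret_pair (m := .ret b) (e := fun x => x) (h' v)⟩
    obtain ⟨T, h⟩ := key (.ofNat 5)
    obtain ⟨T', h'⟩ := key Prog.nil.code
    exact ⟨_, fun i => (h _).ret_pair (m := .ret _) (e := fun x => x)
      ((h' _).ret_pair (m := .ret _) (e := fun x => x) (Sim.ev (p := get 1) rfl _))⟩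
  obtain ⟨T, hb⟩ := hb
  have h3 := Sim.foldE (env := .nil) (fun _ : Unit => Val.nil) (fun i => (numP i).code)
    (fun i _ => .ret (i + 1)) (fun _ _ => True) (fun a l i _ => ⟨hb i, trivial⟩)
    (List.replicate m ()) 0 trivial
  rw [Dt.foldl_ret] at h3
  have h4 : (List.replicate m ()).foldl (fun i _ => i + 1) 0 = m := by
    have : ∀ m i, (List.replicate m ()).foldl (fun i _ => i + 1) i = m + i := by
      intro m
      induction m with
      | zero => simp
      | succ m ih => intro i; rw [List.replicate_succ, List.foldl_cons, ih]; omega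
    exact this m 0
  rw [h4] at h3
  exact ⟨_, Sim.ret_seq h2 h3⟩

/-- Apart from `m`, the text of `progP m p` is fixed around copies of `p`. The builder thus outputs
constants with copies of its input inserted, and needs a loop only for the numeral. It ignores `k`,
which the written program sees as the length of its own input. -/
theorem exists_builder : ∃ A : Prog, ∀ (k m : ℕ) (p : Prog), ∃ T,
    Sim A (.cons (.ofNat k) (.cons (.ofNat m) p.code)) (.ret (progP m p).code) T := by
  obtain ⟨b, hb⟩ := Buildable.mainP (Buildable.oracleP Buildable.id)
  refine ⟨.pair (constP (.ofNat 6)) (.pair (.pair (constP (.ofNat 5)) (.pair (constP Prog.id.code)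
    (.seq (get 1) numCodeP))) (.seq (from' 2) b)), fun k m p => ?_⟩
  rw [ofNat_eq m]
  obtain ⟨T1, h1⟩ := hb p
  obtain ⟨T2, h2⟩ := sim_numCodeP m
  obtain ⟨T3, h3⟩ := sim_constP (.ofNat 6) (.cons (.ofNat k) (.cons (num m) p.code))
  obtain ⟨T4, h4⟩ := sim_constP (.ofNat 5) (.cons (.ofNat k) (.cons (num m) p.code))
  obtain ⟨T5, h5⟩ := sim_constP Prog.id.code (.cons (.ofNat k) (.cons (num m) p.code))
  exact ⟨_, h3.ret_pair (m := .ret _) (e := fun x => x) (Sim.ret_pair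
    (h4.ret_pair (m := .ret _) (e := fun x => x) (h5.ret_pair (m := .ret _) (e := fun x => x)
      (Sim.ret_seq (Sim.ev (p := get 1) rfl _) h2))) (m := .ret _) (e := fun x => x)
    (Sim.ret_seq (Sim.ev (p := from' 2) rfl _) h1))⟩

end DPXor

namespace DPXor
open scoped BigOperators

/-! ### Signs, characters and expectations over products -/

/-- The sign of a bit. -/
def sgn (b : Bool) : ℝ := if b then -1 else 1

@[simp] theorem sgn_false : sgn false = 1 := rfl
@[simp] theorem sgn_true : sgn true = -1 := rfl

theorem sgn_xor (a b : Bool) : sgn (xor a b) = sgn a * sgn b := by cases a <;> cases b <;> simp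

theorem sgn_mul_self (a : Bool) : sgn a * sgn a = 1 := by cases a <;> simp

theorem abs_sgn (a : Bool) : |sgn a| = 1 := by cases a <;> simp

theorem sgn_injective : Function.Injective sgn := by
  intro a b h
  cases a <;> cases b <;> norm_num at h <;> rfl

theorem sgn_and_xor (a b c : Bool) : sgn (a && xor b c) = sgn (a && b) * sgn (a && c) := by
  cases a <;> simp [sgn_xor]

theorem expect_prod {ι κ : Type*} [Fintype ι] [DecidableEq ι] [Fintype κ] (f : ι → κ → ℝ) :
    𝔼 x : ι → κ, ∏ i, f i (x i) = ∏ i, 𝔼 a, f i a := by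
  simp only [Fintype.expect_eq_sum_div_card, Finset.prod_div_distrib, Finset.prod_const,
    Finset.card_univ, Fintype.card_fun, Nat.cast_pow]
  congr 1
  rw [Finset.prod_univ_sum]
  simp

theorem expect_bool (f : Bool → ℝ) : 𝔼 b, f b = (f false + f true) / 2 := by
  rw [Fintype.expect_eq_sum_div_card]; simp [add_comm]

theorem abs_expect_le {ι : Type*} [Fintype ι] (f : ι → ℝ) : |𝔼 i, f i| ≤ 𝔼 i, |f i| :=
  Finset.abs_expect_le _ _

variable {K l : ℕ}

/-- The character of `M` at `r`. -/
noncomputable def chi (M r : Fin K → Bool) : ℝ := ∏ j, sgn (M j && r j)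

/-- The inner product of two vectors over the field with two elements. -/
noncomputable def dot (M r : Fin K → Bool) : Bool := decide (chi M r < 0)

/-- Sum of vectors over the field with two elements. -/
def vxor (a b : Fin K → Bool) : Fin K → Bool := fun j => xor (a j) (b j)

theorem chi_comm (M r : Fin K → Bool) : chi M r = chi r M := by
  simp only [chi, Bool.and_comm]

theorem chi_vxor (M a b : Fin K → Bool) : chi M (vxor a b) = chi M a * chi M b := by
  simp only [chi, vxor, sgn_and_xor, Finset.prod_mul_distrib]

theorem chi_mul_self (M r : Fin K → Bool) : chi M r * chi M r = 1 := by
  simp [chi, ← Finset.prod_mul_distrib, sgn_mul_self]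

theorem abs_chi (M r : Fin K → Bool) : |chi M r| = 1 := by
  simp [chi, Finset.abs_prod, abs_sgn]

theorem sgn_dot (M r : Fin K → Bool) : sgn (dot M r) = chi M r := by
  rcases mul_self_eq_one_iff.1 (chi_mul_self M r) with h | h <;> simp [dot, h, sgn]

theorem expect_chi (M : Fin K → Bool) : 𝔼 r, chi M r = if M = fun _ => false then 1 else 0 := by
  simp only [chi]
  rw [expect_prod fun j b => sgn (M j && b)]
  simp only [expect_bool]
  split_ifs with h
  · simp [h]
  · obtain ⟨j, hj⟩ := Function.ne_iff.1 h
    exact Finset.prod_eq_zero (Finset.mem_univ j) (by simp at hj; simp [hj])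

theorem vxor_eq_zero {a b : Fin K → Bool} : vxor a b = (fun _ => false) ↔ a = b := by
  simp [vxor, funext_iff]

theorem expect_chi_mul (M M' : Fin K → Bool) : 𝔼 r, chi r M * chi r M' = if M = M' then 1 else 0 := by
  simp only [← chi_vxor, ← chi_comm (vxor M M'), expect_chi, vxor_eq_zero]

/-- The correlation of `G` with the character of `M`. -/
noncomputable def coef (G : (Fin K → Bool) → ℝ) (M : Fin K → Bool) : ℝ := 𝔼 r, G r * chi M r

theorem vxor_eq_iff {a b c : Fin K → Bool} : c = vxor a b ↔ vxor a c = b := by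
  simp only [vxor, funext_iff]
  refine forall_congr' fun i => ?_
  generalize a i = x; generalize b i = y; generalize c i = z
  revert x y z; decide

/-- The convolution of `G` with itself in terms of its Fourier coefficients. -/
theorem sum_coef_sq_mul_chi (G : (Fin K → Bool) → ℝ) (a : Fin K → Bool) :
    ∑ M, coef G M ^ 2 * chi M a = 𝔼 r, G r * G (vxor r a) := by
  have h1 : ∀ M, coef G M ^ 2 * chi M a =
      𝔼 r, 𝔼 r', G r * G r' * (chi M (vxor r r') * chi M a) := by
    intro M
    rw [pow_two, coef, Finset.expect_mul_expect, Finset.expect_mul]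
    refine Finset.expect_congr rfl fun r _ => ?_
    rw [Finset.expect_mul]
    refine Finset.expect_congr rfl fun r' _ => ?_
    rw [chi_vxor]; ring
  simp only [h1, ← Finset.expect_sum_comm, ← Finset.mul_sum]
  refine Finset.expect_congr rfl fun r _ => ?_
  have h2 : ∀ r' : Fin K → Bool, ∑ M, chi M (vxor r r') * chi M a =
      if r' = vxor r a then (Fintype.card (Fin K → Bool) : ℝ) else 0 := by
    intro r'
    have := expect_chi_mul (vxor r r') a
    rw [Fintype.expect_eq_sum_div_card, div_eq_iff (by simp)] at this
    rw [this, ite_mul, one_mul, zero_mul]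
    simp only [vxor_eq_iff]
  simp only [h2, Fintype.expect_eq_sum_div_card, mul_ite, mul_zero, Finset.sum_ite_eq',
    Finset.mem_univ, if_true]
  exact mul_div_cancel_right₀ _ (by simp)

/-- Parseval: the convolution formula at the zero vector. -/
theorem sum_coef_sq_le_one {G : (Fin K → Bool) → ℝ} (hG : ∀ r, |G r| ≤ 1) :
    ∑ M, coef G M ^ 2 ≤ 1 := by
  have h := sum_coef_sq_mul_chi G fun _ => false
  have h1 : ∀ M : Fin K → Bool, chi M (fun _ => false) = 1 := fun M => by simp [chi]
  have h2 : ∀ r : Fin K → Bool, vxor r (fun _ => false) = r := fun r => funext fun i => by simp [vxor]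
  simp only [h1, h2, mul_one] at h
  rw [h]
  refine Finset.expect_le Finset.univ_nonempty (fun r _ => ?_)
  have := abs_le.1 (hG r)
  nlinarith

theorem abs_coef_le_one {G : (Fin K → Bool) → ℝ} (hG : ∀ r, |G r| ≤ 1) (M : Fin K → Bool) :
    |coef G M| ≤ 1 := by
  refine (abs_expect_le _).trans (Finset.expect_le Finset.univ_nonempty (fun r _ => ?_))
  rw [abs_mul, abs_chi, mul_one]
  exact hG r

/-- The linear hash value of `M` under the matrix `c`. -/
noncomputable def hash (c : Fin K → Fin l → Bool) (M : Fin K → Bool) : Fin l → Bool :=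
  fun i => dot M fun j => c j i

/-- Adjointness: pairing `M` with a combination `s` of hash functions is the same as pairing `s`
with the hash value of `M`. -/
theorem prod_sgn_dot (c : Fin K → Fin l → Bool) (M : Fin K → Bool) (s : Fin l → Bool) :
    chi M (fun j => dot s (c j)) = chi s (hash c M) := by
  have h : ∀ (b : Bool) {n : ℕ} (x y : Fin n → Bool), sgn (b && dot x y) = ∏ i, sgn (b && (x i && y i)) := by
    intro b n x y
    cases b
    · simp
    · simp [sgn_dot, chi]
  simp only [chi, hash, h]
  rw [Finset.prod_comm]
  refine Finset.prod_congr rfl fun i _ => Finset.prod_congr rfl fun j _ => ?_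
  congr 1
  exact Bool.and_left_comm _ _ _

/-- The indicator of a hash bucket, written as a mean over characters. This is how averaging over
`s` isolates the bucket in `E_sample`. -/
theorem expect_hash_eq (c : Fin K → Fin l → Bool) (M : Fin K → Bool) (v : Fin l → Bool) :
    𝔼 s, chi M (fun j => dot s (c j)) * chi s v = if hash c M = v then 1 else 0 := by
  simp only [prod_sgn_dot, expect_chi_mul]

/-- Two different vectors collide with probability `2 ^ (-l)`. -/
theorem expect_collision {M M' : Fin K → Bool} (h : M ≠ M') :
    𝔼 c : Fin K → Fin l → Bool, (if hash c M = hash c M' then (1 : ℝ) else 0) = 2⁻¹ ^ l := by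
  have h1 : ∀ c : Fin K → Fin l → Bool, (if hash c M = hash c M' then (1 : ℝ) else 0) =
      𝔼 s, chi (vxor M M') (fun j => dot s (c j)) := by
    intro c
    rw [← expect_hash_eq]
    refine Finset.expect_congr rfl fun s _ => ?_
    rw [← prod_sgn_dot, chi_comm M, chi_comm M', chi_comm (vxor M M'), chi_vxor]
  simp only [h1]
  rw [Finset.expect_comm]
  -- For `s ≠ 0`, at a coordinate where `M` and `M'` differ, the row of the matrix is uniform and
  -- the corresponding factor averages to zero. Only `s = 0` survives, with weight `2 ^ (-l)`.
  have h2 : ∀ s : Fin l → Bool, 𝔼 c : Fin K → Fin l → Bool, chi (vxor M M') (fun j => dot s (c j)) =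
      if s = fun _ => false then 1 else 0 := by
    intro s
    simp only [chi]
    rw [expect_prod fun j (x : Fin l → Bool) => sgn (vxor M M' j && dot s x)]
    obtain ⟨j, hj⟩ := Function.ne_iff.1 h
    split_ifs with hs
    · subst hs
      refine Finset.prod_eq_one fun j _ => ?_
      simp [dot, chi, show ¬ (1:ℝ) < 0 by norm_num]
    · refine Finset.prod_eq_zero (Finset.mem_univ j) ?_
      have : vxor M M' j = true := by simpa [vxor] using hj
      simp only [this, Bool.true_and, sgn_dot, expect_chi, hs, if_false]
  simp only [h2, Fintype.expect_eq_sum_div_card, Finset.sum_ite_eq', Finset.mem_univ, if_true]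
  simp

theorem expect_ite_eq {ι : Type*} [Fintype ι] [DecidableEq ι] (v : ι) (g : ι → ℝ) :
    𝔼 w, (if v = w then g w else 0) = g v / Fintype.card ι := by
  rw [Fintype.expect_eq_sum_div_card]; simp

end DPXor

namespace DPXor
open scoped BigOperators
variable {K l : ℕ} {α : Type}

/-! ### Analysis of the list decoder -/

/-- Independent uniform draws are a uniform function. The first draw ends up last in the list, which
is why the function is extended by `Fin.snocEquiv`. -/
theorem E_mapRev_unif {ι κ : Type} [Fintype ι] {m : Dt κ} {φ : ι → κ}
    (hm : ∀ h, m.E h = 𝔼 b, h (φ b)) (L : List α) (hK : L.length = K) (acc : List κ)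
    (g : List κ → ℝ) :
    (Dt.mapRev (fun _ => m) acc L).E g = 𝔼 r : Fin K → ι, g (List.ofFn (fun i => φ (r i)) ++ acc) := by
  induction L generalizing K acc with
  | nil =>
    simp only [List.length_nil] at hK
    subst hK
    simp [Dt.mapRev, Dt.foldl]
  | cons a L ih =>
    simp only [List.length_cons] at hK
    subst hK
    have h1 : Dt.mapRev (fun _ => m) acc (a :: L) =
        m.bind fun b => Dt.mapRev (fun _ => m) (b :: acc) L := by
      simp only [Dt.mapRev, Dt.foldl, Dt.map_bind]
    rw [h1, Dt.E_bind, hm]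
    simp only [ih rfl]
    rw [← Finset.expect_product', Finset.univ_product_univ,
      ← Fintype.expect_equiv (Fin.snocEquiv fun _ : Fin (L.length + 1) => ι) _ _ fun _ => rfl]
    refine Finset.expect_congr rfl fun p _ => ?_
    rw [List.ofFn_succ']
    simp [Fin.snocEquiv]

theorem E_rand (L : List α) (hK : L.length = K) (g : List Bool → ℝ) :
    (rand L).E g = 𝔼 r : Fin K → Bool, g (List.ofFn r) := by
  rw [rand, E_mapRev_unif (φ := fun b => b) (fun h => by rw [expect_bool, Dt.E_coin]) L hK]
  simp

theorem E_mapRev_rand (L : List α) (hK : L.length = K) (l : ℕ) (g : List (List Bool) → ℝ) :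
    (Dt.mapRev (fun _ : α => rand (List.replicate l ())) [] L).E g =
      𝔼 c : Fin K → Fin l → Bool, g (List.ofFn fun j => List.ofFn (c j)) := by
  rw [E_mapRev_unif (ι := Fin l → Bool) (φ := fun x => List.ofFn x)
    (fun h => E_rand _ (by simp) h) L hK]
  simp

theorem shift_eq (s : List Bool) (K : ℕ) (r u : List Bool) (cols : List (List Bool)) :
    shift s K r u cols = List.ofFn fun j : Fin K =>
      xor (xor (r.getD j false) (u.getD j false)) (ip s (cols.getD j [])) := by
  induction K generalizing r u cols with
  | zero => rfl
  | succ K ih =>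
    rw [shift, ih, List.ofFn_succ]
    cases r <;> cases u <;> cases cols <;> simp

theorem ip_cons (a : Bool) (s v : List Bool) :
    ip (a :: s) v = xor (a && v.headD false) (ip s v.tail) := by
  have h : ∀ (s v : List Bool) (b : Bool),
      (s.foldl (fun st a => (st.1.tail, xor st.2 (a && st.1.headD false))) (v, b)).2 =
        xor b (ip s v) := by
    intro s
    induction s with
    | nil => intro v b; simp [ip]
    | cons a s ih =>
      intro v b
      rw [ip, List.foldl_cons, List.foldl_cons, ih, ih]
      simp
  rw [ip, List.foldl_cons, h]
  simp

theorem ip_ofFn (s v : Fin l → Bool) : ip (List.ofFn s) (List.ofFn v) = dot s v := by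
  apply sgn_injective
  rw [sgn_dot, chi]
  induction l with
  | zero => simp [ip]
  | succ l ih =>
    rw [List.ofFn_succ, List.ofFn_succ, ip_cons, sgn_xor, Fin.prod_univ_succ]
    simp [ih]

theorem tally_cons (a : Bool) (L : List Bool) : (tally (a :: L) : ℝ) = sgn a + tally L := by
  have h : ∀ (L : List Bool) (z : ℤ), L.foldl (fun z a => z + if a then -1 else 1) z = z + tally L := by
    intro L
    induction L with
    | nil => simp [tally]
    | cons a L ih =>
      intro z
      rw [tally, List.foldl_cons, List.foldl_cons, ih, ih]
      ring
  rw [tally, List.foldl_cons, h]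
  cases a <;> simp

theorem abs_E_sgn_le (m : Dt Bool) : |m.E sgn| ≤ 1 := by
  rw [abs_le]
  constructor
  · simpa using m.E_mono' (g := fun _ => -1) fun a => (abs_le.1 (abs_sgn a).le).1
  · simpa using m.E_mono' (h := fun _ => 1) fun a => (abs_le.1 (abs_sgn a).le).2

/-- The variance of a sum of independent signs is at most their number. The induction runs over an
arbitrary accumulator, in which the mixed term cancels because `μ` is the mean of each new sign. -/
theorem E_sq_tally_le {ι : Type} (m : Dt Bool) (L : List ι) (acc : List Bool) :
    (Dt.mapRev (fun _ => m) acc L).E (fun l => (tally l - l.length * m.E sgn) ^ 2) ≤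
      L.length + (tally acc - acc.length * m.E sgn) ^ 2 := by
  induction L generalizing acc with
  | nil => simp [Dt.mapRev, Dt.foldl]
  | cons a L ih =>
    have h1 : Dt.mapRev (fun _ => m) acc (a :: L) =
        m.bind fun b => Dt.mapRev (fun _ => m) (b :: acc) L := by
      simp only [Dt.mapRev, Dt.foldl, Dt.map_bind]
    rw [h1, Dt.E_bind]
    refine (m.E_mono' fun b => ih (b :: acc)).trans ?_
    set μ := m.E sgn with hμ
    have h2 : ∀ b : Bool, (L.length : ℝ) + (tally (b :: acc) - ((b :: acc).length : ℕ) * μ) ^ 2 =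
        (L.length + (tally acc - acc.length * μ) ^ 2 - 2 * (tally acc - acc.length * μ) * μ + 1 + μ ^ 2) +
          (2 * (tally acc - acc.length * μ) - 2 * μ) * sgn b := by
      intro b
      rw [tally_cons, List.length_cons]
      push_cast
      have := sgn_mul_self b
      linear_combination this
    simp only [h2]
    rw [Dt.E_add, Dt.E_const, Dt.E_mul_left, ← hμ, List.length_cons]
    push_cast
    nlinarith [sq_nonneg μ]

/-- The majority of many samples is likely to be the more likely value. -/
theorem E_majority_ne {ι : Type} (m : Dt Bool) (L : List ι) (b : Bool) {γ : ℝ} (hγ : 0 < γ)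
    (hL : 0 < L.length) (h : γ ≤ sgn b * m.E sgn) :
    ((Dt.mapRev (fun _ => m) [] L).map fun l => decide (tally l < 0)).E
      (fun b' => if b' = b then 1 else 0) ≥ 1 - 1 / (L.length * γ ^ 2) := by
  set μ := m.E sgn
  have hN : (0 : ℝ) < L.length := by exact_mod_cast hL
  rw [Dt.E_map]
  -- Chebyshev: a wrong majority forces the tally to deviate from its mean by at least `L.length *
  -- γ`.
  have h1 : ((Dt.mapRev (fun _ => m) [] L).All fun l =>
      1 - (tally l - l.length * μ) ^ 2 * (1 / (L.length * γ) ^ 2) ≤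
        if decide (tally l < 0) = b then (1 : ℝ) else 0) := by
    refine (Dt.mapRev_length _ _ _).mono fun l hl => ?_
    simp only [List.length_nil, Nat.zero_add] at hl
    rw [hl]
    split_ifs with hb
    · have : 0 ≤ ((tally l : ℝ) - L.length * μ) ^ 2 * (1 / (L.length * γ) ^ 2) := by positivity
      linarith
    · rw [sub_nonpos, mul_one_div, one_le_div (by positivity)]
      have h2 : sgn b * (tally l : ℝ) ≤ 0 := by
        cases b
        · simp only [decide_eq_false_iff_not, not_lt, not_le] at hb
          have : (tally l : ℝ) ≤ 0 := by exact_mod_cast hb.le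
          simpa using this
        · simp only [decide_eq_true_eq, not_lt] at hb
          have : (0 : ℝ) ≤ tally l := by exact_mod_cast hb
          simpa using this
      have h3 : L.length * γ ≤ L.length * (sgn b * μ) := mul_le_mul_of_nonneg_left h hN.le
      have h4 := sgn_mul_self b
      have h5 : ((tally l : ℝ) - L.length * μ) ^ 2 = (sgn b * ((tally l : ℝ) - L.length * μ)) ^ 2 := by
        rw [mul_pow, pow_two (sgn b), h4, one_mul]
      rw [h5, ← neg_sq (sgn b * _)]
      have : 0 < L.length * γ := by positivity
      exact pow_le_pow_left₀ this.le (by nlinarith) 2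
  refine ge_iff_le.2 (le_trans ?_ (Dt.E_mono h1))
  rw [Dt.E_sub, Dt.E_const, Dt.E_mul_right]
  have h2 := E_sq_tally_le m L []
  simp only [tally, List.foldl_nil, List.length_nil, Int.cast_zero, Nat.cast_zero, zero_mul,
    sub_zero, ne_eq, OfNat.ofNat_ne_zero, not_false_eq_true, zero_pow, add_zero] at h2
  have h3 := mul_le_mul_of_nonneg_right h2 (show 0 ≤ 1 / (L.length * γ) ^ 2 by positivity)
  have h4 : (L.length : ℝ) * (1 / (L.length * γ) ^ 2) = 1 / (L.length * γ ^ 2) := by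
    field_simp
  rw [h4] at h3
  unfold tally at *
  linarith

/-- Independent experiments that succeed with high probability all succeed. -/
theorem E_mapRev_ge {ι κ : Type} [DecidableEq κ] (g : ι → Dt κ) (t : ι → κ) {δ : ℝ}
    (L : List ι) (acc : List κ) (hg : ∀ a ∈ L, 1 - δ ≤ (g a).E fun b => if b = t a then 1 else 0) :
    1 - L.length * δ ≤
      (Dt.mapRev g acc L).E fun l => if l = (L.map t).reverse ++ acc then 1 else 0 := by
  induction L generalizing acc with
  | nil => simp [Dt.mapRev, Dt.foldl]
  | cons a L ih =>
    have h1 : Dt.mapRev g acc (a :: L) = (g a).bind fun b => Dt.mapRev g (b :: acc) L := by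
      simp only [Dt.mapRev, Dt.foldl, Dt.map_bind]
    have h0 := hg a (by simp)
    have hL : ∀ acc, 1 - L.length * δ ≤ _ := fun acc => ih acc fun a ha => hg a (by simp [ha])
    have hδ : 0 ≤ δ := by
      have : ((g a).E fun b => if b = t a then (1:ℝ) else 0) ≤ 1 :=
        Dt.E_le_one _ fun b => by split_ifs <;> norm_num
      linarith
    rw [h1, Dt.E_bind]
    have h2 : ∀ b, (if b = t a then (1:ℝ) else 0) - L.length * δ ≤
        (Dt.mapRev g (b :: acc) L).E fun l => if l = ((a :: L).map t).reverse ++ acc then 1 else 0 := by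
      intro b
      split_ifs with hb
      · subst hb
        simpa using hL (t a :: acc)
      · have : 0 ≤ (Dt.mapRev g (b :: acc) L).E
            fun l => if l = ((a :: L).map t).reverse ++ acc then (1:ℝ) else 0 :=
          Dt.E_nonneg _ fun l => by split_ifs <;> norm_num
        have h3 : 0 ≤ L.length * δ := by positivity
        linarith
    refine le_trans ?_ (Dt.E_mono' _ h2)
    rw [Dt.E_sub, Dt.E_const, List.length_cons]
    push_cast
    linarith

/-- Once a coin shows `true`, the rest is deterministic. The value `2 * i + 2` arises when the first
`true` comes with exactly `i` rounds left, counting its own round; this has probability `2 ^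
(-(L.length - i + 1))`. Other outcomes are dropped. -/
theorem E_geo_ge {ι : Type} {L : List ι} (h : ℕ → ℝ) (hh : ∀ n, 0 ≤ h n) {i : ℕ} (hi : 1 ≤ i)
    (hL : i ≤ L.length) :
    2⁻¹ ^ (L.length - i + 1) * h (2 * i + 2) ≤ (geo L).E fun s => h s.2 := by
  let step : Bool × ℕ → ι → Dt (Bool × ℕ) := fun s _ => if s.1 then .ret (true, s.2 + 2) else
    .flip fun c => .ret (c, if c then s.2 + 2 else s.2)
  have h1 : ∀ (L : List ι) (c : ℕ), Dt.foldl step (true, c) L = .ret (true, c + 2 * L.length) := by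
    intro L
    induction L with
    | nil => simp [Dt.foldl]
    | cons a L ih =>
      intro c
      have : step (true, c) a = .ret (true, c + 2) := rfl
      rw [Dt.foldl, this, Dt.ret_bind, ih, List.length_cons]
      congr 2
      ring
  have h2 : ∀ (L : List ι) (c : ℕ), i ≤ L.length → 2⁻¹ ^ (L.length - i + 1) * h (c + 2 * i) ≤
      (Dt.foldl step (false, c) L).E fun s => h s.2 := by
    intro L
    induction L with
    | nil => intro c hc; simp at hc; omega
    | cons a L ih =>
      intro c hc
      have : step (false, c) a = .flip fun b => .ret (b, if b then c + 2 else c) := rfl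
      rw [Dt.foldl, this, Dt.flip_bind, Dt.E_flip]
      simp only [Dt.ret_bind, if_true, h1, Dt.E_ret, Bool.false_eq_true, if_false]
      have h3 : 0 ≤ (Dt.foldl step (false, c) L).E fun s => h s.2 := Dt.E_nonneg _ fun _ => hh _
      rcases Nat.lt_or_ge L.length i with h4 | h4
      · have h5 : i = L.length + 1 := by simp at hc; omega
        subst h5
        simp only [List.length_cons, Nat.sub_self]
        have : c + 2 + 2 * L.length = c + 2 * (L.length + 1) := by ring
        rw [this]
        linarith
      · have h5 := ih c h4
        have h6 : (a :: L).length - i + 1 = (L.length - i + 1) + 1 := by simp; omega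
        rw [h6, pow_succ]
        have h7 := hh (c + 2 + 2 * L.length)
        linarith
  have := h2 L 2 hL
  rwa [Nat.add_comm 2] at this

end DPXor

/-! ### Fourier analysis of the samples and success probability of the list decoder -/

namespace DPXor
open scoped BigOperators
variable {K l : ℕ} {α : Type}

/-- The mean answer of the oracle to the selection `r`. -/
noncomputable def answer (o : List α → Dt Bool) (xs ys : List α) (r : Fin K → Bool) : ℝ :=
  (o (choose xs ys (List.ofFn r) [])).E sgn

theorem abs_answer_le (o : List α → Dt Bool) (xs ys : List α) (r : Fin K → Bool) :
    |answer o xs ys r| ≤ 1 := abs_E_sgn_le _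

def unitVec (i : Fin K) : Fin K → Bool := fun j => decide (j = i)

theorem chi_unitVec (M : Fin K → Bool) (i : Fin K) : chi M (unitVec i) = sgn (M i) := by
  rw [chi, Finset.prod_eq_single i]
  · simp [unitVec]
  · intro j _ hj
    simp [unitVec, hj]
  · simp

/-- The two oracle calls use independent coins, so the sample has the mean of a product of two
values of `answer`. Averaging over `r` gives the convolution, that is, the squared Fourier
coefficients; averaging over `s` cuts out the bucket of `v`; the unit vector contributes the sign of
the bit `i`. -/
theorem E_sample (o : List α → Dt Bool) {xs : List α} (hK : xs.length = K) (ys : List α)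
    (v : Fin l → Bool) (c : Fin K → Fin l → Bool) (i : Fin K) :
    (sample o xs ys l (List.ofFn v) (List.ofFn fun j => List.ofFn (c j))
      (List.replicate i false ++ [true])).E sgn =
    ∑ M, coef (answer o xs ys) M ^ 2 * sgn (M i) * if hash c M = v then 1 else 0 := by
  rw [sample, Dt.E_bind, E_rand _ hK]
  have h1 : ∀ (r : Fin K → Bool) (s : Fin l → Bool),
      shift (List.ofFn s) xs.length (List.ofFn r) (List.replicate i false ++ [true])
        (List.ofFn fun j => List.ofFn (c j)) =
      List.ofFn (vxor r (vxor (unitVec i) fun j => dot s (c j))) := by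
    intro r s
    rw [shift_eq, hK]
    congr 1
    funext j
    have : (List.replicate i false ++ [true]).getD j false = unitVec i j := by
      rcases lt_trichotomy (j : ℕ) i with h | h | h
      · rw [List.getD_append _ _ _ _ (by simpa using h)]
        simp [unitVec, Fin.ext_iff, h.ne]
      · rw [List.getD_append_right _ _ _ _ (by simp [h])]
        simp [unitVec, Fin.ext_iff, h]
      · rw [List.getD_eq_default _ _ (by simp; omega)]
        simp [unitVec, Fin.ext_iff, h.ne']
    rw [this]
    simp [vxor, ip_ofFn]
  have h2 : ∀ r : Fin K → Bool, ((rand (List.replicate l ())).bind fun s =>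
      (o (choose xs ys (List.ofFn r) [])).bind fun b =>
        (o (choose xs ys (shift s xs.length (List.ofFn r) (List.replicate i false ++ [true])
          (List.ofFn fun j => List.ofFn (c j))) [])).bind fun b' =>
            .ret (xor (xor b b') (ip s (List.ofFn v)))).E sgn =
      𝔼 s, chi s v * (answer o xs ys r *
        answer o xs ys (vxor r (vxor (unitVec i) fun j => dot s (c j)))) := by
    intro r
    rw [Dt.E_bind, E_rand (K := l) _ (by simp)]
    refine Finset.expect_congr rfl fun s _ => ?_
    simp only [Dt.E_bind, h1, Dt.E_ret, sgn_xor, Dt.E_mul_right, Dt.E_mul_left, ip_ofFn, sgn_dot]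
    rw [answer, answer]; ring
  simp only [h2]
  rw [Finset.expect_comm]
  simp only [← Finset.mul_expect, ← sum_coef_sq_mul_chi]
  simp only [← expect_hash_eq, Finset.mul_sum, Finset.mul_expect]
  rw [Finset.expect_sum_comm]
  refine Finset.sum_congr rfl fun M _ => Finset.expect_congr rfl fun s _ => ?_
  rw [chi_vxor, chi_unitVec]
  ring

/-- A unit vector is stored only up to its single `true`, so its length determines its index. The
reversed order of `units` undoes the reversal by `Dt.mapRev`. -/
theorem map_units (M : Fin K → Bool) :
    ((units K).map fun u => (List.ofFn M).getD (u.length - 1) false).reverse = List.ofFn M := by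
  rw [units, List.map_reverse, List.reverse_reverse, List.map_map]
  apply List.ext_getElem
  · simp
  · intro i h1 h2
    simp at h1
    simp [h1]

/-- With the right guess of the hash value of `M`, and little Fourier mass colliding with it,
the decoder succeeds with probability at least one half. -/
theorem E_estimates_ge (o : List α → Dt Bool) {xs : List α} (hK : xs.length = K) (ys : List α)
    (c : Fin K → Fin l → Bool) (M : Fin K → Bool) {N : ℕ} {γ : ℝ} (hγ : 0 < γ)
    (hN : 2 * (K : ℝ) ≤ N * γ ^ 2)
    (hM : γ ≤ coef (answer o xs ys) M ^ 2 - ∑ M' ∈ Finset.univ.erase M,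
      coef (answer o xs ys) M' ^ 2 * if hash c M' = hash c M then 1 else 0) :
    1 / 2 ≤ (Dt.mapRev (estimate o xs ys N l (List.ofFn (hash c M))
      (List.ofFn fun j => List.ofFn (c j))) [] (units xs.length)).E
        fun out => if out = List.ofFn M then 1 else 0 := by
  -- For `K = 0` the hypothesis `hN` does not make the number of samples positive, but there is
  -- nothing to decode.
  rcases Nat.eq_zero_or_pos K with hK0 | hK0
  · subst hK0
    simp [hK, units, Dt.mapRev, Dt.foldl]
    norm_num
  have hN0 : 0 < N := by
    rcases Nat.eq_zero_or_pos N with h | h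
    · subst h
      have : (0 : ℝ) < K := by exact_mod_cast hK0
      simp at hN
      linarith
    · exact h
  have hN1 : (0 : ℝ) < N := by exact_mod_cast hN0
  have h1 : ∀ a ∈ units K, 1 - 1 / (N * γ ^ 2) ≤
      (estimate o xs ys N l (List.ofFn (hash c M)) (List.ofFn fun j => List.ofFn (c j)) a).E
        fun b => if b = (List.ofFn M).getD (a.length - 1) false then 1 else 0 := by
    intro a ha
    simp only [units, List.mem_reverse, List.mem_map, List.mem_range] at ha
    obtain ⟨i, hi, rfl⟩ := ha
    have h2 := E_majority_ne (sample o xs ys l (List.ofFn (hash c M))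
      (List.ofFn fun j => List.ofFn (c j)) (List.replicate i false ++ [true]))
      (List.replicate N ()) (M ⟨i, hi⟩) hγ (by simpa using hN0) ?_
    · simpa [estimate, hi] using h2
    -- The vector `M` votes for its own bit with weight `coef ^ 2`; in the worst case all others in
    -- its bucket vote against it.
    · rw [E_sample o hK ys (hash c M) c ⟨i, hi⟩, ← Finset.add_sum_erase _ _ (Finset.mem_univ M),
        mul_add, Finset.mul_sum]
      refine hM.trans ?_
      rw [sub_eq_add_neg, ← Finset.sum_neg_distrib]
      refine add_le_add (le_of_eq ?_) (Finset.sum_le_sum fun M' _ => ?_)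
      · have := sgn_mul_self (M ⟨i, hi⟩)
        simp only [if_true]
        linear_combination (-coef (answer o xs ys) M ^ 2) * this
      · split_ifs
        · have h3 := abs_sgn (M ⟨i, hi⟩)
          have h4 := abs_sgn (M' ⟨i, hi⟩)
          have h5 : |sgn (M ⟨i, hi⟩) * sgn (M' ⟨i, hi⟩)| = 1 := by rw [abs_mul, h3, h4, one_mul]
          have h6 := (abs_le.1 h5.le).1
          have := sq_nonneg (coef (answer o xs ys) M')
          nlinarith
        · simp
  have h2 := E_mapRev_ge _ _ (units K) [] h1
  rw [map_units, List.append_nil] at h2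
  rw [hK]
  refine le_trans ?_ h2
  have h3 : (units K).length = K := by simp [units]
  rw [h3, mul_one_div]
  have : (K : ℝ) / (N * γ ^ 2) ≤ 1 / 2 := by
    rw [div_le_iff₀ (by positivity)]
    linarith
  linarith

/-- The guess is right with probability `2 ^ (-l)`. Given this, the Fourier mass colliding with `M`
has mean at most `2 ^ (-l)` and may be as large as `2 * 2 ^ (-l)` without harm; a Markov argument
leaves probability `1/4`. -/
theorem E_decode_ge (o : List α → Dt Bool) {xs : List α} (hK : xs.length = K) (ys : List α)
    (M : Fin K → Bool) {N : ℕ} (hN : 2 * (K : ℝ) ≤ N * (2 * 2⁻¹ ^ l) ^ 2)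
    (hM : 4 * 2⁻¹ ^ l ≤ coef (answer o xs ys) M ^ 2) :
    2⁻¹ ^ l / 4 ≤ (decode o xs ys N l).E fun out => if out = List.ofFn M then 1 else 0 := by
  set G : (Fin K → Bool) → ℝ := answer o xs ys with hG
  obtain ⟨δ, hδ⟩ : ∃ δ : ℝ, δ = 2⁻¹ ^ l := ⟨_, rfl⟩
  rw [← hδ] at hN hM ⊢
  have hδ0 : 0 < δ := by rw [hδ]; positivity
  let bad : (Fin K → Fin l → Bool) → ℝ := fun c => ∑ M' ∈ Finset.univ.erase M,
    coef G M' ^ 2 * if hash c M' = hash c M then 1 else 0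
  have hbad : 𝔼 c, bad c ≤ δ := by
    simp only [bad]
    rw [Finset.expect_sum_comm]
    simp only [← Finset.mul_expect]
    calc _ = ∑ M' ∈ Finset.univ.erase M, coef G M' ^ 2 * δ := by
          refine Finset.sum_congr rfl fun M' hM' => ?_
          rw [hδ, expect_collision (Finset.ne_of_mem_erase hM')]
      _ = (∑ M' ∈ Finset.univ.erase M, coef G M' ^ 2) * δ := by rw [Finset.sum_mul]
      _ ≤ 1 * δ := by
          refine mul_le_mul_of_nonneg_right ?_ hδ0.le
          refine le_trans ?_ (sum_coef_sq_le_one (G := G) fun r => abs_answer_le _ _ _ r)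
          exact Finset.sum_le_sum_of_subset_of_nonneg (Finset.erase_subset _ _)
            fun _ _ _ => sq_nonneg _
      _ = δ := one_mul _
  rw [decode, Dt.E_bind, E_rand (K := l) _ (by simp)]
  simp only [Dt.E_bind, E_mapRev_rand xs hK]
  rw [Finset.expect_comm]
  -- Markov's inequality in linear form: the lower bound for a matrix `c` is affine in `bad c`, and
  -- is trivial where `bad c` exceeds `2 * δ`, since it is then negative.
  have h1 : ∀ c : Fin K → Fin l → Bool, δ * ((1 - bad c / (2 * δ)) / 2) ≤ 𝔼 v : Fin l → Bool,
      (Dt.mapRev (estimate o xs ys N l (List.ofFn v) (List.ofFn fun j => List.ofFn (c j))) []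
        (units xs.length)).E fun out => if out = List.ofFn M then 1 else 0 := by
    intro c
    have h2 : (𝔼 v : Fin l → Bool, if hash c M = v then (1 - bad c / (2 * δ)) / 2 else 0) =
        δ * ((1 - bad c / (2 * δ)) / 2) := by
      rw [expect_ite_eq, div_eq_inv_mul]
      simp [hδ]
    rw [← h2]
    refine Finset.expect_le_expect fun v _ => ?_
    have h3 : 0 ≤ (Dt.mapRev (estimate o xs ys N l (List.ofFn v) (List.ofFn fun j => List.ofFn (c j)))
        [] (units xs.length)).E fun out => if out = List.ofFn M then (1:ℝ) else 0 :=
      Dt.E_nonneg _ fun _ => by split_ifs <;> norm_num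
    split_ifs with hv
    · subst hv
      have hb : 0 ≤ bad c := Finset.sum_nonneg fun _ _ => mul_nonneg (sq_nonneg _)
        (by split_ifs <;> norm_num)
      rcases le_or_gt (bad c) (2 * δ) with h | h
      · have h4 : 2 * δ ≤ coef G M ^ 2 - bad c := by linarith
        have h5 := E_estimates_ge (γ := 2 * δ) o hK ys c M (by positivity) hN h4
        have : 0 ≤ bad c / (2 * δ) := div_nonneg hb (by linarith)
        linarith
      · refine le_trans ?_ h3
        have : 1 ≤ bad c / (2 * δ) := (one_le_div (by positivity)).2 h.le
        linarith
    · exact h3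
  refine le_trans ?_ (Finset.expect_le_expect fun c _ => h1 c)
  rw [← Finset.mul_expect, ← Finset.expect_div, Finset.expect_sub_distrib, ← Finset.expect_div,
    Fintype.expect_const]
  have : (𝔼 c, bad c) / (2 * δ) ≤ 1 / 2 := by
    rw [div_le_iff₀ (by positivity)]
    linarith
  nlinarith

/-- List decoding: a vector whose character has a large correlation with the answers of the oracle
is found with noticeable probability. -/
theorem E_listDecode_ge (o : List α → Dt Bool) {xs : List α} (hK : xs.length = K) (ys : List α)
    (M : Fin K → Bool) {q : ℕ} (hq : 1 ≤ q) :
    (|coef (answer o xs ys) M| - 1 / q) / (128 * q) ≤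
      (listDecode o xs ys q).E fun out => if out = List.ofFn M then 1 else 0 := by
  set ĉ := coef (answer o xs ys) M with hĉ
  have hq0 : (0 : ℝ) < q := by exact_mod_cast hq
  have hnn : ∀ n, 0 ≤ (decode o xs ys ((4 * q) ^ 4 * xs.length) n).E
      fun out => if out = List.ofFn M then (1:ℝ) else 0 := fun n =>
    Dt.E_nonneg _ fun _ => by split_ifs <;> norm_num
  rcases le_or_gt |ĉ| (1 / q) with h | h
  · refine le_trans (div_nonpos_of_nonpos_of_nonneg (by linarith) (by positivity)) ?_
    exact Dt.E_nonneg _ fun _ => by split_ifs <;> norm_num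
  have h1 : |ĉ| ≤ 1 := abs_coef_le_one (fun r => abs_answer_le _ _ _ r) M
  have hlg1 : (q : ℝ) < 2 ^ lg q := by exact_mod_cast lt_two_pow_lg q
  have hlg2 : (2 : ℝ) ^ lg q ≤ 2 * q := by exact_mod_cast two_pow_lg_le (show q ≠ 0 by omega)
  have hlg0 : 1 ≤ lg q := by rw [lg_pos (by omega)]; omega
  have hex : ∃ i : ℕ, 1 ≤ i ∧ (2⁻¹ : ℝ) ^ i ≤ |ĉ| := by
    refine ⟨lg q, hlg0, le_trans ?_ h.le⟩
    rw [inv_pow, ← one_div]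
    exact one_div_le_one_div_of_le hq0 hlg1.le
  -- The dyadic scale of the correlation. The hash length `2 * i + 2` fits it: `4 * 2 ^ (-(2 * i +
  -- 2))` is the square of `2 ^ (-i)`, hence at most `ĉ ^ 2`.
  obtain ⟨i, ⟨hi1, hi2⟩, hi4, hi3⟩ : ∃ i : ℕ, (1 ≤ i ∧ (2⁻¹ : ℝ) ^ i ≤ |ĉ|) ∧ i ≤ lg q ∧
      |ĉ| ≤ 2 * 2⁻¹ ^ i := by
    refine ⟨Nat.find hex, Nat.find_spec hex, Nat.find_min' hex ⟨hlg0, ?_⟩, ?_⟩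
    · refine le_trans ?_ h.le
      rw [inv_pow, ← one_div]
      exact one_div_le_one_div_of_le hq0 hlg1.le
    · obtain ⟨j, hj⟩ : ∃ j, Nat.find hex = j + 1 := ⟨Nat.find hex - 1, by
        have := (Nat.find_spec hex).1; omega⟩
      rw [hj, pow_succ]
      rcases Nat.eq_zero_or_pos j with h2 | h2
      · subst h2; simpa using h1
      · have := Nat.find_min hex (m := j) (by omega)
        push Not at this
        have := this h2
        linarith
  have hgeo := E_geo_ge (L := List.replicate (lg q) ()) (fun n => (decode o xs ys ((4 * q) ^ 4 * xs.length) n).E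
      fun out => if out = List.ofFn M then (1:ℝ) else 0) hnn hi1 (by simpa using hi4)
  rw [listDecode, Dt.E_bind]
  refine le_trans ?_ hgeo
  have hp : (2⁻¹ : ℝ) ^ (2 * i + 2) = (2⁻¹ ^ i) ^ 2 / 4 := by
    rw [pow_add, pow_mul']; norm_num; ring
  have hx0 : (0 : ℝ) < 2⁻¹ ^ i := by positivity
  have hx1 : 1 ≤ 2 * q * (2⁻¹ : ℝ) ^ i := by
    have h2 : (2 : ℝ) ^ i ≤ 2 * q := (pow_le_pow_right₀ (by norm_num) hi4).trans hlg2
    have h3 : (2 : ℝ) ^ i * 2⁻¹ ^ i = 1 := by rw [← mul_pow]; norm_num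
    nlinarith
  have hdec := E_decode_ge (l := 2 * i + 2) o hK ys M (N := (4 * q) ^ 4 * xs.length) ?_ ?_
  · refine le_trans ?_ (mul_le_mul_of_nonneg_left hdec (by positivity))
    rw [List.length_replicate, hp]
    have h2 : (2⁻¹ : ℝ) ^ (lg q - i + 1) * 2⁻¹ ^ i = 2⁻¹ ^ lg q / 2 := by
      rw [← pow_add, show lg q - i + 1 + i = lg q + 1 by omega, pow_succ]; ring
    have h3 : 1 / (2 * q) ≤ (2⁻¹ : ℝ) ^ lg q := by
      rw [inv_pow, ← one_div]
      exact one_div_le_one_div_of_le (by positivity) hlg2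
    -- The longer hash succeeds with probability of order `2 ^ (-2 * i)` but is chosen with
    -- probability of order `2 ^ i / q`. The product is of order `2 ^ (-i) / q`, linear in the
    -- correlation.
    have h4 : (2⁻¹ : ℝ) ^ (lg q - i + 1) * ((2⁻¹ ^ i) ^ 2 / 4 / 4) = 2⁻¹ ^ lg q * 2⁻¹ ^ i / 32 := by
      linear_combination (2⁻¹ ^ i / 16) * h2
    rw [h4]
    calc (|ĉ| - 1 / q) / (128 * q) ≤ |ĉ| / (128 * q) := by
          gcongr; linarith [show (0 : ℝ) ≤ 1 / q by positivity]
      _ ≤ 2 * 2⁻¹ ^ i / (128 * q) := by gcongr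
      _ = (1 / (2 * q)) * 2⁻¹ ^ i / 32 := by field_simp; norm_num
      _ ≤ _ := by gcongr
  · rw [hp, hK]
    push_cast
    have h2 : (1 : ℝ) ≤ (2 * q * (2⁻¹ : ℝ) ^ i) ^ 4 := one_le_pow₀ hx1
    have h3 : (0 : ℝ) ≤ K := by positivity
    have h4 : ((4 * (q : ℝ)) ^ 4 * K) * (2 * ((2⁻¹ ^ i) ^ 2 / 4)) ^ 2 =
        4 * K * (2 * q * (2⁻¹ : ℝ) ^ i) ^ 4 := by ring
    rw [h4]
    nlinarith
  · rw [hp, ← sq_abs ĉ]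
    have := pow_le_pow_left₀ hx0.le hi2 2
    linarith

end DPXor

namespace DPXor
open scoped BigOperators
variable {K l : ℕ} {α : Type}

/-! ### Averages over lists -/

theorem expect_append {κ : Type} [Fintype κ] {j k : ℕ} (g : List κ → ℝ) :
    𝔼 w : Fin (j + k) → κ, g (List.ofFn w) =
      𝔼 a : Fin j → κ, 𝔼 b : Fin k → κ, g (List.ofFn a ++ List.ofFn b) := by
  rw [← Finset.expect_product', Finset.univ_product_univ,
    ← Fintype.expect_equiv (Fin.appendEquiv j k) _ _ fun _ => rfl]
  simp [Fin.appendEquiv, List.ofFn_fin_append]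

theorem expect_reverse {κ : Type} [Fintype κ] (g : List κ → ℝ) :
    𝔼 w : Fin K → κ, g (List.ofFn w).reverse = 𝔼 w : Fin K → κ, g (List.ofFn w) := by
  rw [← Fintype.expect_equiv (Equiv.arrowCongr Fin.revPerm (Equiv.refl κ))
    (fun w => g (List.ofFn w).reverse) (fun w => g (List.ofFn w)) fun w => ?_]
  congr 1
  apply List.ext_getElem
  · simp
  · intro i h1 h2
    simp at h1
    simp [Fin.rev, Nat.sub_sub, Nat.add_comm]

/-- The coordinates of a random tuple along an injection are again random. -/
theorem expect_comp_injective {ι ι' κ : Type} [Fintype ι] [Fintype ι'] [DecidableEq ι]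
    [DecidableEq ι'] [Fintype κ] [Nonempty κ] {φ : ι' → ι} (hφ : Function.Injective φ)
    (g : (ι' → κ) → ℝ) : 𝔼 w : ι → κ, g (w ∘ φ) = 𝔼 x : ι' → κ, g x := by
  classical
  let s := Set.range φ
  have h1 := Fintype.expect_equiv (Equiv.piEquivPiSubtypeProd (fun i => i ∈ s) fun _ : ι => κ)
    (fun w => g (w ∘ φ)) (fun p => g fun i => p.1 ⟨φ i, i, rfl⟩) fun w => by rfl
  rw [h1, ← Finset.univ_product_univ, Finset.expect_product]
  simp only [Fintype.expect_const]
  exact Fintype.expect_equiv (Equiv.arrowCongr (Equiv.ofInjective φ hφ).symm (Equiv.refl κ)) _ _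
    fun w => rfl

theorem E_randStr (n : ℕ) (g : (Fin n → Bool) → ℝ) : (randStr n).E g = 𝔼 x, g x := by
  rw [randStr, Dt.E_map, E_rand (K := n) _ (by simp)]
  simp

theorem E_randStrs {n : ℕ} (L : List α) (hK : L.length = K) (g : List (Fin n → Bool) → ℝ) :
    (randStrs n L).E g = 𝔼 y : Fin K → Fin n → Bool, g (List.ofFn y) := by
  rw [randStrs, E_mapRev_unif (φ := fun x => x) (E_randStr n) L hK]
  simp

theorem E_randNum (L : List α) (g : ℕ → ℝ) :
    (randNum L).E g = (∑ e ∈ Finset.range (2 ^ L.length), g e) / 2 ^ L.length := by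
  have h : ∀ (L : List α) (a : ℕ),
      (Dt.foldl (fun a _ => .flip fun b => .ret (a * 2 + b.toNat)) a L).E g =
        (∑ e ∈ Finset.range (2 ^ L.length), g (a * 2 ^ L.length + e)) / 2 ^ L.length := by
    intro L
    induction L with
    | nil => intro a; simp [Dt.foldl]
    | cons b L ih =>
      intro a
      rw [Dt.foldl, Dt.flip_bind, Dt.E_flip]
      simp only [Dt.ret_bind, ih, List.length_cons]
      rw [pow_succ 2 L.length, mul_two (2 ^ L.length), Finset.sum_range_add, pow_succ (2 : ℝ)]
      have h1 : ∀ e, a * (2 ^ L.length + 2 ^ L.length) + e =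
          (a * 2 + false.toNat) * 2 ^ L.length + e := fun e => by simp; ring
      have h2 : ∀ e, a * (2 ^ L.length + 2 ^ L.length) + (2 ^ L.length + e) =
          (a * 2 + true.toNat) * 2 ^ L.length + e := fun e => by simp; ring
      simp only [h2]
      simp only [h1]
      rw [← add_div, div_div]
  have := h L 0
  simp only [Nat.zero_mul, Nat.zero_add] at this
  exact this

/-! ### Cyclic lists -/

section
variable {P : ℕ}

/-- A function on `ZMod P` as a list. -/
def cyc (T : ZMod P → α) : List α := (List.range P).map fun i : ℕ => T i

@[simp] theorem cyc_length (T : ZMod P → α) : (cyc T).length = P := by simp [cyc]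

theorem map_cyc {κ : Type} (g : α → κ) (T : ZMod P → α) : (cyc T).map g = cyc (g ∘ T) := by
  simp [cyc]

/-- The residues as elements of `ZMod P`. -/
noncomputable def finZMod (P : ℕ) [NeZero P] : Fin P ≃ ZMod P where
  toFun i := (i : ℕ)
  invFun a := ⟨a.val, a.val_lt⟩
  left_inv i := Fin.ext (ZMod.val_cast_of_lt i.2)
  right_inv a := ZMod.natCast_zmod_val a

theorem cyc_eq_ofFn [NeZero P] (T : ZMod P → α) : cyc T = List.ofFn fun i => T (finZMod P i) := by
  apply List.ext_getElem
  · simp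
  · intro i h1 h2
    simp [cyc, finZMod]

theorem exists_cyc [NeZero P] (L : List α) (hL : L.length = P) : ∃ T : ZMod P → α, L = cyc T := by
  refine ⟨fun a => L[a.val]'(by rw [hL]; exact a.val_lt), ?_⟩
  apply List.ext_getElem
  · simpa using hL
  · intro i h1 h2
    rw [hL] at h1
    simp [cyc, Nat.mod_eq_of_lt h1]

theorem cyc_prod [NeZero P] (T : ZMod P → ℝ) : (cyc T).prod = ∏ a, T a := by
  rw [cyc_eq_ofFn, List.prod_ofFn]
  exact Fintype.prod_equiv (finZMod P) _ _ fun _ => rfl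

theorem expect_finZMod {κ : Type} [Fintype κ] [NeZero P] (g : (Fin P → κ) → ℝ) :
    𝔼 r, g r = 𝔼 ρ : ZMod P → κ, g fun i => ρ (finZMod P i) :=
  Fintype.expect_equiv (Equiv.arrowCongr (finZMod P) (Equiv.refl κ)) _ _ fun r => by
    congr 1; funext i; simp

theorem rot_cyc [NeZero P] (x : ZMod P → α) : rot (cyc x) = cyc fun a => x (a + 1) := by
  obtain ⟨p, rfl⟩ := Nat.exists_eq_succ_of_ne_zero (NeZero.ne P)
  have h1 : cyc x = x 0 :: (List.range p).map fun i : ℕ => x (i + 1) := by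
    refine (congrArg (List.map fun i : ℕ => x i) (List.range_succ_eq_map (n := p))).trans ?_
    simp
  have h2 : (cyc fun a => x (a + 1)) = ((List.range p).map fun i : ℕ => x (i + 1)) ++ [x 0] := by
    refine (congrArg (List.map fun i : ℕ => x (i + 1)) (List.range_succ (n := p))).trans ?_
    have : ((p : ZMod (p + 1)) + 1) = 0 := by exact_mod_cast ZMod.natCast_self (p + 1)
    simp [this]
  rw [h1, h2]; rfl

theorem advance_drop [NeZero P] (L : List α) (hL : L.length = P) (a n : ℕ) :
    (advance L)^[n] (L.drop (a % P)) = L.drop ((a + n) % P) := by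
  have hP := NeZero.pos P
  induction n with
  | zero => rfl
  | succ n ih =>
    rw [Function.iterate_succ_apply', ih, advance, List.tail_drop]
    have h1 := Nat.mod_lt (a + n) hP
    rw [← add_assoc, Nat.add_mod (a + n) 1]
    rcases Nat.lt_or_ge ((a + n) % P + 1) P with h | h
    · rw [if_neg (by simp [hL]; omega)]
      have : 1 < P := by omega
      rw [Nat.mod_eq_of_lt this, Nat.mod_eq_of_lt h]
    · rw [if_pos (by simp [hL]; omega)]
      have h2 : (a + n) % P + 1 = P := by omega
      rcases Nat.lt_or_ge 1 P with h3 | h3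
      · rw [Nat.mod_eq_of_lt h3, h2]; simp
      · have : P = 1 := by omega
        subst this; simp [Nat.mod_one]

/-- The selection comes reversed from `choose`, and the walk puts what it meets in front, so two
reversals cancel. The element met at time `t` is `S (-1 - t * n)` and lands at position `P - 1 - t`;
this explains the two offsets by one. -/
theorem dilate_cyc [NeZero P] (n : ℕ) (S : ZMod P → α) (Z : List α) :
    dilate n (cyc S).reverse Z = cyc (fun i : ZMod P => S (n * (i + 1) - 1)) ++ Z := by
  have hP := NeZero.pos P
  set L := (cyc S).reverse with hL
  have hlen : L.length = P := by simp [hL]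
  have hget : ∀ t : ℕ, (L.drop (t % P)).head? = some (S (-1 - t)) := by
    intro t
    have ht := Nat.mod_lt t hP
    rw [List.head?_drop, List.getElem?_eq_getElem (by rw [hlen]; exact ht)]
    simp only [hL, List.getElem_reverse, cyc, List.getElem_map, List.getElem_range, List.length_map,
      List.length_range]
    congr 2
    rw [Nat.sub_sub, Nat.cast_sub (by omega)]
    simp
    ring
  have h1 : ∀ (L' : List α) (a : ℕ) (Z : List α), L'.foldl (fun (s : List α × List α) _ =>
      ((advance L)^[n] s.1, s.1.head?.toList ++ s.2)) (L.drop (a % P), Z) =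
      (L.drop ((a + L'.length * n) % P),
        ((List.range L'.length).map fun i : ℕ => S (-1 - (a + i * n : ℕ))).reverse ++ Z) := by
    intro L'
    induction L' with
    | nil => intro a Z; simp
    | cons b L' ih =>
      intro a Z
      rw [List.foldl_cons, advance_drop L hlen, hget, ih, List.length_cons, List.range_succ_eq_map]
      simp only [Prod.mk.injEq]
      refine ⟨by congr 2; ring, ?_⟩
      simp only [Option.toList_some, List.map_cons, List.map_map, List.reverse_cons,
        List.append_assoc, Function.comp_def, Nat.zero_mul, Nat.add_zero]
      congr 2
      refine List.map_congr_left fun i _ => ?_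
      congr 3
      rw [Nat.succ_mul]; ring
  have h2 := h1 L 0 Z
  rw [Nat.zero_mod, List.drop_zero, hlen] at h2
  rw [dilate, h2]
  refine congrArg (· ++ Z) ?_
  apply List.ext_getElem
  · simp
  · intro i h3 h4
    simp only [List.length_reverse, List.length_map, List.length_range] at h3
    simp only [List.getElem_reverse, cyc, List.getElem_map, List.getElem_range, List.length_map,
      List.length_range, Nat.zero_add]
    congr 1
    rw [Nat.cast_mul, Nat.sub_sub, Nat.cast_sub (by omega)]
    simp
    ring

theorem choose_range (x y : ℕ → α) (P : ℕ) (r : List Bool) (acc : List α) :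
    choose ((List.range P).map x) ((List.range P).map y) r acc =
      ((List.range P).map fun j => if r.getD j false then x j else y j).reverse ++ acc := by
  induction P generalizing x y r acc with
  | zero => rfl
  | succ P ih =>
    have := ih (fun j => x (j + 1)) (fun j => y (j + 1)) r.tail (pick (r.headD false) (x 0) [y 0] acc)
    rw [List.range_succ_eq_map]
    simp only [List.map_cons, List.map_map, choose, Function.comp_def, List.tail_cons]
    simp only [Nat.succ_eq_add_one, pick] at this ⊢
    rw [this]
    cases r <;> simp [apply_ite]
    split_ifs <;> rfl

theorem choose_cyc [NeZero P] (x y : ZMod P → α) (ρ : ZMod P → Bool) :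
    choose (cyc x) (cyc y) (List.ofFn fun i => ρ (finZMod P i)) [] =
      (cyc fun a => if ρ a then x a else y a).reverse := by
  rw [← cyc_eq_ofFn, cyc, cyc, choose_range, List.append_nil, cyc]
  congr 1
  refine List.map_congr_left fun i hi => ?_
  simp at hi
  simp [hi]

end

end DPXor

namespace DPXor
open scoped BigOperators

/-! ### Decoding a random list from its subsets of half the size -/

variable {κ : Type} {K k n : ℕ}

/-- The correlation of the answer to a tuple with the parity of the values of `f` on it. -/
noncomputable def advantage (c : List κ → Dt Val) (f : κ → Bool) (L : List κ) : ℝ :=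
  (c L).E (fun w => sgn (!w.isNil)) * (L.map fun a => sgn (f a)).prod

theorem E_oracle_sgn (c : List κ → Dt Val) (k e : ℕ) (Z sel : List κ) :
    (oracle c k e Z sel).E sgn = if (dilate e sel Z).length = k then
      (c (dilate e sel Z)).E (fun w => sgn (!w.isNil)) else 0 := by
  rw [oracle]
  split_ifs
  · rw [Dt.E_map]
  · rw [Dt.E_coin]; simp

theorem choose_filter {ι : Type} (w : ι → κ) (b : ι → Bool) (L : List ι) (acc : List κ) :
    choose (L.map w) [] (L.map b) acc = ((L.filter b).map w).reverse ++ acc := by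
  induction L generalizing acc with
  | nil => rfl
  | cons a L ih =>
    simp only [List.map_cons, choose, List.headD_cons, List.tail_cons, List.tail_nil, ih, pick]
    by_cases h : b a <;> simp [h]

theorem prod_filter_map {ι : Type} (b : ι → Bool) (g : ι → ℝ) (L : List ι) :
    ((L.filter b).map g).prod = (L.map fun a => if b a then g a else 1).prod := by
  induction L with
  | nil => rfl
  | cons a L ih => by_cases h : b a <;> simp [h, ih]

theorem dilate_one (L : List κ) : dilate 1 L [] = L.reverse := by
  by_cases hL : L = []
  · subst hL; rfl
  obtain ⟨p, hp⟩ : ∃ p, L.length = p := ⟨_, rfl⟩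
  have : NeZero p := ⟨by rw [← hp]; simpa using hL⟩
  obtain ⟨T, hT⟩ := exists_cyc (P := p) L.reverse (by simpa using hp)
  rw [hT, ← L.reverse_reverse, hT, dilate_cyc]
  simp

theorem expect_map_nodup {ι : Type} [Fintype ι] [DecidableEq ι] [Fintype κ] [Nonempty κ]
    {J : List ι} (hJ : J.Nodup) (hk : J.length = k) (g : List κ → ℝ) :
    𝔼 w : ι → κ, g (J.map w) = 𝔼 x : Fin k → κ, g (List.ofFn x) := by
  subst hk
  rw [← expect_comp_injective (φ := J.get) (List.nodup_iff_injective_get.1 hJ)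
    fun x => g (List.ofFn x)]
  refine Finset.expect_congr rfl fun w _ => ?_
  congr 1
  apply List.ext_getElem
  · simp
  · intro i h1 h2
    simp

theorem card_weight (K k : ℕ) :
    (Finset.univ.filter fun r : Fin K → Bool => ((List.finRange K).filter r).length = k).card =
      K.choose k := by
  have h1 : ∀ r : Fin K → Bool, ((List.finRange K).filter r).length =
      (Finset.univ.filter fun j => r j = true).card := by
    intro r
    rw [← List.toFinset_card_of_nodup ((List.nodup_finRange K).filter _)]
    congr 1
    ext j
    simp
  have h2 : K.choose k = (Finset.powersetCard k (Finset.univ : Finset (Fin K))).card := by simp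
  rw [h2]
  refine Finset.card_bij' (fun r _ => Finset.univ.filter fun j => r j = true)
    (fun s _ => fun j => decide (j ∈ s)) ?_ ?_ ?_ ?_
  · intro r hr
    rw [Finset.mem_filter, h1] at hr
    simpa using hr.2
  · intro s hs
    rw [Finset.mem_filter, h1]
    simpa using hs
  · intro r _
    funext j
    simp
  · intro s _
    ext j
    simp

variable [Fintype κ] [Nonempty κ] (c : List κ → Dt Val) (f : κ → Bool)

/-- Subsets of size other than `k` are answered by a coin and contribute zero. For each subset of
size `k` the selected strings are a uniform `k`-tuple, and the character of the vector of values at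
`r` is their parity. -/
theorem expect_coef_subsets :
    𝔼 w : Fin K → κ, coef (answer (oracle c k 1 []) (List.ofFn w) []) (fun j => f (w j)) =
      (K.choose k : ℝ) / 2 ^ K * 𝔼 x : Fin k → κ, advantage c f (List.ofFn x) := by
  simp only [coef]
  rw [Finset.expect_comm]
  have h : ∀ r : Fin K → Bool, (𝔼 w : Fin K → κ,
      answer (oracle c k 1 []) (List.ofFn w) [] r * chi (fun j => f (w j)) r) =
      if ((List.finRange K).filter r).length = k
        then 𝔼 x : Fin k → κ, advantage c f (List.ofFn x) else 0 := by
    intro r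
    set J := (List.finRange K).filter r
    have h1 : ∀ w : Fin K → κ, choose (List.ofFn w) [] (List.ofFn r) [] = (J.map w).reverse := by
      intro w
      rw [List.ofFn_eq_map, List.ofFn_eq_map, choose_filter, List.append_nil]
    simp only [answer, h1, E_oracle_sgn, dilate_one, List.reverse_reverse, List.length_map]
    split_ifs with hl
    · rw [← expect_map_nodup ((List.nodup_finRange K).filter r) hl]
      refine Finset.expect_congr rfl fun w _ => ?_
      rw [advantage, List.map_map, chi]
      congr 1
      rw [Function.comp_def, prod_filter_map, Fin.prod_univ_def]
      congr 1
      refine List.map_congr_left fun j _ => ?_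
      by_cases hr : r j <;> simp [hr]
    · simp
  simp only [h]
  rw [Fintype.expect_eq_sum_div_card, ← Finset.sum_filter, Finset.sum_const, card_weight]
  simp
  ring

/-- Because the bound for the decoder is linear in the correlation, only the mean of the coefficient
over the random strings enters; no tail estimate is needed. -/
theorem expect_listDecode_subsets {q : ℕ} (hq : 1 ≤ q) :
    ((K.choose k : ℝ) / 2 ^ K * 𝔼 x : Fin k → κ, advantage c f (List.ofFn x) - 1 / q) / (128 * q) ≤
      𝔼 w : Fin K → κ, (listDecode (oracle c k 1 []) (List.ofFn w) [] q).E
        fun M => if M = (List.ofFn w).map f then 1 else 0 := by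
  rw [← expect_coef_subsets c f]
  calc _ = 𝔼 w : Fin K → κ, (coef (answer (oracle c k 1 []) (List.ofFn w) []) (fun j => f (w j)) -
        1 / (q : ℝ)) / (128 * q) := by
        rw [← Finset.expect_div, Finset.expect_sub_distrib, Fintype.expect_const]
    _ ≤ _ := by
        refine Finset.expect_le_expect fun w _ => ?_
        have := E_listDecode_ge (K := K) (oracle c k 1 []) (xs := List.ofFn w) (by simp) []
          (fun j => f (w j)) hq
        rw [List.map_ofFn]
        refine le_trans ?_ this
        gcongr
        exact le_abs_self _

theorem expect_strategyOne (c : List (Fin n → Bool) → Dt Val) (f : (Fin n → Bool) → Bool)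
    {m : ℕ} (hm : 1 ≤ m) :
    (((k + k).choose k : ℝ) / 2 ^ (k + k) * 𝔼 x : Fin k → Fin n → Bool, advantage c f (List.ofFn x) -
      1 / (64 * (m * m) : ℕ)) / (128 * (64 * (m * m) : ℕ)) ≤
      𝔼 x : Fin k → Fin n → Bool, (strategyOne c (List.ofFn x) m).E
        fun M => if M = (List.ofFn x).map f then 1 else 0 := by
  have hq : 1 ≤ 64 * (m * m) := by nlinarith
  refine (expect_listDecode_subsets (K := k + k) c f hq).trans ?_
  rw [expect_append fun L => (listDecode (oracle c k 1 []) L [] (64 * (m * m))).E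
        fun M => if M = L.map f then (1 : ℝ) else 0]
  have h := expect_reverse (K := k) fun A => 𝔼 b : Fin k → Fin n → Bool,
    (listDecode (oracle c k 1 []) (A ++ List.ofFn b) [] (64 * (m * m))).E
        fun M => if M = (A ++ List.ofFn b).map f then (1 : ℝ) else 0
  rw [← h, Finset.expect_comm]
  refine Finset.expect_le_expect fun x _ => ?_
  rw [strategyOne, Dt.E_bind, E_randStrs (K := k) _ (by simp), List.length_ofFn]
  refine Finset.expect_le_expect fun y _ => ?_
  rw [Dt.E_map]
  refine Dt.E_mono' _ fun M => ?_
  split_ifs with h1 h2 h2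
  · exact le_rfl
  · exact absurd (by rw [h1]; simp) h2
  · norm_num
  · exact le_rfl

/-- The squared form of the bound `4 ^ k / (2 * √k)` for the central binomial coefficient, by
induction from its recursion. -/
theorem sixteen_pow_le {k : ℕ} (hk : k ≠ 0) :
    (16 : ℝ) ^ k ≤ 4 * k * ((k + k).choose k : ℝ) ^ 2 := by
  have h : ∀ j : ℕ, (16 : ℝ) ^ (j + 1) ≤ 4 * (j + 1) * (Nat.centralBinom (j + 1) : ℝ) ^ 2 := by
    intro j
    induction j with
    | zero => norm_num [Nat.centralBinom]
    | succ j ih =>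
      have h1 : ((j : ℝ) + 1 + 1) * Nat.centralBinom (j + 1 + 1) =
          2 * (2 * (j + 1) + 1) * Nat.centralBinom (j + 1) := by
        exact_mod_cast Nat.succ_mul_centralBinom_succ (j + 1)
      have hj : (0 : ℝ) ≤ j := by positivity
      set a : ℝ := (Nat.centralBinom (j + 1) : ℝ)
      set b : ℝ := (Nat.centralBinom (j + 1 + 1) : ℝ)
      push_cast
      have h2 : ((j : ℝ) + 1 + 1) * (4 * (j + 1 + 1) * b ^ 2) = 4 * (2 * (2 * (j + 1) + 1) * a) ^ 2 := by
        rw [← h1]; ring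
      have h3 : ((j : ℝ) + 1 + 1) * 16 ^ (j + 1 + 1) ≤ (j + 1 + 1) * (4 * (j + 1 + 1) * b ^ 2) := by
        rw [h2, pow_succ]
        nlinarith [sq_nonneg a]
      exact le_of_mul_le_mul_left h3 (by positivity)
  obtain ⟨j, rfl⟩ := Nat.exists_eq_succ_of_ne_zero hk
  have := h j
  rw [Nat.centralBinom, two_mul] at this
  exact_mod_cast this

end DPXor

namespace DPXor
open scoped BigOperators

/-! ### Decoding the differences along two matchings -/

variable {κ : Type} {P k n : ℕ}

/-- The list `y_{p-1}, x_{p-1}, …, y_0, x_0`. -/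
def weave (x y : ℕ → κ) : ℕ → List κ
  | 0 => []
  | p + 1 => y p :: x p :: weave x y p

theorem weave_map {κ' : Type} (g : κ → κ') (x y : ℕ → κ) (p : ℕ) :
    (weave x y p).map g = weave (fun i => g (x i)) (fun i => g (y i)) p := by
  induction p with
  | zero => rfl
  | succ p ih => simp [weave, ih]

theorem weave_length (x y : ℕ → κ) (p : ℕ) : (weave x y p).length = p + p := by
  induction p with
  | zero => rfl
  | succ p ih => simp [weave, ih]; omega

theorem mem_weave {x y : ℕ → κ} {p : ℕ} {a : κ} : a ∈ weave x y p ↔ ∃ i < p, a = x i ∨ a = y i := by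
  induction p with
  | zero => simp [weave]
  | succ p ih =>
    simp only [weave, List.mem_cons, ih, Nat.lt_succ_iff_lt_or_eq]
    constructor
    · rintro (h | h | ⟨i, hi, h⟩)
      · exact ⟨p, .inr rfl, .inr h⟩
      · exact ⟨p, .inr rfl, .inl h⟩
      · exact ⟨i, .inl hi, h⟩
    · rintro ⟨i, hi | rfl, h⟩
      · exact .inr (.inr ⟨i, hi, h⟩)
      · rcases h with h | h
        · exact .inr (.inl h)
        · exact .inl h

theorem deint_weave (x y : ℕ → κ) (p : ℕ) :
    deint (weave x y p) = ((List.range p).map y, (List.range p).map x) := by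
  have h : ∀ (p : ℕ) (s : List κ × List κ), (weave x y p).foldl (fun s a => (s.2, a :: s.1)) s =
      ((List.range p).map y ++ s.1, (List.range p).map x ++ s.2) := by
    intro p
    induction p with
    | zero => intro s; rfl
    | succ p ih => intro s; simp [weave, ih, List.range_succ]
  rw [deint, h]; simp

/-- The edges of the two matchings alternate along the path `x 0, y 0, x 1, y 1, …`. Starting from
the value at `x 0`, each difference yields the next value. -/
theorem recon_weave (x y : ℕ → Bool) (p : ℕ) :
    recon (x 0) ((List.range p).map fun j => xor (x j) (y j))
      ((List.range p).map fun j => xor (x (j + 1)) (y j)) = weave x y p := by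
  set B := (List.range p).map fun j => xor (x (j + 1)) (y j) with hB
  have h : ∀ q ≤ p, ((List.range q).map fun j => xor (x j) (y j)).foldl
      (fun (s : Bool × List Bool × List Bool) a =>
        (xor (xor s.1 a) (s.2.1.headD false), s.2.1.tail, xor s.1 a :: s.1 :: s.2.2)) (x 0, B, []) =
      (x q, B.drop q, weave x y q) := by
    intro q
    induction q with
    | zero => intro _; rfl
    | succ q ih =>
      intro hq
      rw [List.range_succ, List.map_append, List.foldl_append, ih (by omega)]
      have h1 : (B.drop q).headD false = xor (x (q + 1)) (y q) := by
        rw [List.headD_eq_head?_getD, List.head?_drop]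
        simp [hB, List.getElem?_range (show q < p by omega)]
      simp only [List.map_cons, List.map_nil, List.foldl_cons, List.foldl_nil, h1, List.tail_drop, weave]
      cases x q <;> cases y q <;> simp
  rw [recon, h p le_rfl]

/-- A random list of length `2 p` is woven from two random functions. -/
theorem expect_weave [Fintype κ] [Nonempty κ] [NeZero P] (g : List κ → ℝ) :
    𝔼 w : Fin (P + P) → κ, g (List.ofFn w) = 𝔼 x : ZMod P → κ, 𝔼 y : ZMod P → κ,
      g (weave (fun i => x i) (fun i => y i) P) := by
  -- The weave of the coordinates themselves lists `ZMod P ⊕ ZMod P` without repetition, so the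
  -- strings along it are independent and uniform.
  let u : ℕ → ZMod P ⊕ ZMod P := fun i => .inl i
  let v : ℕ → ZMod P ⊕ ZMod P := fun i => .inr i
  have hinj : ∀ {i j : ℕ}, i < P → j < P → (i : ZMod P) = j → i = j := fun hi hj h => by
    have := congrArg ZMod.val h
    rwa [ZMod.val_cast_of_lt hi, ZMod.val_cast_of_lt hj] at this
  have hnd : ∀ p ≤ P, (weave u v p).Nodup := by
    intro p
    induction p with
    | zero => intro _; exact List.nodup_nil
    | succ p ih =>
      intro hp
      rw [weave, List.nodup_cons, List.nodup_cons, List.mem_cons, mem_weave, mem_weave]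
      refine ⟨?_, ?_, ih (by omega)⟩
      · rintro (h | ⟨i, hi, h | h⟩)
        · simp [u, v] at h
        · simp [u, v] at h
        · have := hinj (by omega) (by omega) (Sum.inr_injective h)
          omega
      · rintro ⟨i, hi, h | h⟩
        · have := hinj (by omega) (by omega) (Sum.inl_injective h)
          omega
        · simp [u, v] at h
  rw [← expect_map_nodup (hnd P le_rfl) (weave_length u v P) g,
    Fintype.expect_equiv (Equiv.sumArrowEquivProdArrow (ZMod P) (ZMod P) κ) _
      (fun p => g (weave (fun i => p.1 i) (fun i => p.2 i) P)) fun w => by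
        rw [weave_map]; rfl, ← Finset.univ_product_univ, Finset.expect_product]

/-- For a fixed choice `ρ` the selected coordinates are distinct, so the selection from independent
uniform pairs is itself uniform. -/
theorem expect_ite_pair [Fintype κ] [Nonempty κ] [NeZero P] (ρ : ZMod P → Bool)
    (g : (ZMod P → κ) → ℝ) :
    𝔼 X : ZMod P → κ, 𝔼 Y : ZMod P → κ, g (fun i => if ρ i then X i else Y i) = 𝔼 T, g T := by
  let φ : ZMod P → ZMod P ⊕ ZMod P := fun i => if ρ i then .inl i else .inr i
  have hφ : Function.Injective φ := by
    intro i j h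
    simp only [φ] at h
    split_ifs at h <;> simpa using h
  rw [← expect_comp_injective hφ g, Fintype.expect_equiv
      (Equiv.sumArrowEquivProdArrow (ZMod P) (ZMod P) κ) (fun w => g (w ∘ φ))
      (fun p => g fun i => if ρ i then p.1 i else p.2 i) fun w => by
        congr 1; funext i; simp only [φ, Function.comp]; split_ifs <;> rfl,
      ← Finset.univ_product_univ, Finset.expect_product]

/-- The map along which a query with dilation factor `n` is read. -/
def readMap [Fact P.Prime] (n : ZMod P) (hn : n ≠ 0) : Equiv.Perm (ZMod P) :=
  ((Equiv.addRight 1).trans (Equiv.mulLeft₀ n hn)).trans (Equiv.subRight 1)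

theorem readMap_apply [Fact P.Prime] (n : ZMod P) (hn : n ≠ 0) (i : ZMod P) :
    readMap n hn i = n * (i + 1) - 1 := rfl

/-- A step by one along the cycle is a step by `n⁻¹` in the positions of the query. This turns the
fixed second matching into a random shift. -/
theorem readMap_add_one [Fact P.Prime] (n : ZMod P) (hn : n ≠ 0) (i : ZMod P) :
    readMap n hn i + 1 = readMap n hn (i + n⁻¹) := by
  simp only [readMap_apply]
  field_simp
  ring

theorem prod_sgn_sq (f : κ → Bool) (z : List κ) :
    (z.map fun a => sgn (f a)).prod * (z.map fun a => sgn (f a)).prod = 1 := by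
  induction z with
  | nil => simp
  | cons a z ih =>
    rw [List.map_cons, List.prod_cons]
    have := sgn_mul_self (f a)
    linear_combination sgn (f a) * sgn (f a) * ih + this

variable (c : List κ → Dt Val) (f : κ → Bool)

/-- The mean correlation for the tuples that choose between the `i`-th element of `Y` and the element
of `X` at distance `d`. -/
noncomputable def corr [NeZero P] (z : List κ) (d : ZMod P) (X Y : ZMod P → κ) : ℝ :=
  𝔼 ρ : ZMod P → Bool, advantage c f (cyc (fun i => if ρ i then X (i + d) else Y i) ++ z)

theorem advantage_append_cyc [NeZero P] (T : ZMod P → κ) (z : List κ) :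
    advantage c f (cyc T ++ z) = (c (cyc T ++ z)).E (fun w => sgn (!w.isNil)) *
      ((∏ i, sgn (f (T i))) * (z.map fun a => sgn (f a)).prod) := by
  rw [advantage, List.map_append, List.prod_append, map_cyc, cyc_prod]
  rfl

/-- The sign of `f (x a)` is the sign of the difference times that of `f (y a)`. So the character of
the differences equals the parity of the query up to the signs of all `y a` and of `z`, which do not
depend on `ρ`; the absolute value removes them. Reading along `readMap` permutes the selected
strings without changing their parity. -/
theorem abs_coef_cyc [Fact P.Prime] {e : ℕ} (he : (e : ZMod P) ≠ 0) (z : List κ)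
    (hz : P + z.length = k) (x y : ZMod P → κ) :
    |coef (answer (oracle c k e z) (cyc x) (cyc y))
      (fun j : Fin P => xor (f (x (finZMod P j))) (f (y (finZMod P j))))| =
    |𝔼 ρ : ZMod P → Bool, advantage c f (cyc (fun i => if ρ i then x (readMap e he i)
      else y (readMap e he i)) ++ z)| := by
  set μ := readMap (e : ZMod P) he with hμ
  set C : ℝ := (∏ a, sgn (f (y a))) * (z.map fun a => sgn (f a)).prod with hC
  have hC1 : |C| = 1 := by
    rw [hC, abs_mul, Finset.abs_prod]
    have := prod_sgn_sq f z
    have h2 : |(z.map fun a => sgn (f a)).prod| = 1 := by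
      rcases mul_self_eq_one_iff.1 this with h | h <;> simp [h]
    simp [abs_sgn, h2]
  have h1 : ∀ ρ : ZMod P → Bool, answer (oracle c k e z) (cyc x) (cyc y) (fun i => ρ (finZMod P i)) *
      chi (fun j : Fin P => xor (f (x (finZMod P j))) (f (y (finZMod P j)))) (fun i => ρ (finZMod P i)) =
      C * advantage c f (cyc (fun i => if ρ (μ i) then x (μ i) else y (μ i)) ++ z) := by
    intro ρ
    rw [answer, choose_cyc, E_oracle_sgn, dilate_cyc, advantage_append_cyc, if_pos (by simp [hz])]
    have h2 : ∏ i, sgn (f (if ρ (μ i) then x (μ i) else y (μ i))) =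
        ∏ a, sgn (f (if ρ a then x a else y a)) :=
      Fintype.prod_equiv μ _ _ fun _ => rfl
    have h3 : chi (fun j : Fin P => xor (f (x (finZMod P j))) (f (y (finZMod P j))))
        (fun i => ρ (finZMod P i)) =
        (∏ a, sgn (f (if ρ a then x a else y a))) * ∏ a, sgn (f (y a)) := by
      rw [chi, ← Finset.prod_mul_distrib]
      refine Fintype.prod_equiv (finZMod P) _ _ fun j => ?_
      by_cases h : ρ (finZMod P j)
      · simp [h, sgn_xor]
      · simp [h, sgn_mul_self]
    rw [h2, h3, hC]
    simp only [hμ, readMap_apply]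
    have h4 := prod_sgn_sq f z
    set A := (c (cyc (fun i : ZMod P => if ρ (↑e * (i + 1) - 1) = true then x (↑e * (i + 1) - 1)
      else y (↑e * (i + 1) - 1)) ++ z)).E fun w => sgn !w.isNil
    set p := ∏ a, sgn (f (if ρ a then x a else y a))
    set q := ∏ a, sgn (f (y a))
    linear_combination (-A * p * q) * h4
  rw [coef, expect_finZMod]
  simp only [h1]
  rw [← Finset.mul_expect, abs_mul, hC1, one_mul]
  congr 1
  exact Fintype.expect_equiv (Equiv.arrowCongr μ.symm (Equiv.refl Bool)) _ _ fun ρ => rfl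

/-- Translating `X` shifts the index `d`. Since `X` is uniform, this makes the correlations a
stationary family. -/
theorem corr_shift [NeZero P] (z : List κ) (d t : ZMod P) (X Y : ZMod P → κ) :
    corr c f z d (fun i => X (i + t)) Y = corr c f z (d + t) X Y := by
  simp only [corr, add_assoc]

end DPXor

/-! ### Joint success of the two decodings and the second-moment bound -/

namespace DPXor
open scoped BigOperators

variable {κ : Type} {P k n : ℕ} (c : List κ → Dt Val) (f : κ → Bool)

/-- A lower bound for the probability of decoding with correlation `t`. -/
noncomputable def gain (q : ℕ) (t : ℝ) : ℝ := max 0 ((t - 1 / q) / (128 * q))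

theorem gain_nonneg (q : ℕ) (t : ℝ) : 0 ≤ gain q t := le_max_left _ _

theorem gain_le_one {q : ℕ} (hq : 1 ≤ q) {t : ℝ} (ht : t ≤ 1) : gain q t ≤ 1 := by
  have hq' : (1 : ℝ) ≤ q := by exact_mod_cast hq
  refine max_le (by norm_num) ?_
  rw [div_le_one (by positivity)]
  have : (0 : ℝ) ≤ 1 / q := by positivity
  linarith

theorem gain_mono (q : ℕ) {s t : ℝ} (h : s ≤ t) : gain q s ≤ gain q t := by
  unfold gain; gcongr

theorem advantage_le_one (L : List κ) : advantage c f L ≤ 1 := by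
  have h1 : |(c L).E fun w => sgn (!w.isNil)| ≤ 1 := by
    have := abs_E_sgn_le ((c L).map fun w => !w.isNil)
    rwa [Dt.E_map] at this
  have h2 : |(L.map fun a => sgn (f a)).prod| = 1 := by
    rcases mul_self_eq_one_iff.1 (prod_sgn_sq f L) with h | h <;> simp [h]
  refine (le_abs_self _).trans ?_
  rw [advantage, abs_mul, h2, mul_one]
  exact h1

theorem corr_le_one [NeZero P] (z : List κ) (d : ZMod P) (X Y : ZMod P → κ) :
    corr c f z d X Y ≤ 1 :=
  Finset.expect_le Finset.univ_nonempty fun _ _ => advantage_le_one c f _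

theorem gain_le_listDecode [Fact P.Prime] {e : ℕ} (he : (e : ZMod P) ≠ 0) (z : List κ)
    (hz : P + z.length = k) (x y : ZMod P → κ) {q : ℕ} (hq : 1 ≤ q) :
    gain q (𝔼 ρ : ZMod P → Bool, advantage c f (cyc (fun i => if ρ i then x (readMap e he i)
      else y (readMap e he i)) ++ z)) ≤
    (listDecode (oracle c k e z) (cyc x) (cyc y) q).E fun M =>
      if M = (List.range P).map (fun j : ℕ => xor (f (x j)) (f (y j))) then 1 else 0 := by
  have h1 := E_listDecode_ge (K := P) (oracle c k e z) (xs := cyc x) (by simp) (cyc y)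
    (fun j => xor (f (x (finZMod P j))) (f (y (finZMod P j)))) hq
  rw [← cyc_eq_ofFn fun a => xor (f (x a)) (f (y a)), abs_coef_cyc c f he z hz] at h1
  refine (gain_mono q (le_abs_self _)).trans (max_le (Dt.E_nonneg _ fun _ => ?_) h1)
  split_ifs <;> norm_num

/-- The probability that all values of `f` on the list `W` are decoded. -/
noncomputable def decodeProb (m k e : ℕ) (z W : List κ) : ℝ :=
  (listDecode (oracle c k e z) (deint W).2 (deint W).1 m).E fun A =>
    (listDecode (oracle c k e z) (rot (deint W).2) (deint W).1 m).E fun B =>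
      Dt.coin.E fun g => if recon g A B = W.map f then 1 else 0

theorem decodeProb_nonneg (m k e : ℕ) (z W : List κ) : 0 ≤ decodeProb c f m k e z W :=
  Dt.E_nonneg _ fun _ => Dt.E_nonneg _ fun _ => Dt.E_nonneg _ fun _ => by split_ifs <;> norm_num

/-- For fixed strings and fixed `e` the two decoders use independent coins, so their success
probabilities multiply; the factor `1/2` is the guess of the value at `x 0`. -/
theorem decodeProb_ge [Fact P.Prime] {e : ℕ} (he : (e : ZMod P) ≠ 0) (z : List κ)
    (hz : P + z.length = k) (x y : ZMod P → κ) {m : ℕ} (hm : 1 ≤ m) :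
    gain m (corr c f z 0 (x ∘ readMap e he) (y ∘ readMap e he)) *
      gain m (corr c f z (e : ZMod P)⁻¹ (x ∘ readMap e he) (y ∘ readMap e he)) / 2 ≤
      decodeProb c f m k e z (weave (fun i => x i) (fun i => y i) P) := by
  have h0 := gain_le_listDecode c f he z hz x y hm
  have h1 := gain_le_listDecode c f he z hz (fun a => x (a + 1)) y hm
  have e0 : corr c f z 0 (x ∘ readMap e he) (y ∘ readMap e he) =
      𝔼 ρ : ZMod P → Bool, advantage c f (cyc (fun i => if ρ i then x (readMap e he i)
      else y (readMap e he i)) ++ z) := by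
    simp only [corr, add_zero, Function.comp]
  have e1 : corr c f z (e : ZMod P)⁻¹ (x ∘ readMap e he) (y ∘ readMap e he) =
      𝔼 ρ : ZMod P → Bool, advantage c f (cyc (fun i => if ρ i then x (readMap e he i + 1)
      else y (readMap e he i)) ++ z) := by
    simp only [corr, Function.comp, readMap_add_one]
  rw [← e0] at h0
  rw [← e1] at h1
  have hd : deint (weave (fun i : ℕ => x i) (fun i : ℕ => y i) P) = (cyc y, cyc x) :=
    deint_weave _ _ _
  rw [decodeProb, hd]
  simp only
  rw [rot_cyc]
  set A' := (List.range P).map fun j : ℕ => xor (f (x j)) (f (y j))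
  set B' := (List.range P).map fun j : ℕ => xor (f (x (j + 1))) (f (y j)) with hB'
  have h2 : ∀ A B : List Bool, (if A = A' then (1 : ℝ) else 0) * (if B = B' then 1 else 0) * (1 / 2) ≤
      Dt.coin.E fun g => if recon g A B =
        (weave (fun i : ℕ => x i) (fun i : ℕ => y i) P).map f then 1 else 0 := by
    intro A B
    have h3 : 0 ≤ Dt.coin.E fun g => if recon g A B =
        (weave (fun i : ℕ => x i) (fun i : ℕ => y i) P).map f then (1 : ℝ) else 0 :=
      Dt.E_nonneg _ fun _ => by split_ifs <;> norm_num
    split_ifs with hA hB hB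
    · have h4 := recon_weave (fun i : ℕ => f (x i)) (fun i => f (y i)) P
      simp only [Nat.cast_add, Nat.cast_one] at h4
      rw [Dt.E_coin, hA, hB, weave_map, ← h4, Nat.cast_zero]
      cases f (x 0)
      · rw [if_pos rfl]
        have : (0 : ℝ) ≤ if recon true A' B' = recon false A' B' then 1 else 0 := by
          split_ifs <;> norm_num
        linarith
      · rw [if_pos rfl]
        have : (0 : ℝ) ≤ if recon false A' B' = recon true A' B' then 1 else 0 := by
          split_ifs <;> norm_num
        linarith
    all_goals simpa using h3
  refine le_trans ?_ (Dt.E_mono' _ fun A => Dt.E_mono' _ fun B => h2 A B)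
  simp only [Dt.E_mul_left, Dt.E_mul_right]
  rw [← div_eq_mul_one_div]
  gcongr
  · exact gain_nonneg _ _
  · exact (gain_nonneg _ _).trans h0

/-- Second-moment bound for a stationary family indexed by the residues. -/
theorem sum_pair_ge {Ω : Type} [Fintype Ω] [Nonempty Ω] [NeZero P] (F : ZMod P → Ω → ℝ)
    (H : ZMod P → ℝ) (hH : ∀ a b, 𝔼 ω, F a ω * F b ω = H (b - a)) {τ : ℝ} (hτ : ∀ a, 𝔼 ω, F a ω = τ)
    (h0 : ∀ a ω, 0 ≤ F a ω) (h1 : ∀ a ω, F a ω ≤ 1) :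
    P * τ ^ 2 - τ ≤ ∑ d ∈ Finset.univ.erase 0, H d := by
  have hP : (0 : ℝ) < P := by exact_mod_cast NeZero.pos P
  have hS : 𝔼 ω, ∑ a, F a ω = P * τ := by
    rw [Finset.expect_sum_comm]
    simp [hτ]
  have hS2 : 𝔼 ω, (∑ a, F a ω) ^ 2 = P * ∑ d, H d := by
    simp only [pow_two, Finset.sum_mul_sum]
    rw [Finset.expect_sum_comm]
    simp only [Finset.expect_sum_comm, hH]
    have : ∀ a : ZMod P, ∑ b, H (b - a) = ∑ d, H d := fun a =>
      Fintype.sum_equiv (Equiv.subRight a) _ _ fun _ => rfl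
    simp [this]
  have hvar : 0 ≤ 𝔼 ω, (∑ a, F a ω - P * τ) ^ 2 := Finset.expect_nonneg fun _ _ => sq_nonneg _
  have hexp : 𝔼 ω, (∑ a, F a ω - P * τ) ^ 2 = P * ∑ d, H d - (P * τ) ^ 2 := by
    have : ∀ ω, (∑ a, F a ω - P * τ) ^ 2 = (∑ a, F a ω) ^ 2 - 2 * (P * τ) * ∑ a, F a ω + (P * τ) ^ 2 :=
      fun ω => by ring
    simp only [this]
    rw [Finset.expect_add_distrib, Finset.expect_sub_distrib, ← Finset.mul_expect, hS, hS2,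
      Fintype.expect_const]
    ring
  -- The diagonal term is a second moment of a variable with values in `[0, 1]`, hence at most its
  -- mean.
  have hH0 : H 0 ≤ τ := by
    have := hH 0 0
    rw [sub_zero] at this
    rw [← this, ← hτ 0]
    refine Finset.expect_le_expect fun ω _ => ?_
    nlinarith [h0 0 ω, h1 0 ω]
  rw [hexp, ← Finset.add_sum_erase _ _ (Finset.mem_univ (0 : ZMod P))] at hvar
  have : P * (P * τ ^ 2) ≤ P * (H 0 + ∑ d ∈ Finset.univ.erase 0, H d) := by nlinarith
  have := le_of_mul_le_mul_left this hP
  linarith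

end DPXor

/-! ### Mean gain over pairs of shifts -/

namespace DPXor
open scoped BigOperators

section
variable {κ : Type} [Fintype κ] {P k : ℕ} (c : List κ → Dt Val) (f : κ → Bool)

theorem expect_fin_congr {a b : ℕ} (h : a = b) (g : List κ → ℝ) :
    𝔼 w : Fin a → κ, g (List.ofFn w) = 𝔼 w : Fin b → κ, g (List.ofFn w) := by
  subst h; rfl

variable [Nonempty κ]

/-- For each `ρ` the selected strings together with `z` form a uniform `k`-tuple; no selection is
wasted. -/
theorem expect_corr_zero [NeZero P] (hPk : P ≤ k) :
    (𝔼 z : Fin (k - P) → κ, 𝔼 X : ZMod P → κ, 𝔼 Y : ZMod P → κ, corr c f (List.ofFn z) 0 X Y) =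
      𝔼 x : Fin k → κ, advantage c f (List.ofFn x) := by
  have h0 : (𝔼 x : Fin k → κ, advantage c f (List.ofFn x)) = 𝔼 z : Fin (k - P) → κ,
      𝔼 T : ZMod P → κ, advantage c f (cyc T ++ List.ofFn z) := by
    rw [← expect_fin_congr (show P + (k - P) = k by omega) fun L => advantage c f L, expect_append,
      Finset.expect_comm]
    refine Finset.expect_congr rfl fun z _ => ?_
    rw [expect_finZMod]
    simp only [← cyc_eq_ofFn]
  rw [h0]
  refine Finset.expect_congr rfl fun z _ => ?_
  simp only [corr, add_zero]
  refine ((Finset.expect_congr rfl fun X _ => Finset.expect_comm _ _ _).trans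
    (Finset.expect_comm _ _ _)).trans ?_
  refine (Finset.expect_congr rfl fun ρ _ => expect_ite_pair ρ fun T =>
    advantage c f (cyc T ++ List.ofFn z)).trans ?_
  rw [Fintype.expect_const]

/-- The gain dominates an affine function of the correlation, so its mean is at least `(2/m - 1/m) /
(128 m)`. The second-moment bound applies to the gains at all shifts, and `P ≥ 256 m ^ 2` makes its
diagonal term at most half of the main term. -/
theorem gain_pairs [NeZero P] (hPk : P ≤ k) {m : ℕ} (hm : 1 ≤ m)
    (hA : 2 / m ≤ 𝔼 x : Fin k → κ, advantage c f (List.ofFn x)) (hP : 256 * m ^ 2 ≤ P) :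
    P * (1 / (128 * (m : ℝ) ^ 2)) ^ 2 / 2 ≤ ∑ d ∈ Finset.univ.erase (0 : ZMod P),
      𝔼 z : Fin (k - P) → κ, 𝔼 X : ZMod P → κ, 𝔼 Y : ZMod P → κ,
        gain m (corr c f (List.ofFn z) 0 X Y) * gain m (corr c f (List.ofFn z) d X Y) := by
  let Ω := (Fin (k - P) → κ) × (ZMod P → κ) × (ZMod P → κ)
  let F : ZMod P → Ω → ℝ := fun a ω => gain m (corr c f (List.ofFn ω.1) a ω.2.1 ω.2.2)
  have hm' : (1 : ℝ) ≤ m := by exact_mod_cast hm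
  let shiftEquiv : ZMod P → Ω ≃ Ω := fun a => Equiv.prodCongr (Equiv.refl _)
    (Equiv.prodCongr (Equiv.arrowCongr (Equiv.addRight a).symm (Equiv.refl κ)) (Equiv.refl _))
  have hshift : ∀ a b ω, F b (shiftEquiv a ω) = F (b + a) ω := fun a b ω =>
    congrArg (gain m) (corr_shift c f _ b a _ _)
  have hH : ∀ a b, 𝔼 ω, F a ω * F b ω = 𝔼 ω, F 0 ω * F (b - a) ω := fun a b =>
    Fintype.expect_equiv (shiftEquiv a) _ _ fun ω => by
      rw [hshift, hshift, zero_add, sub_add_cancel]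
  have hτ : ∀ a, 𝔼 ω, F a ω = 𝔼 ω, F 0 ω := fun a =>
    Fintype.expect_equiv (shiftEquiv a) _ _ fun ω => by rw [hshift, zero_add]
  have h1 := sum_pair_ge F (fun d => 𝔼 ω, F 0 ω * F d ω) hH hτ (fun _ _ => gain_nonneg _ _)
    fun _ _ => gain_le_one hm (corr_le_one _ _ _ _ _ _)
  have h2 : 1 / (128 * (m : ℝ) ^ 2) ≤ 𝔼 ω, F 0 ω := by
    calc 1 / (128 * (m : ℝ) ^ 2) = (2 / m - 1 / m) / (128 * m) := by field_simp; norm_num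
      _ ≤ ((𝔼 ω : Ω, corr c f (List.ofFn ω.1) 0 ω.2.1 ω.2.2) - 1 / m) / (128 * m) := by
          gcongr
          rw [← expect_corr_zero (P := P) c f hPk] at hA
          refine hA.trans (le_of_eq ?_)
          simp only [Ω, ← Finset.univ_product_univ, Finset.expect_product]
      _ = 𝔼 ω : Ω, (corr c f (List.ofFn ω.1) 0 ω.2.1 ω.2.2 - 1 / (m : ℝ)) / (128 * m) := by
          rw [← Finset.expect_div, Finset.expect_sub_distrib, Fintype.expect_const]
      _ ≤ _ := Finset.expect_le_expect fun ω _ => le_max_right _ _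
  have h3 : ∀ d, 𝔼 ω, F 0 ω * F d ω = 𝔼 z : Fin (k - P) → κ, 𝔼 X : ZMod P → κ, 𝔼 Y : ZMod P → κ,
        gain m (corr c f (List.ofFn z) 0 X Y) * gain m (corr c f (List.ofFn z) d X Y) := by
    intro d
    simp only [F, Ω, ← Finset.univ_product_univ, Finset.expect_product]
  simp only [← h3]
  refine le_trans ?_ h1
  set τ := 𝔼 ω, F 0 ω
  set τ₀ := 1 / (128 * (m : ℝ) ^ 2) with hτ₀
  have hτ₀0 : 0 < τ₀ := by positivity
  have hP' : (256 * m ^ 2 : ℝ) ≤ P := by exact_mod_cast hP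
  have h4 : 2 ≤ P * τ₀ := by
    rw [hτ₀, mul_one_div, le_div_iff₀ (by positivity)]
    linarith
  have h5 : P * τ₀ ≤ P * τ := by gcongr
  have h6 : P * τ₀ ^ 2 ≤ P * τ ^ 2 := by gcongr
  nlinarith

end

end DPXor

/-! ### Success probability of the second strategy -/

namespace DPXor
open scoped BigOperators

/-- With dilation factor `d⁻¹` the second matching becomes the shift by `d`. The permutation
`readMap` disappears because `x` and `y` are uniform. -/
theorem expect_decodeProb {κ : Type} [Fintype κ] [Nonempty κ] {P k : ℕ} [Fact P.Prime]
    (c : List κ → Dt Val) (f : κ → Bool) {m : ℕ} (hm : 1 ≤ m) {d : ZMod P} (hd : d ≠ 0) {z : List κ}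
    (hz : P + z.length = k) :
    (𝔼 X : ZMod P → κ, 𝔼 Y : ZMod P → κ, gain m (corr c f z 0 X Y) * gain m (corr c f z d X Y)) / 2 ≤
      𝔼 x : ZMod P → κ, 𝔼 y : ZMod P → κ,
        decodeProb c f m k (d⁻¹).val z (weave (fun i => x i) (fun i => y i) P) := by
  have he : (((d⁻¹).val : ℕ) : ZMod P) = d⁻¹ := ZMod.natCast_zmod_val _
  have he0 : (((d⁻¹).val : ℕ) : ZMod P) ≠ 0 := by rw [he]; exact inv_ne_zero hd
  have hreindex : ∀ g : (ZMod P → κ) → ℝ, 𝔼 X, g X = 𝔼 x, g (x ∘ readMap _ he0) := fun g =>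
    (Fintype.expect_equiv (Equiv.arrowCongr (readMap _ he0).symm (Equiv.refl κ)) _ _
      fun x => rfl).symm
  rw [hreindex]
  simp only [Finset.expect_div]
  refine Finset.expect_le_expect fun x _ => ?_
  rw [hreindex]
  refine Finset.expect_le_expect fun y _ => ?_
  have := decodeProb_ge c f he0 z hz x y hm
  rwa [show (((d⁻¹).val : ℕ) : ZMod P)⁻¹ = d by rw [he, inv_inv]] at this

/-- Bertrand's postulate at `k / 2`. -/
theorem exists_large_prime {k : ℕ} (hk : 2 ≤ k) : (Nat.findGreatest Nat.Prime k).Prime ∧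
    Nat.findGreatest Nat.Prime k ≤ k ∧ k ≤ 2 * Nat.findGreatest Nat.Prime k := by
  obtain ⟨p, hp, h1, h2⟩ := Nat.exists_prime_lt_and_le_two_mul (k / 2) (by omega)
  refine ⟨Nat.findGreatest_spec (P := Nat.Prime) hk Nat.prime_two, Nat.findGreatest_le k, ?_⟩
  have := Nat.le_findGreatest (P := Nat.Prime) (show p ≤ k by omega) hp
  omega

theorem expect_strategyTwo {k n : ℕ} (c : List (Fin n → Bool) → Dt Val) (f : (Fin n → Bool) → Bool)
    {m : ℕ} (hm : 1 ≤ m) (hk : 512 * m ^ 2 ≤ k)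
    (hA : 2 / m ≤ 𝔼 x : Fin k → Fin n → Bool, advantage c f (List.ofFn x)) :
    (1 / (128 * (m : ℝ) ^ 2)) ^ 2 / 8 ≤
      𝔼 x : Fin k → Fin n → Bool, (strategyTwo c (List.ofFn x) m).E
        fun M => if M = (List.ofFn x).map f then 1 else 0 := by
  obtain ⟨P, hPdef⟩ : ∃ P, P = Nat.findGreatest Nat.Prime k := ⟨_, rfl⟩
  have hm2 : 1 ≤ m ^ 2 := Nat.one_le_pow _ _ hm
  obtain ⟨hP, hPk, hkP⟩ := exists_large_prime (show 2 ≤ k by omega)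
  rw [← hPdef] at hP hPk hkP
  have : Fact P.Prime := ⟨hP⟩
  have hP0 : (0 : ℝ) < P := by exact_mod_cast hP.pos
  set N := 2 ^ lg P with hN
  have hPN : P < N := lt_two_pow_lg P
  have hN2 : (N : ℝ) ≤ 2 * P := by exact_mod_cast two_pow_lg_le hP.ne_zero
  have hN0 : (0 : ℝ) < N := by positivity
  let h : List (Fin n → Bool) → ℝ := fun W => 𝔼 z : Fin (k - P) → Fin n → Bool,
    (∑ e ∈ Finset.range N, decodeProb c f m k e (List.ofFn z) W) / N
  have h1 : 𝔼 x : Fin k → Fin n → Bool, 𝔼 F : Fin (P + P - k) → Fin n → Bool,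
      h ((List.ofFn F).reverse ++ List.ofFn x) ≤ 𝔼 x : Fin k → Fin n → Bool,
      (strategyTwo c (List.ofFn x) m).E fun M => if M = (List.ofFn x).map f then 1 else 0 := by
    refine Finset.expect_le_expect fun x _ => ?_
    rw [strategyTwo]
    simp only [List.length_ofFn, ← hPdef]
    rw [Dt.E_bind, E_randStrs (K := P + P - k) _ (by simp)]
    refine Finset.expect_le_expect fun F _ => ?_
    rw [Dt.E_bind, E_randStrs (K := k - P) _ (by simp)]
    refine Finset.expect_le_expect fun z _ => ?_
    rw [Dt.E_bind, E_randNum, List.length_replicate, hN, Nat.cast_pow, Nat.cast_ofNat]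
    gcongr with e _
    rw [decodeProb, Dt.E_bind]
    refine Dt.E_mono' _ fun A => ?_
    rw [Dt.E_bind]
    refine Dt.E_mono' _ fun B => ?_
    rw [Dt.E_map]
    refine Dt.E_mono' _ fun g => ?_
    split_ifs with h1 h2 h2
    · exact le_rfl
    · exact absurd (by rw [h1]; simp) h2
    · norm_num
    · exact le_rfl
  refine le_trans ?_ h1
  rw [Finset.expect_comm, expect_reverse fun L => 𝔼 x : Fin k → Fin n → Bool, h (L ++ List.ofFn x),
    ← expect_append, expect_fin_congr (show P + P - k + k = P + P by omega), expect_weave]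
  have hpairs := gain_pairs (P := P) c f hPk hm hA (by omega)
  have h2 : (∑ d ∈ Finset.univ.erase (0 : ZMod P),
      𝔼 z : Fin (k - P) → Fin n → Bool, 𝔼 X : ZMod P → Fin n → Bool, 𝔼 Y : ZMod P → Fin n → Bool,
        gain m (corr c f (List.ofFn z) 0 X Y) * gain m (corr c f (List.ofFn z) d X Y)) / 2 / N ≤
      𝔼 x : ZMod P → Fin n → Bool, 𝔼 y : ZMod P → Fin n → Bool,
        h (weave (fun i => x i) (fun i => y i) P) := by
    have h3 : 𝔼 x : ZMod P → Fin n → Bool, 𝔼 y : ZMod P → Fin n → Bool,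
        h (weave (fun i => x i) (fun i => y i) P) = (∑ e ∈ Finset.range N,
          𝔼 z : Fin (k - P) → Fin n → Bool, 𝔼 x : ZMod P → Fin n → Bool, 𝔼 y : ZMod P → Fin n → Bool,
            decodeProb c f m k e (List.ofFn z) (weave (fun i => x i) (fun i => y i) P)) / N := by
      simp only [h, ← Finset.expect_div, ← Finset.expect_sum_comm]
      congr 1
      exact (Finset.expect_congr rfl fun x _ => Finset.expect_comm _ _ _).trans
        (Finset.expect_comm _ _ _)
    rw [h3, Finset.sum_div]
    gcongr
    -- Different nonzero shifts use different factors below `P < N`. The remaining values of `e`,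
    -- which include those that are zero modulo `P` or repeat a residue, contribute nonnegative
    -- terms.
    let φ : ZMod P → ℕ := fun d => (d⁻¹).val
    have hφ : Function.Injective φ := fun a b hab => inv_injective (ZMod.val_injective P hab)
    have hnn : ∀ e, 0 ≤ 𝔼 z : Fin (k - P) → Fin n → Bool, 𝔼 x : ZMod P → Fin n → Bool,
        𝔼 y : ZMod P → Fin n → Bool,
          decodeProb c f m k e (List.ofFn z) (weave (fun i => x i) (fun i => y i) P) := fun e =>
      Finset.expect_nonneg fun _ _ => Finset.expect_nonneg fun _ _ => Finset.expect_nonneg fun _ _ =>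
        decodeProb_nonneg _ _ _ _ _ _ _
    refine le_trans ?_ (Finset.sum_le_sum_of_subset_of_nonneg
      (s := (Finset.univ.erase (0 : ZMod P)).map ⟨φ, hφ⟩) ?_ fun e _ _ => hnn e)
    · rw [Finset.sum_map]
      refine Finset.sum_le_sum fun d hd => ?_
      rw [Finset.expect_div]
      refine Finset.expect_le_expect fun z _ => ?_
      exact expect_decodeProb c f hm (Finset.ne_of_mem_erase hd) (by simp; omega)
    · intro e he
      simp only [Finset.mem_map, Function.Embedding.coeFn_mk] at he
      obtain ⟨d, -, rfl⟩ := he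
      exact Finset.mem_range.2 ((ZMod.val_lt _).trans hPN)
  refine le_trans ?_ h2
  have h4 : (P * (1 / (128 * (m : ℝ) ^ 2)) ^ 2 / 2) / 2 / N ≤ (∑ d ∈ Finset.univ.erase (0 : ZMod P),
      𝔼 z : Fin (k - P) → Fin n → Bool, 𝔼 X : ZMod P → Fin n → Bool, 𝔼 Y : ZMod P → Fin n → Bool,
        gain m (corr c f (List.ofFn z) 0 X Y) * gain m (corr c f (List.ofFn z) d X Y)) / 2 / N := by
    gcongr
  refine le_trans ?_ h4
  rw [le_div_iff₀ hN0]
  have h5 : 0 ≤ (1 / (128 * (m : ℝ) ^ 2)) ^ 2 := by positivity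
  nlinarith

end DPXor

/-! ### From runs of the machine to expectations, and the choice of constants -/

namespace DPXor
open Val
open scoped BigOperators

/-- Hides the numeral exponent, so that the final estimates are symbolic in `J`. -/
theorem exists_run_progP : ∃ J : ℕ, ∀ {β : Budget} {k m n : ℕ} {C' : Prog}
    {c : List (Fin n → Bool) → Dt Val} {X : List (Fin n → Bool)}, n ≤ β.t → X.length = k → k ≠ 0 →
    m ≠ 0 → (4 * (64 * (m * m))) ^ 4 * (2 * k) ≤ β.B →
    (∀ L : List (Fin n → Bool), L.length = k → Run β 0 C' (list ofBits L) (c L)) →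
    Run β J (progP m C') (list ofBits X) ((mainAlg c X m).map bits) :=
  ⟨90000, fun hn hX hk hm hB hC => run_progP hn hX hk hm hB hC⟩

theorem Prog.HasTime.exists_sim {k n t : ℕ} {p : Prog} (h : p.HasTime k n t) :
    ∃ c : List (Fin n → Bool) → Dt Val, ∀ L, L.length = k → Sim p (list ofBits L) (c L) t := by
  have h1 : ∀ L : List (Fin n → Bool), ∃ m, L.length = k → Sim p (list ofBits L) m t := by
    intro L
    by_cases hL : L.length = k
    · subst hL
      obtain ⟨m, hm⟩ := (h L.get).sim
      refine ⟨m, fun _ => ?_⟩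
      rwa [ofTuple_eq, List.ofFn_get] at hm
    · exact ⟨.ret .nil, fun h => absurd h hL⟩
  choose c hc using h1
  exact ⟨c, hc⟩

open Classical in
theorem success_eq {k n t : ℕ} {p : Prog} {c : List (Fin n → Bool) → Dt Val}
    (h : ∀ L, L.length = k → Sim p (list ofBits L) (c L) t) (g : (Fin k → Fin n → Bool) → Val) :
    p.success k n t g = 𝔼 x, (c (List.ofFn x)).E fun w => if w = g x then 1 else 0 := by
  rw [Prog.success, Fintype.expect_eq_sum_div_card]
  congr 1
  refine Finset.sum_congr rfl fun x _ => ?_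
  rw [ofTuple_eq]
  exact Sim.outProb_eq (h _ (by simp)) _

theorem sgn_xorPower {n : ℕ} (f : (Fin n → Bool) → Bool) (k : ℕ) (x : Fin k → Fin n → Bool) :
    sgn (xorPower f k x) = ((List.ofFn x).map fun a => sgn (f a)).prod := by
  have h : ∀ L : List Bool, sgn (L.foldr Bool.xor false) = (L.map sgn).prod := by
    intro L
    induction L with
    | nil => simp
    | cons a L ih => rw [List.foldr_cons, List.map_cons, List.prod_cons, ← ih]; exact sgn_xor _ _
  rw [xorPower, h, List.map_ofFn, List.map_ofFn]
  rfl

open Classical in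
-- Success probability `1/2 + ε` is correlation `2ε`. Reading any nonempty output as `true` can only
-- help: outputs that encode no bit counted as failures before.
theorem le_expect_advantage {k n t : ℕ} {p : Prog} {c : List (Fin n → Bool) → Dt Val}
    (h : ∀ L, L.length = k → Sim p (list ofBits L) (c L) t) (f : (Fin n → Bool) → Bool) {ε : ℝ}
    (hε : 1 / 2 + ε ≤ p.success k n t fun x => .ofBool (xorPower f k x)) :
    2 * ε ≤ 𝔼 x : Fin k → Fin n → Bool, advantage c f (List.ofFn x) := by
  rw [success_eq h] at hε
  have h1 : 𝔼 x : Fin k → Fin n → Bool, (c (List.ofFn x)).E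
      (fun w => if w = Val.ofBool (xorPower f k x) then (1 : ℝ) else 0) ≤
      𝔼 x : Fin k → Fin n → Bool, (1 + advantage c f (List.ofFn x)) / 2 := by
    refine Finset.expect_le_expect fun x _ => ?_
    rw [advantage, ← sgn_xorPower]
    have h2 : (1 + (c (List.ofFn x)).E (fun w => sgn (!w.isNil)) * sgn (xorPower f k x)) / 2 =
        (c (List.ofFn x)).E fun w => (1 / 2 + 1 / 2 * (sgn (!w.isNil) * sgn (xorPower f k x))) := by
      rw [Dt.E_add, Dt.E_const, Dt.E_mul_left, Dt.E_mul_right]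
      ring
    rw [h2]
    refine Dt.E_mono' _ fun w => ?_
    split_ifs with hw
    · rw [hw]
      cases xorPower f k x <;> simp [Val.ofBool, Val.isNil] <;> norm_num
    · have h3 : |sgn (!w.isNil) * sgn (xorPower f k x)| = 1 := by rw [abs_mul, abs_sgn, abs_sgn, one_mul]
      have := (abs_le.1 h3.le).1
      linarith
  rw [← Finset.expect_div, Finset.expect_add_distrib, Fintype.expect_const] at h1
  linarith

/-- From `1 / (2 * √k)` and `2 * √512 < 46`. -/
theorem centralBinom_ratio_ge {k m : ℕ} (hk : k ≠ 0) (hm : 1 ≤ m) (hkm : k < 512 * m ^ 2) :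
    1 / (46 * (m : ℝ)) ≤ ((k + k).choose k : ℝ) / 2 ^ (k + k) := by
  have hm' : (1 : ℝ) ≤ m := by exact_mod_cast hm
  have hkm' : (k : ℝ) ≤ 512 * m ^ 2 := by exact_mod_cast hkm.le
  have h1 := sixteen_pow_le hk
  rw [div_le_div_iff₀ (by positivity) (by positivity), one_mul]
  refine le_of_sq_le_sq ?_ (by positivity)
  have h2 : ((2 : ℝ) ^ (k + k)) ^ 2 = 16 ^ k := by
    rw [← two_mul, pow_mul, ← pow_mul, mul_comm k 2, pow_mul]; norm_num
  rw [h2]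
  refine h1.trans ?_
  have h3 := sq_nonneg ((k + k).choose k : ℝ)
  nlinarith [mul_le_mul_of_nonneg_right hkm' h3]

theorem expect_mainAlg {k n : ℕ} (c : List (Fin n → Bool) → Dt Val) (f : (Fin n → Bool) → Bool)
    {m : ℕ} (hm : 1 ≤ m) (hk : k ≠ 0)
    (hA : 2 / m ≤ 𝔼 x : Fin k → Fin n → Bool, advantage c f (List.ofFn x)) :
    1 / (600000 * (m : ℝ) ^ 4) ≤ 𝔼 x : Fin k → Fin n → Bool, (mainAlg c (List.ofFn x) m).E
        fun M => if M = (List.ofFn x).map f then 1 else 0 := by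
  have hm' : (1 : ℝ) ≤ m := by exact_mod_cast hm
  simp only [mainAlg, Dt.E_bind, Dt.E_coin, if_true, Bool.false_eq_true, if_false]
  rw [← Finset.expect_div, Finset.expect_add_distrib]
  have hnn : ∀ D : (Fin k → Fin n → Bool) → Dt (List Bool), 0 ≤ 𝔼 x, (D x).E
      fun M => if M = (List.ofFn x).map f then (1 : ℝ) else 0 := fun D =>
    Finset.expect_nonneg fun _ _ => Dt.E_nonneg _ fun _ => by split_ifs <;> norm_num
  have hnn1 := hnn fun x => strategyOne c (List.ofFn x) m
  have hnn2 := hnn fun x => strategyTwo c (List.ofFn x) m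
  rcases Nat.lt_or_ge k (512 * m ^ 2) with h | h
  · have h1 := expect_strategyOne (k := k) c f hm
    have h2 := centralBinom_ratio_ge hk hm h
    have h3 : 1 / (46 * (m : ℝ)) * (2 / m) ≤ ((k + k).choose k : ℝ) / 2 ^ (k + k) *
        𝔼 x : Fin k → Fin n → Bool, advantage c f (List.ofFn x) := by gcongr
    -- The constant `600000` comes from here: `(2/46 - 1/64) / (128 * 64)` slightly exceeds
    -- `2/600000`, where the factor `2` pays for the coin between the strategies.
    have h4 : 2 * (1 / (600000 * (m : ℝ) ^ 4)) ≤ (1 / (46 * (m : ℝ)) * (2 / m) -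
        1 / (64 * (m * m) : ℕ)) / (128 * (64 * (m * m) : ℕ)) := by
      push_cast
      rw [le_div_iff₀ (by positivity)]
      have e1 : 2 * (1 / (600000 * (m : ℝ) ^ 4)) * (128 * (64 * (m * m))) =
          (2 * 128 * 64 / 600000) * (1 / m ^ 2) := by field_simp
      have e2 : 1 / (46 * (m : ℝ)) * (2 / m) - 1 / (64 * (m * m)) = (2 / 46 - 1 / 64) * (1 / m ^ 2) := by
        field_simp
      rw [e1, e2]
      gcongr
      norm_num
    have h5 : (1 / (46 * (m : ℝ)) * (2 / m) - 1 / (64 * (m * m) : ℕ)) / (128 * (64 * (m * m) : ℕ)) ≤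
        (((k + k).choose k : ℝ) / 2 ^ (k + k) *
          𝔼 x : Fin k → Fin n → Bool, advantage c f (List.ofFn x) - 1 / (64 * (m * m) : ℕ)) /
            (128 * (64 * (m * m) : ℕ)) := by gcongr
    linarith
  · have h1 := expect_strategyTwo c f hm h hA
    have h2 : 2 * (1 / (600000 * (m : ℝ) ^ 4)) ≤ (1 / (128 * (m : ℝ) ^ 2)) ^ 2 / 8 := by
      have e1 : (1 / (128 * (m : ℝ) ^ 2)) ^ 2 / 8 = (1 / (128 ^ 2 * 8)) * (1 / m ^ 4) := by
        field_simp
      have e2 : 2 * (1 / (600000 * (m : ℝ) ^ 4)) = (2 / 600000) * (1 / m ^ 4) := by field_simp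
      rw [e1, e2]
      exact mul_le_mul_of_nonneg_right (by norm_num) (by positivity)
    linarith

/-- The base is `256 ^ 4 * 2 * m ^ 8 * k`; with `m ≤ 2 / ε` it is at most `2 ^ 41 * (k / ε) ^ 8`. -/
theorem time_bound {k m J t : ℕ} {ε : ℝ} (hk : 1 ≤ k) (hε0 : 0 < ε) (hm : m ≤ 2 / ε) :
    ((((4 * (64 * (m * m))) ^ 4 * (2 * k)) ^ J * t : ℕ) : ℝ) ≤
      ((2 ^ 41) ^ J : ℕ) * (k / ε) ^ (8 * J) * t := by
  have hk' : (1 : ℝ) ≤ k := by exact_mod_cast hk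
  have h : (((4 * (64 * (m * m))) ^ 4 * (2 * k) : ℕ) : ℝ) ≤ ((2 ^ 41 : ℕ) : ℝ) * (k / ε) ^ 8 := by
    rw [Nat.cast_pow 2]
    push_cast
    refine le_trans (b := 2 ^ 41 * (k / ε) ^ 8) ?_ (by norm_num)
    calc (4 * (64 * ((m : ℝ) * m))) ^ 4 * (2 * k) = 256 ^ 4 * 2 * (m ^ 8 * k) := by ring
      _ ≤ 256 ^ 4 * 2 * ((2 / ε) ^ 8 * k ^ 8) := by
          gcongr
          exact le_self_pow₀ hk' (by norm_num)
      _ = 2 ^ 41 * (k / ε) ^ 8 := by rw [div_pow, div_pow]; ring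
  rw [Nat.cast_mul, Nat.cast_pow, Nat.cast_pow (2 ^ 41), pow_mul, ← mul_pow]
  gcongr

end DPXor

open scoped BigOperators

open DPXor in
theorem theorem1 :
    ∃ (A : Prog) (α : ℝ) (D e : ℕ), 0 < α ∧
      ∀ (k : ℕ) (ε : ℝ), 0 < ε → ε < 1 → (2 : ℝ)⁻¹ ^ k < ε →
      ∀ (n : ℕ) (f : (Fin n → Bool) → Bool) (t : ℕ) (C' : Prog), n ≤ t →
        C'.HasTime k n t →
        1 / 2 + ε ≤ C'.success k n t (fun x => .ofBool (xorPower f k x)) →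
        ∃ s : ℕ, ∀ c ∈ (A.run s (.cons (.ofNat k) (.cons (.ofNat ⌈1 / ε⌉₊) C'.code))).support,
          ∃ C : Prog, c = .ret C.code [] ∧
            ∃ t' : ℕ, (t' : ℝ) ≤ D * (k / ε) ^ e * t ∧
              C.HasTime k n t' ∧
              α * ε ^ 4 ≤ C.success k n t' (fun x => .ofBits (directProduct f k x)) := by
  obtain ⟨A, hA⟩ := exists_builder
  obtain ⟨J, hJ⟩ := exists_run_progP
  refine ⟨A, 1 / 9600000, (2 ^ 41) ^ J, 8 * J, by norm_num, ?_⟩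
  intro k ε hε0 hε1 hεk n f t C' hnt hT hS
  obtain ⟨s, hs⟩ := hA k ⌈1 / ε⌉₊ C'
  refine ⟨s, fun cfg hcfg => ⟨progP ⌈1 / ε⌉₊ C', ?_, ?_⟩⟩
  · rw [hs.run_eq] at hcfg
    simpa [Dt.pmf] using hcfg
  -- For `k = 0` the lower bound for `ε` would read `1 < ε`.
  have hk : k ≠ 0 := by
    rintro rfl
    simp at hεk
    linarith
  -- After zero steps the machine is still in its initial `call` configuration.
  have ht : 1 ≤ t := by
    rcases Nat.eq_zero_or_pos t with rfl | h
    · obtain ⟨w, hw⟩ := hT (fun _ _ => false) (.call C' (.ofTuple fun (_ : Fin k) (_ : Fin n) => false) []) (by simp [Prog.run, runFor])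
      cases hw
    · exact h
  obtain ⟨m, hm⟩ : ∃ m, m = ⌈1 / ε⌉₊ := ⟨_, rfl⟩
  rw [← hm]
  have hε1' : 1 ≤ 1 / ε := (one_le_div hε0).2 hε1.le
  have hm1 : 1 / ε ≤ m := hm ▸ Nat.le_ceil _
  have hm2 : (m : ℝ) ≤ 2 / ε := by
    have := Nat.ceil_lt_add_one (show 0 ≤ 1 / ε by positivity)
    rw [← hm] at this
    have e : 2 / ε = 1 / ε + 1 / ε := by ring
    linarith
  have hm0 : 1 ≤ m := by exact_mod_cast hε1'.trans hm1
  have hm0' : (0 : ℝ) < m := by exact_mod_cast hm0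
  obtain ⟨c, hc⟩ := hT.exists_sim
  have hadv := le_expect_advantage hc f hS
  have hB : 64 ≤ (4 * (64 * (m * m))) ^ 4 * (2 * k) := by
    have h1 : 64 ≤ 4 * (64 * (m * m)) := by nlinarith
    exact (h1.trans (Nat.le_self_pow (by norm_num) _)).trans
      (Nat.le_mul_of_pos_right _ (by omega))
  let β : Budget := ⟨(4 * (64 * (m * m))) ^ 4 * (2 * k), t, hB, ht⟩
  have hrun : ∀ X : List (Fin n → Bool), X.length = k →
      Sim (progP m C') (Val.list Val.ofBits X) ((mainAlg c X m).map Val.bits)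
        (((4 * (64 * (m * m))) ^ 4 * (2 * k)) ^ J * t) := fun X hX =>
    hJ (β := β) hnt hX hk (by omega) le_rfl fun L hL => by
      have := hc L hL
      rwa [Run, pow_zero, one_mul]
  refine ⟨_, time_bound (J := J) (by omega) hε0 hm2, fun x => ?_, ?_⟩
  · rw [ofTuple_eq]
    exact (hrun _ (by simp)).haltsWithin
  · rw [success_eq hrun]
    have h2 : 2 / (m : ℝ) ≤ 𝔼 x : Fin k → Fin n → Bool, advantage c f (List.ofFn x) := by
      refine le_trans ?_ hadv
      rw [div_le_iff₀ hm0']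
      rw [div_le_iff₀ hε0] at hm1
      linarith
    have h3 := expect_mainAlg c f hm0 hk h2
    -- Since `m * ε ≤ 2`, replacing `m` by `1 / ε` costs a factor `2 ^ 4`, and `9600000 = 16 *
    -- 600000`.
    have h4 : 1 / 9600000 * ε ^ 4 ≤ 1 / (600000 * (m : ℝ) ^ 4) := by
      rw [le_div_iff₀ (by positivity)]
      have h5 : (m : ℝ) * ε ≤ 2 := by rwa [le_div_iff₀ hε0] at hm2
      have h6 : ((m : ℝ) * ε) ^ 4 ≤ 2 ^ 4 := by gcongr
      linarith [show 1 / 9600000 * ε ^ 4 * (600000 * (m : ℝ) ^ 4) = 1 / 16 * ((m : ℝ) * ε) ^ 4 by ring]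
    refine (h4.trans h3).trans (Finset.expect_le_expect fun x _ => ?_)
    rw [Dt.E_map]
    refine Dt.E_mono' _ fun M => ?_
    split_ifs with h6 h7 h7
    · exact le_rfl
    · refine absurd ?_ h7
      rw [h6, ofBits_eq, List.map_ofFn]
      rfl
    · norm_num
    · exact le_rfl
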